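/- Let $\mathcal C$ be a category with a subcategory of \emph{covers} such that: (1) $\mathcal C$ has a terminal object $*$ and every map $X\to *$ is a cover; (2) pullbacks of covers along arbitrary maps exist and are covers; (3) if $fg$ and $g$ are covers, so is $f$; (4) every cover is the coequalizer of its kernel pair. Assume that $\mathcal C$ has enough points: whenever $u\neq v$ are parallel maps in $\mathcal C$ there is a functor $p\colon\mathcal C\to\mathrm{Set}$ that preserves finite limits and arbitrary colimits and takes covers to surjections, with $p(u)\ne p(v)$. For a simplicial object $X_\bullet$ in $\mathcal C$ and a simplicial set $S$ let $\hom(S,X)=\lim_{\Delta^k\to S}X_k$, when this limit exists. For $n\in\mathbb N\cup\{\infty\}$, $X_\bullet$ is a \emph{Lie $n$-groupoid} if for all $k>0$, $0\le i\le k$ the limit $\hom(\Lambda^k_i,X)$ exists and $X_k\to\hom(\Lambda^k_i,X)$ is a cover, and an isomorphism if $k>n$. A map $f\colon X_\bullet\to Y_\bullet$ of Lie $\infty$-groupoids is an \emph{$n$-stack} if for all $k>0$, $0\le i\le k$ the limit $\Lambda^k_i(f)=\hom(\Lambda^k_i,X)\times_{\hom(\Lambda^k_i,Y)}Y_k$ exists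 and $\lambda^k_i(f)\colon X_k\to\Lambda^k_i(f)$ is a cover, and an isomorphism if $k>n$. Let $n\ge 0$ be an integer and $f\colon X_\bullet\to Y_\bullet$ an $\infty$-stack. The simplicial object $P^{\ge n}(f)_\bullet$ has as $\ell$-simplices those $x\in X_{n+\ell}$ for which $f(x)$ and the faces $d_ix$, $i<n$, are constant in the last $\ell+1$ vertices, i.e. $f(x)=e^*f(x)$ and $d_ix=d_ie^*x$ for $i<n$, where $e\colon[n+\ell]\to[n+\ell]$, $e(j)=\min(j,n)$; the simplicial structure is that of the last $\ell+1$ vertices. So $P^{\ge n}(f)_0=X_n$, and for $n=0$ it is the pullback $Y_0\times_{Y_\bullet}X_\bullet$. Its \emph{orbit space} is a cover $X_n\to\pi_0(P^{\ge n}(f))$ that is a coequalizer of the two face maps $P^{\ge n}(f)_1\rightrightarrows P^{\ge n}(f)_0=X_n$. An \emph{$n$-strictification} of $f$ is a simplicial map $\tau_n(f)\colon\tau_n(X,f)_\bullet\to Y_\bullet$ together with a simplicial map $q\colon X_\bullet\to\tau_n(X,f)_\bullet$ with $\tau_n(f)\,q=f$, such that: $q_k$ is an isomorphism for $k<n$;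 $q_n$ is an orbit space $X_n\to\pi_0(P^{\ge n}(f))$; $\Lambda^{n+1}_1(\tau_n(f))$ exists and $\lambda^{n+1}_1(\tau_n(f))$ is an isomorphism; and $\tau_n(f)$ is relatively $(n+1)$-coskeletal, i.e. for every $k$ the canonical map from $\tau_n(X,f)_k$ to $\hom(\mathrm{sk}_{n+1}\Delta^k,\tau_n(X,f))\times_{\hom(\mathrm{sk}_{n+1}\Delta^k,Y)}Y_k$ is an isomorphism onto this limit, which exists. \textbf{Proposition.} Let $f\colon X_\bullet\to Y_\bullet$ be an $\infty$-stack such that the orbit space $\pi_0(P^{\ge n}(f))$ exists. Then an $n$-strictification of $f$ exists. For every $n$-strictification $(\tau_n(f),q)$ the map $\tau_n(f)$ is an $n$-stack, and the following are equivalent: (a) $f$ is an $n$-stack; (b) $f$ and $\tau_n(f)$ are isomorphic as maps of simplicial objects; (c) $f$ and $\tau_n(f)$ are isomorphic over $Y_\bullet$; (d) the canonical map $q$ is an isomorphism. -/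

import Mathlib

open CategoryTheory CategoryTheory.Limits Opposite Simplicial

universe v u

namespace HigherStack

variable {C : Type u} [Category.{v} C]

/-! ### Categories with covers, and points -/

/-- The axioms for a category with a subcategory of covers. -/
structure IsCovers (W : MorphismProperty C) : Prop where
  /-- the covers form a subcategory -/
  isMultiplicative : W.IsMultiplicative
  /-- there is a terminal object, and every map to it is a cover -/
  exists_terminal : ∃ T : C, Nonempty (IsTerminal T) ∧ ∀ (A : C) (t : A ⟶ T), W t
  /-- pullbacks of covers along arbitrary maps exist ... -/
  hasPullback : ∀ {A B D : C} (g : A ⟶ D) (f : B ⟶ D), W f → HasPullback g f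
  /-- ... and are covers -/
  isStableUnderBaseChange : W.IsStableUnderBaseChange
  /-- right cancellation -/
  cancel : ∀ {A B D : C} (g : A ⟶ B) (f : B ⟶ D), W (g ≫ f) → W g → W f
  /-- a cover is an effective epimorphism: it is the coequalizer of its kernel pair -/
  effectiveEpi : ∀ {A B K : C} (f : A ⟶ B) (a b : K ⟶ A) (h : IsKernelPair f a b),
    W f → Nonempty (IsColimit (Cofork.ofπ f h.w))

/-- A point: a functor to sets which preserves finite limits and arbitrary colimits, and takes
covers to surjections. -/
structure IsPoint (W : MorphismProperty C) (p : C ⥤ Type v) : Prop where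
  preservesFiniteLimits : PreservesFiniteLimits p
  preservesColimits : PreservesColimits p
  surjective : ∀ {A B : C} (f : A ⟶ B), W f → Function.Surjective (p.map f)

/-- There are enough points: distinct parallel maps are distinguished by some point. -/
def EnoughPoints (W : MorphismProperty C) : Prop :=
  ∀ {A B : C} (f g : A ⟶ B), f ≠ g → ∃ p : C ⥤ Type v, IsPoint W p ∧ p.map f ≠ p.map g

/-! ### The (partially defined) limits `hom(S, X)` and relative versions

A limit in `C` of a diagram built from the objects `X_k` exists if and only if the presheaf
`c ↦ lim Hom(c, X_k)` is representable, and is then a representing object.  As a simplicial set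
`S` is the colimit of its simplices, the presheaf for `hom(S, X) = lim_{Δ^k → S} X_k` is
`c ↦ Hom_sSet(S, Hom(c, X))`. -/

/-- The simplicial set `Hom(c, X)` with `k`-simplices `Hom(c, X_k)`, as a functor of the
simplicial object `X` and the object `c`. -/
def pts : SimplicialObject C ⥤ Cᵒᵖ ⥤ SSet.{v} :=
  (coyoneda ⋙ SimplicialObject.whiskering C (Type v)).flip

/-- The presheaf whose representing object, if it exists, is the limit `hom(S, X)`. -/
def homPresheaf (S : SSet.{v}) (X : SimplicialObject C) : Cᵒᵖ ⥤ Type v :=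
  pts.obj X ⋙ coyoneda.obj (op S)

/-- The presheaf whose representing object, if it exists, is the limit
`hom(S, X) ×_{hom(S, Y)} hom(T, Y)`; here `i : S ⟶ T` and `f : X ⟶ Y`. -/
def relPresheaf {S T : SSet.{v}} (i : S ⟶ T) {X Y : SimplicialObject C} (f : X ⟶ Y) :
    Cᵒᵖ ⥤ Type v where
  obj c := { p : (S ⟶ (pts.obj X).obj c) × (T ⟶ (pts.obj Y).obj c) //
    p.1 ≫ (pts.map f).app c = i ≫ p.2 }
  map φ := ↾fun p => ⟨(p.1.1 ≫ (pts.obj X).map φ, p.1.2 ≫ (pts.obj Y).map φ), by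
    have h := p.2
    simp only [Category.assoc, NatTrans.naturality]
    rw [reassoc_of% h]⟩

/-- The tautological `k`-simplex of `Hom(X_k, X)`. -/
def tautSimplex (X : SimplicialObject C) (k : ℕ) :
    Δ[k] ⟶ (pts.obj X).obj (op (X _⦋k⦌)) :=
  SSet.yonedaEquiv.symm (𝟙 (X _⦋k⦌) : X _⦋k⦌ ⟶ X _⦋k⦌)

/-- For `i : S ⟶ Δ^k` and a limit `L = hom(S, X)`, the map `X_k ⟶ hom(S, X)` induced by `i`. -/
def homMap {S : SSet.{v}} {k : ℕ} (i : S ⟶ Δ[k]) {X : SimplicialObject C} {L : C}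
    (R : (homPresheaf S X).RepresentableBy L) : X _⦋k⦌ ⟶ L :=
  R.homEquiv.symm (i ≫ tautSimplex X k : S ⟶ (pts.obj X).obj (op (X _⦋k⦌)))

/-- For `i : S ⟶ Δ^k` and a limit `L = hom(S, X) ×_{hom(S, Y)} Y_k`, the map `X_k ⟶ L` induced
by `i` and `f`. -/
def relMap {S : SSet.{v}} {k : ℕ} (i : S ⟶ Δ[k]) {X Y : SimplicialObject C} (f : X ⟶ Y) {L : C}
    (R : (relPresheaf i f).RepresentableBy L) : X _⦋k⦌ ⟶ L :=
  R.homEquiv.symm ⟨(i ≫ tautSimplex X k, tautSimplex X k ≫ (pts.map f).app _), by simp⟩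

/-! ### Lie `n`-groupoids and `n`-stacks -/

/-- `X` is a Lie `n`-groupoid: for `k > 0` the limit `Λ^k_i(X) = hom(Λ^k_i, X)` exists, and
`λ^k_i(X) : X_k ⟶ Λ^k_i(X)` is a cover, and an isomorphism if `k > n`. -/
def IsLieGroupoid (W : MorphismProperty C) (n : ℕ∞) (X : SimplicialObject C) : Prop :=
  ∀ k : ℕ, 0 < k → ∀ i : Fin (k + 1),
    ∃ (L : C) (R : (homPresheaf (SSet.horn k i).toSSet X).RepresentableBy L),
      W (homMap (SSet.horn k i).ι R) ∧ (n < (k : ℕ∞) → IsIso (homMap (SSet.horn k i).ι R))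

/-- `f : X ⟶ Y` is an `n`-stack: `X` and `Y` are Lie `∞`-groupoids, for `k > 0` the limit
`Λ^k_i(f) = hom(Λ^k_i, X) ×_{hom(Λ^k_i, Y)} Y_k` exists, and `λ^k_i(f) : X_k ⟶ Λ^k_i(f)` is a
cover, and an isomorphism if `k > n`. -/
structure IsStack (W : MorphismProperty C) (n : ℕ∞) {X Y : SimplicialObject C} (f : X ⟶ Y) :
    Prop where
  source : IsLieGroupoid W ⊤ X
  target : IsLieGroupoid W ⊤ Y
  horn : ∀ k : ℕ, 0 < k → ∀ i : Fin (k + 1),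
    ∃ (L : C) (R : (relPresheaf (SSet.horn k i).ι f).RepresentableBy L),
      W (relMap (SSet.horn k i).ι f R) ∧ (n < (k : ℕ∞) → IsIso (relMap (SSet.horn k i).ι f R))

/-! ### Relative higher morphism spaces -/

/-- The ordinal sum `id + θ : [k-1] + [a] → [k-1] + [b]`, where `[k-1] + [a] = [k+a]`. -/
def joinHom (k : ℕ) {a b : ℕ} (θ : Fin (a + 1) →o Fin (b + 1)) :
    Fin (k + a + 1) →o Fin (k + b + 1) where
  toFun i := if h : i.1 < k then ⟨i.1, by omega⟩ else ⟨k + (θ ⟨i.1 - k, by omega⟩).1, by omega⟩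
  monotone' := by
    intro i j hij
    have hij' : i.1 ≤ j.1 := hij
    by_cases hi : i.1 < k
    · by_cases hj : j.1 < k
      · simpa [hi, hj] using hij'
      · simp only [hi, hj, dite_true, dite_false, Fin.mk_le_mk]; omega
    · have hj : ¬ j.1 < k := by omega
      simp only [hi, hj, dite_false, Fin.mk_le_mk, add_le_add_iff_left]
      exact θ.monotone (by simp only [Fin.mk_le_mk]; omega)

theorem joinHom_of_lt (k : ℕ) {a b : ℕ} (θ : Fin (a + 1) →o Fin (b + 1)) (i : Fin (k + a + 1))
    (h : i.1 < k) : (joinHom k θ i).1 = i.1 :=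
  congrArg Fin.val (dif_pos h)

theorem joinHom_of_not_lt (k : ℕ) {a b : ℕ} (θ : Fin (a + 1) →o Fin (b + 1))
    (i : Fin (k + a + 1)) (h : ¬ i.1 < k) :
    (joinHom k θ i).1 = k + (θ ⟨i.1 - k, by omega⟩).1 :=
  congrArg Fin.val (dif_neg h)

/-- The functor `[m] ↦ [k-1] + [m] = [k+m]`; it is the identity for `k = 0`. -/
def joinFunctor (k : ℕ) : SimplexCategory ⥤ SimplexCategory where
  obj m := ⦋k + m.len⦌
  map θ := SimplexCategory.Hom.mk (joinHom k θ.toOrderHom)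
  map_id m := by
    ext i : 3
    apply Fin.ext
    by_cases h : i.1 < k
    · exact joinHom_of_lt k _ i h
    · refine (joinHom_of_not_lt k _ i h).trans ?_
      simp; omega
  map_comp {a b c} θ θ' := by
    ext i : 3
    apply Fin.ext
    change (joinHom k (θ ≫ θ').toOrderHom i).1 =
      (joinHom k θ'.toOrderHom (joinHom k θ.toOrderHom i)).1
    by_cases h : i.1 < k
    · rw [joinHom_of_lt _ _ _ h, joinHom_of_lt _ _ _ (by rwa [joinHom_of_lt _ _ _ h]),
        joinHom_of_lt _ _ _ h]
    · have h1 := joinHom_of_not_lt k θ.toOrderHom i h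
      rw [joinHom_of_not_lt _ _ _ h, joinHom_of_not_lt _ _ _ (by omega)]
      simp [h1]

/-- The simplicial subset `∂Δ^{k-1} ⋆ Δ^m` of `Δ^{k-1} ⋆ Δ^m = Δ^{k+m}`.  It is the union of
the faces of `Δ^{k+m}` opposite to the vertices `0, ..., k-1`: a simplex belongs to it if and only
if it avoids at least one of these vertices.  It is empty for `k = 0`. -/
def boundaryJoin (k m : ℕ) : (Δ[k + m] : SSet.{v}).Subcomplex where
  obj _ := Set.ofPred (fun s => ∃ j : ℕ, j < k ∧ ∀ t, (SSet.stdSimplex.asOrderHom s t).1 ≠ j)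
  map φ s hs := by
    obtain ⟨j, hj, h⟩ := hs
    exact ⟨j, hj, fun t => h _⟩

/-- The map `1 ⋆ θ : Δ^{k-1} ⋆ Δ^a ⟶ Δ^{k-1} ⋆ Δ^b`. -/
def joinMap (k : ℕ) {a b : SimplexCategory} (θ : a ⟶ b) :
    (Δ[k + a.len] : SSet.{v}) ⟶ Δ[k + b.len] :=
  SSet.stdSimplex.map ((joinFunctor k).map θ)

theorem boundaryJoin_le (k : ℕ) {a b : SimplexCategory} (θ : a ⟶ b) :
    boundaryJoin.{v} k a.len ≤ (boundaryJoin k b.len).preimage (joinMap k θ) := by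
  rintro d s ⟨j, hj, h⟩
  refine ⟨j, hj, fun t ht => ?_⟩
  change (joinHom k θ.toOrderHom (SSet.stdSimplex.asOrderHom s t)).1 = j at ht
  by_cases h' : (SSet.stdSimplex.asOrderHom s t).1 < k
  · rw [joinHom_of_lt _ _ _ h'] at ht
    exact h t ht
  · rw [joinHom_of_not_lt _ _ _ h'] at ht
    omega

/-- The map `1 ⋆ θ : ∂Δ^{k-1} ⋆ Δ^a ⟶ ∂Δ^{k-1} ⋆ Δ^b`. -/
def boundaryJoinMap (k : ℕ) {a b : SimplexCategory} (θ : a ⟶ b) :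
    (boundaryJoin.{v} k a.len).toSSet ⟶ (boundaryJoin.{v} k b.len).toSSet :=
  SSet.Subcomplex.lift ((boundaryJoin k a.len).ι ≫ joinMap k θ) (by
    rintro d _ ⟨x, rfl⟩
    exact boundaryJoin_le k θ d x.2)

theorem boundaryJoinMap_ι (k : ℕ) {a b : SimplexCategory} (θ : a ⟶ b) :
    boundaryJoinMap.{v} k θ ≫ (boundaryJoin k b.len).ι = (boundaryJoin k a.len).ι ≫ joinMap k θ :=
  rfl

theorem joinMap_id (k : ℕ) (a : SimplexCategory) : joinMap.{v} k (𝟙 a) = 𝟙 _ := by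
  simp only [joinMap, CategoryTheory.Functor.map_id]
  exact CategoryTheory.Functor.map_id _ _

theorem joinMap_comp (k : ℕ) {a b c : SimplexCategory} (θ : a ⟶ b) (θ' : b ⟶ c) :
    joinMap.{v} k (θ ≫ θ') = joinMap k θ ≫ joinMap k θ' := by
  simp only [joinMap, Functor.map_comp]
  exact Functor.map_comp _ _ _

theorem boundaryJoinMap_comp (k : ℕ) {a b c : SimplexCategory} (θ : a ⟶ b) (θ' : b ⟶ c) :
    boundaryJoinMap.{v} k (θ ≫ θ') = boundaryJoinMap k θ ≫ boundaryJoinMap k θ' := by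
  rw [← cancel_mono (boundaryJoin k c.len).ι]
  simp only [Category.assoc, boundaryJoinMap_ι, joinMap_comp]
  rw [← Category.assoc, ← Category.assoc, boundaryJoinMap_ι]

/-- The functor `A ↦ A^{Δ^{k-1} ⋆}`, where `A^{Δ^{k-1} ⋆}` has `m`-simplices `A_{k+m}`. -/
def shift (k : ℕ) : SSet.{v} ⥤ SSet.{v} :=
  (Functor.whiskeringLeft SimplexCategoryᵒᵖ SimplexCategoryᵒᵖ (Type v)).obj (joinFunctor k).op

/-- The value at `c` of the relative higher morphism space `P^{≥k}(f)`, the pullback of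
`X^{Δ^{k-1} ⋆} ⟶ X^{∂Δ^{k-1} ⋆} ×_{Y^{∂Δ^{k-1} ⋆}} Y^{Δ^{k-1} ⋆}` along the inclusion of the
constant simplicial object on the vertices of the target.  The inclusion is a monomorphism, so the
pullback consists of the simplices `x` of `X^{Δ^{k-1} ⋆}` whose image in the target, i.e. the
restriction of `x` to `∂Δ^{k-1} ⋆ Δ^m` together with `f x`, is the degeneracy of a vertex `h`. -/
def higherMorphismsAt (k : ℕ) {X Y : SimplicialObject C} (f : X ⟶ Y) (c : Cᵒᵖ) :
    ((shift k).obj ((pts.obj X).obj c)).Subcomplex where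
  obj m := Set.ofPred (fun x : ((pts.obj X).obj c).obj (op ⦋k + m.unop.len⦌) =>
    ∃ h : (relPresheaf (boundaryJoin.{v} k 0).ι f).obj c,
      (boundaryJoin k m.unop.len).ι ≫ SSet.yonedaEquiv.symm x =
        boundaryJoinMap k (b := ⦋0⦌) (SimplexCategory.const m.unop ⦋0⦌ 0) ≫ h.1.1 ∧
      SSet.yonedaEquiv.symm x ≫ (pts.map f).app c =
        joinMap k (b := ⦋0⦌) (SimplexCategory.const m.unop ⦋0⦌ 0) ≫ h.1.2)
  map {m m'} θ x hx := by
    obtain ⟨h, h1, h2⟩ := hx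
    have e : (SSet.yonedaEquiv.symm (((pts.obj X).obj c).map ((joinFunctor k).map θ.unop).op x) :
        Δ[k + m'.unop.len] ⟶ (pts.obj X).obj c) = joinMap k θ.unop ≫ SSet.yonedaEquiv.symm x :=
      (SSet.yonedaEquiv_symm_naturality_left _ _).symm
    have e' : SimplexCategory.const m'.unop ⦋0⦌ 0 =
        θ.unop ≫ SimplexCategory.const m.unop ⦋0⦌ 0 := by
      ext i : 3; rfl
    refine ⟨h, ?_, ?_⟩
    · refine (congrArg _ e).trans ?_
      rw [e', boundaryJoinMap_comp, Category.assoc, ← h1, ← Category.assoc, ← Category.assoc,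
        boundaryJoinMap_ι]
    · refine (congrArg (· ≫ (pts.map f).app c) e).trans ?_
      rw [e', joinMap_comp, Category.assoc, Category.assoc, h2]

theorem higherMorphismsAt_range_le (k : ℕ) {X Y : SimplicialObject C} (f : X ⟶ Y) {c c' : Cᵒᵖ}
    (φ : c ⟶ c') :
    SSet.Subcomplex.range
      ((higherMorphismsAt k f c).ι ≫ (shift k).map ((pts.obj X).map φ)) ≤
      higherMorphismsAt k f c' := by
  rintro m _ ⟨⟨x, h, h1, h2⟩, rfl⟩
  have e := (SSet.yonedaEquiv_symm_comp (n := ⦋k + m.unop.len⦌) x ((pts.obj X).map φ)).symm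
  refine ⟨(relPresheaf _ f).map φ h, ?_, ?_⟩
  · refine (congrArg _ e).trans ?_
    rw [← Category.assoc, h1, Category.assoc]
    rfl
  · refine (congrArg (· ≫ (pts.map f).app c') e).trans ?_
    rw [Category.assoc, NatTrans.naturality, ← Category.assoc, h2, Category.assoc]
    rfl

/-- The relative higher morphism space `P^{≥k}(f)`, as a simplicial presheaf on `C`. -/
def higherMorphisms (k : ℕ) {X Y : SimplicialObject C} (f : X ⟶ Y) : Cᵒᵖ ⥤ SSet.{v} where
  obj c := (higherMorphismsAt k f c).toSSet
  map φ := SSet.Subcomplex.lift _ (higherMorphismsAt_range_le k f φ)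
  map_id c := by
    apply (cancel_mono (higherMorphismsAt k f c).ι).1
    rw [SSet.Subcomplex.lift_ι, CategoryTheory.Functor.map_id, CategoryTheory.Functor.map_id]
    rfl
  map_comp {c c' c''} φ ψ := by
    apply (cancel_mono (higherMorphismsAt k f c'').ι).1
    rw [SSet.Subcomplex.lift_ι, Category.assoc, SSet.Subcomplex.lift_ι,
      SSet.Subcomplex.lift_ι_assoc, CategoryTheory.Functor.map_comp,
      CategoryTheory.Functor.map_comp, Category.assoc]

theorem mem_higherMorphismsAt_zero (k : ℕ) {X Y : SimplicialObject C} (f : X ⟶ Y) {c : C}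
    (x : c ⟶ X _⦋k⦌) : x ∈ (higherMorphismsAt k f (op c)).obj (op ⦋0⦌) := by
  let x' : Δ[k] ⟶ (pts.obj X).obj (op c) :=
    SSet.yonedaEquiv.symm (x : ((pts.obj X).obj (op c)).obj (op ⦋k⦌))
  have e : SimplexCategory.const ⦋0⦌ ⦋0⦌ 0 = 𝟙 _ := by
    ext i : 3; exact Subsingleton.elim (α := Fin 1) _ _
  refine ⟨⟨((boundaryJoin k 0).ι ≫ x', x' ≫ (pts.map f).app _), by simp⟩, ?_, ?_⟩
  · change _ = boundaryJoinMap k (SimplexCategory.const ⦋0⦌ ⦋0⦌ 0) ≫ (boundaryJoin k 0).ι ≫ x'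
    rw [e, ← Category.assoc]
    erw [boundaryJoinMap_ι, joinMap_id]
    rfl
  · change _ = joinMap k (SimplexCategory.const ⦋0⦌ ⦋0⦌ 0) ≫ x' ≫ (pts.map f).app _
    rw [e, joinMap_id]
    rfl

/-- The vertices of `P^{≥k}(f)` are the `k`-simplices of `X`. -/
def higherMorphismsVertices (k : ℕ) {X Y : SimplicialObject C} (f : X ⟶ Y) :
    (higherMorphisms k f ⋙ (evaluation _ _).obj (op ⦋0⦌)).RepresentableBy (X _⦋k⦌) where
  homEquiv :=
    { toFun := fun x => ⟨x, mem_higherMorphismsAt_zero k f x⟩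
      invFun := fun p => p.1
      left_inv := fun _ => rfl
      right_inv := fun _ => rfl }
  homEquiv_comp _ _ := rfl

/-! ### Orbit spaces -/

/-- Let `P` be a simplicial presheaf whose presheaf of vertices is represented by `A`.  The map
`q : A ⟶ Q` is an orbit space `π_0(P)`: it is a cover, and it is the coequalizer of
`d_0, d_1 : P_1 ⇉ P_0 = A`.  If `P_1` is represented by an object of `C`, this is the
coequalizer in `C`. -/
structure IsOrbitSpace (W : MorphismProperty C) (P : Cᵒᵖ ⥤ SSet.{v}) {A : C}
    (e : (P ⋙ (evaluation _ _).obj (op ⦋0⦌)).RepresentableBy A) {Q : C} (q : A ⟶ Q) : Prop where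
  cover : W q
  condition : ∀ {c : C} (p : (P.obj (op c)) _⦋1⦌),
    e.homEquiv.symm ((P.obj (op c)).δ 0 p) ≫ q = e.homEquiv.symm ((P.obj (op c)).δ 1 p) ≫ q
  desc : ∀ {Z : C} (ε : A ⟶ Z),
    (∀ {c : C} (p : (P.obj (op c)) _⦋1⦌),
      e.homEquiv.symm ((P.obj (op c)).δ 0 p) ≫ ε = e.homEquiv.symm ((P.obj (op c)).δ 1 p) ≫ ε) →
    ∃! u : Q ⟶ Z, q ≫ u = ε

/-- The orbit space `π_0(P^{≥n}(f))` exists. -/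
def OrbitSpaceExists (W : MorphismProperty C) (n : ℕ) {X Y : SimplicialObject C} (f : X ⟶ Y) :
    Prop :=
  ∃ (Q : C) (q : X _⦋n⦌ ⟶ Q), IsOrbitSpace W (higherMorphisms n f) (higherMorphismsVertices n f) q

/-! ### Strictification -/

/-- `g : T ⟶ Y`, together with `q : X ⟶ T` over `Y`, is the `n`-strictification
`τ_n(f) : τ_n(X, f) ⟶ Y` of `f : X ⟶ Y`.  The face map `d_1 : T_{n+1} ⟶ T_n` is the missing face
map, because `T` is a simplicial object, `q` is a map of simplicial objects, and `q_{n+1}` is a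
composite of covers, hence an epimorphism.  These data are determined by `f` up to a unique
isomorphism. -/
structure IsStrictification (W : MorphismProperty C) (n : ℕ) {X Y T : SimplicialObject C}
    (f : X ⟶ Y) (g : T ⟶ Y) (q : X ⟶ T) : Prop where
  fac : q ≫ g = f
  /-- `T_k = X_k` for `k < n` -/
  isIso_of_lt : ∀ k : ℕ, k < n → IsIso (q.app (op ⦋k⦌))
  /-- `T_n = π_0(P^{≥n}(f))` -/
  orbitSpace : IsOrbitSpace W (higherMorphisms n f) (higherMorphismsVertices n f) (q.app (op ⦋n⦌))
  /-- `T_{n+1} = Λ^{n+1}_1(g)` -/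
  horn : ∃ (L : C) (R : (relPresheaf (SSet.horn (n + 1) 1).ι g).RepresentableBy L),
    IsIso (relMap (SSet.horn (n + 1) 1).ι g R)
  /-- `T = Csk_{n+1}(T) ×_{Csk_{n+1}(Y)} Y`; in Mathlib, `skeleton (n + 2)` is the simplicial
  subset generated by the simplices of dimension `< n + 2`, i.e. the `(n+1)`-skeleton. -/
  coskeletal : ∀ k : ℕ, ∃ (L : C)
    (R : (relPresheaf (SSet.skeleton Δ[k] (n + 2)).ι g).RepresentableBy L),
    IsIso (relMap (SSet.skeleton Δ[k] (n + 2)).ι g R)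

end HigherStack

namespace HigherStack

variable {C : Type u} [Category.{v} C]

/-! ### Mapping presheaves of simplicial presheaves -/

/-! The argument takes place in presheaves of sets on `C`. A limit exists exactly when its presheaf
is representable, and covers and isomorphisms can be recognised on presheaves
(`IsCovers.relMap_iff`, `isIso_relMap_iff`). Representable presheaves are sheaves for the covers, so
an injective and locally surjective map between sheaves is invertible (`isIso_of_isSheafFor`).

The geometric input is an exchange property (`IsOrbitSpace.exchange`): if two (n+1)-simplices of X
have the same image in Y and all faces but one agree in the orbit space, then so does the remaining
one. Being an equation between maps, it can be checked at points. At a point, f has fillers for all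
horns, so homotopy relative to the boundary in the fibers is an equivalence relation on n-simplices.
The point preserves the coequalizer, hence the orbit map identifies exactly the homotopic simplices
(`IsOrbitSpace.map_eq_iff`). Exchange then becomes a statement about Kan fibrations,
`htpy_face_of_htpy_faces`.

That a strictification g : T → Y is an n-stack is shown by induction on the dimension k of horns
(`IsWeakStrictification.hornProp`). The inclusion of a vertex into a horn is built from horns of
smaller dimension, so Λ^k_i(g) exists and is covered by Λ^k_i(f). Therefore X_k → T_k → Λ^k_i(g) is
a cover. For k < n the first map is invertible; for k = n it is a cover and can be cancelled; for k
> n the second map is injective, hence an isomorphism. For k = n + 1 and general i, injectivity is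
where exchange is used.

For existence, T is first constructed as a simplicial presheaf `strictPsh`: a k-simplex is a simplex
of Y_k with a family of maps to the orbit space indexed by the maps [n] → [k], coming locally from
X. The same induction applies to it, and yields its representability and, by filling horns, its
relative coskeletality.

If f is an n-stack, all homotopies are degenerate, so q_n is invertible, and above n both X_k and
T_k are relative horn objects; thus q is an isomorphism. Conversely, invertibility of the relative
horn maps is invariant under isomorphisms of arrows. -/

/-- The presheaf `c ↦ Hom(S, E(c))`. -/
def homPsh (S : SSet.{v}) (E : Cᵒᵖ ⥤ SSet.{v}) : Cᵒᵖ ⥤ Type v :=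
  E ⋙ coyoneda.obj (op S)

/-- Precomposition with `i : S ⟶ T`. -/
def homPre {S T : SSet.{v}} (i : S ⟶ T) (E : Cᵒᵖ ⥤ SSet.{v}) : homPsh T E ⟶ homPsh S E :=
  Functor.whiskerLeft E (coyoneda.map i.op)

/-- Postcomposition with `φ : E ⟶ B`. -/
def homPost (S : SSet.{v}) {E B : Cᵒᵖ ⥤ SSet.{v}} (φ : E ⟶ B) : homPsh S E ⟶ homPsh S B :=
  Functor.whiskerRight φ (coyoneda.obj (op S))

section

variable {S T U : SSet.{v}} {E B D : Cᵒᵖ ⥤ SSet.{v}}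

/-- The presheaf of commutative squares from `i : S ⟶ T` to `φ : E ⟶ B`. -/
def rel (i : S ⟶ T) (φ : E ⟶ B) : Cᵒᵖ ⥤ Type v where
  obj c := { p : (S ⟶ E.obj c) × (T ⟶ B.obj c) // p.1 ≫ φ.app c = i ≫ p.2 }
  map u := ↾fun p => ⟨(p.1.1 ≫ E.map u, p.1.2 ≫ B.map u), by
    have h := p.2
    simp only [Category.assoc, NatTrans.naturality]
    rw [reassoc_of% h]⟩

/-- The map of the top row of a square. -/
def rel.fst (i : S ⟶ T) (φ : E ⟶ B) : rel i φ ⟶ homPsh S E where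
  app c := ↾fun p => p.1.1

/-- The map of the bottom row of a square. -/
def rel.snd (i : S ⟶ T) (φ : E ⟶ B) : rel i φ ⟶ homPsh T B where
  app c := ↾fun p => p.1.2

/-- A map `T ⟶ E` gives a square with a diagonal filler. -/
def toRel (i : S ⟶ T) (φ : E ⟶ B) : homPsh T E ⟶ rel i φ where
  app c := ↾fun t => ⟨(i ≫ t, t ≫ φ.app c), Category.assoc _ _ _⟩
  naturality c d u := by
    ext t
    refine Subtype.ext (Prod.ext (Category.assoc _ _ _).symm ?_)
    change (t ≫ E.map u) ≫ φ.app d = (t ≫ φ.app c) ≫ B.map u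
    erw [Category.assoc, Category.assoc, φ.naturality]

lemma isPullback_presheaf {P X Y Z : Cᵒᵖ ⥤ Type v} {fst : P ⟶ X} {snd : P ⟶ Y}
    {f : X ⟶ Z} {g : Y ⟶ Z} (w : fst ≫ f = snd ≫ g)
    (inj : ∀ c (p p' : P.obj c), fst.app c p = fst.app c p' → snd.app c p = snd.app c p' → p = p')
    (surj : ∀ c (x : X.obj c) (y : Y.obj c), f.app c x = g.app c y →
      ∃ p, fst.app c p = x ∧ snd.app c p = y) : IsPullback fst snd f g := by
  refine IsPullback.of_forall_isPullback_app fun c => ?_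
  rw [Types.isPullback_iff]
  exact ⟨by rw [← NatTrans.comp_app, w, NatTrans.comp_app], fun p p' h => inj c p p' h.1 h.2,
    surj c⟩

lemma rel.isPullback (i : S ⟶ T) (φ : E ⟶ B) :
    IsPullback (rel.fst i φ) (rel.snd i φ) (homPost S φ) (homPre i B) := by
  refine isPullback_presheaf ?_ ?_ ?_
  · ext c p
    exact p.2
  · intro c p p' h h'
    exact Subtype.ext (Prod.ext h h')
  · intro c x y h
    exact ⟨⟨(x, y), h⟩, rfl, rfl⟩

lemma toRel_fst (i : S ⟶ T) (φ : E ⟶ B) : toRel i φ ≫ rel.fst i φ = homPre i E := rfl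

lemma toRel_snd (i : S ⟶ T) (φ : E ⟶ B) : toRel i φ ≫ rel.snd i φ = homPost T φ := rfl

lemma homPre_comp (i : S ⟶ T) (j : T ⟶ U) (E : Cᵒᵖ ⥤ SSet.{v}) :
    homPre (i ≫ j) E = homPre j E ≫ homPre i E := by
  simp [homPre, homPsh]

lemma homPost_comp (S : SSet.{v}) (φ : E ⟶ B) (ψ : B ⟶ D) :
    homPost S (φ ≫ ψ) = homPost S φ ≫ homPost S ψ := by
  simp [homPost, homPsh]

/-- A pushout of simplicial sets induces a pullback of mapping presheaves. -/
lemma isPullback_homPre {P : SSet.{v}} {a : S ⟶ T} {b : S ⟶ U} {a' : T ⟶ P} {b' : U ⟶ P}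
    (h : IsPushout a b a' b') (E : Cᵒᵖ ⥤ SSet.{v}) :
    IsPullback (homPre a' E) (homPre b' E) (homPre a E) (homPre b E) := by
  refine isPullback_presheaf ?_ ?_ ?_
  · rw [← homPre_comp, ← homPre_comp, h.w]
  · intro c p p' h1 h2
    exact h.hom_ext h1 h2
  · intro c x y w
    exact ⟨h.desc x y w, h.inl_desc _ _ _, h.inr_desc _ _ _⟩

/-- The map on squares induced by a map of arrows `i ⟶ i'`. -/
def rel.pre {S' T' : SSet.{v}} {i : S ⟶ T} {i' : S' ⟶ T'} (a : S ⟶ S') (b : T ⟶ T')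
    (w : i ≫ b = a ≫ i') (φ : E ⟶ B) : rel i' φ ⟶ rel i φ where
  app c := ↾fun p => ⟨(a ≫ p.1.1, b ≫ p.1.2), by
    rw [Category.assoc, p.2, ← Category.assoc, ← w, Category.assoc]⟩

/-- The map on squares induced by a map of arrows `φ ⟶ φ'`. -/
def rel.post {E' B' : Cᵒᵖ ⥤ SSet.{v}} (i : S ⟶ T) {φ : E ⟶ B} {φ' : E' ⟶ B'} (α : E ⟶ E')
    (β : B ⟶ B') (w : φ ≫ β = α ≫ φ') : rel i φ ⟶ rel i φ' where
  app c := ↾fun p => ⟨(p.1.1 ≫ α.app c, p.1.2 ≫ β.app c), by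
    have w' := congr_app w c
    have h := p.2
    simp only [NatTrans.comp_app, Category.assoc] at w' h ⊢
    rw [← w', reassoc_of% h]⟩
  naturality c d u := by
    ext p
    refine Subtype.ext (Prod.ext ?_ ?_)
    · change (p.1.1 ≫ E.map u) ≫ α.app d = (p.1.1 ≫ α.app c) ≫ E'.map u
      simp
    · change (p.1.2 ≫ B.map u) ≫ β.app d = (p.1.2 ≫ β.app c) ≫ B'.map u
      simp

/-- A lifting problem against `i ≫ j` is solved by extending first along `i`, then along `j`. The
square makes the first step a base change of `toRel i φ`; with `toRel_comp` this closes `relClass`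
under composition. -/
lemma isPullback_toRel_comp (i : S ⟶ T) (j : T ⟶ U) (φ : E ⟶ B) :
    IsPullback (rel.fst j φ) (rel.pre (i := i ≫ j) i (𝟙 U) (by simp) φ) (toRel i φ)
      (rel.pre (𝟙 S) j (by simp) φ) := by
  refine isPullback_presheaf ?_ ?_ ?_
  · ext c p
    refine Subtype.ext (Prod.ext ?_ ?_)
    · exact (Category.id_comp _).symm
    · exact p.2.trans (congrArg (j ≫ ·) (Category.id_comp _).symm)
  · intro c p p' h h'
    refine Subtype.ext (Prod.ext h ?_)
    have := congrArg (fun z => z.1.2) h'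
    exact (Category.id_comp p.1.2).symm.trans (this.trans (Category.id_comp _))
  · intro c x y h
    refine ⟨⟨(x, y.1.2), ?_⟩, rfl, ?_⟩
    · exact congrArg (fun z => z.1.2) h
    · refine Subtype.ext (Prod.ext ?_ (Category.id_comp _))
      exact (congrArg (fun z => z.1.1) h).trans (Category.id_comp _)

lemma toRel_comp (i : S ⟶ T) (j : T ⟶ U) (φ : E ⟶ B) :
    toRel (i ≫ j) φ = toRel j φ ≫ rel.pre (i := i ≫ j) i (𝟙 U) (by simp) φ := by
  ext c t
  refine Subtype.ext (Prod.ext (Category.assoc _ _ _) (Category.id_comp _).symm)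

/-- By the universal property of the pushout, filling a square against `i'` amounts to filling the
induced square against `i`. Hence `relClass` is closed under cobase change. -/
lemma isPullback_toRel_of_isPushout {S' T' : SSet.{v}} {i : S ⟶ T} {i' : S' ⟶ T'} {a : S ⟶ S'}
    {b : T ⟶ T'} (h : IsPushout a i i' b) (φ : E ⟶ B) :
    IsPullback (homPre b E) (toRel i' φ) (toRel i φ) (rel.pre a b h.w.symm φ) := by
  refine isPullback_presheaf ?_ ?_ ?_
  · ext c t
    refine Subtype.ext (Prod.ext ?_ (Category.assoc _ _ _))
    exact (Category.assoc i b t).symm.trans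
      ((congrArg (· ≫ t) h.w.symm).trans (Category.assoc a i' t))
  · intro c p p' h1 h2
    exact h.hom_ext (congrArg (fun z => z.1.1) h2) h1
  · intro c x y w
    have w1 : i ≫ x = a ≫ y.1.1 := congrArg (fun z => z.1.1) w
    have w2 : x ≫ φ.app c = b ≫ y.1.2 := congrArg (fun z => z.1.2) w
    refine ⟨h.desc y.1.1 x w1.symm, h.inr_desc _ _ _,
      Subtype.ext (Prod.ext (h.inl_desc _ _ _) ?_)⟩
    refine h.hom_ext ?_ ?_
    · refine (h.inl_desc_assoc _ _ _ _).trans y.2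
    · exact (h.inr_desc_assoc _ _ _ _).trans w2

/-- The bottom row is common to both sides, and only a lift of the top row through `q` is extra. So
relative objects of `q ≫ g` cover those of `g` as soon as `homPost S q` is a cover. -/
lemma isPullback_rel_post (i : S ⟶ T) (q : E ⟶ D) (g : D ⟶ B) :
    IsPullback (rel.fst i (q ≫ g)) (rel.post i q (𝟙 B) (by simp)) (homPost S q)
      (rel.fst i g) := by
  refine isPullback_presheaf rfl ?_ ?_
  · intro c p p' h h'
    exact Subtype.ext (Prod.ext h ((Category.comp_id p.1.2).symm.trans
      ((congrArg (fun z => z.1.2) h').trans (Category.comp_id _))))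
  · intro c x y h
    refine ⟨⟨(x, y.1.2), ?_⟩, rfl, Subtype.ext (Prod.ext h (Category.comp_id _))⟩
    exact (Category.assoc _ _ _).symm.trans ((congrArg (· ≫ g.app c) h).trans y.2)

/-- A square against `q` is one against `q ≫ g` with a filler of its image over `g`. If such fillers
are unique and exist, lifting properties of `q ≫ g` pass to `q` by `toRel_post`. -/
lemma isPullback_rel_post_toRel (i : S ⟶ T) (q : E ⟶ D) (g : D ⟶ B) :
    IsPullback (rel.snd i q) (rel.post i (φ := q) (φ' := q ≫ g) (𝟙 E) g (by simp)) (toRel i g)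
      (rel.post i q (𝟙 B) (by simp)) := by
  refine isPullback_presheaf ?_ ?_ ?_
  · ext c p
    refine Subtype.ext (Prod.ext ?_ (Category.comp_id _).symm)
    exact p.2.symm.trans (congrArg (· ≫ q.app c) (Category.comp_id _).symm)
  · intro c p p' h h'
    refine Subtype.ext (Prod.ext ?_ h)
    exact (Category.comp_id p.1.1).symm.trans
      ((congrArg (fun z => z.1.1) h').trans (Category.comp_id _))
  · intro c x y h
    refine ⟨⟨(y.1.1, x), ?_⟩, rfl, Subtype.ext (Prod.ext (Category.comp_id _) ?_)⟩
    · exact (congrArg (fun z => z.1.1) h).symm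
    · exact (congrArg (fun z => z.1.2) h).trans (Category.comp_id _)

lemma toRel_post (i : S ⟶ T) (q : E ⟶ D) (g : D ⟶ B) :
    toRel i q ≫ rel.post i (φ := q) (φ' := q ≫ g) (𝟙 E) g (by simp) = toRel i (q ≫ g) := by
  ext c t
  exact Subtype.ext (Prod.ext (Category.comp_id _) (Category.assoc _ _ _))

lemma toRel_comp_post (i : S ⟶ T) (q : E ⟶ D) (g : D ⟶ B) :
    toRel i (q ≫ g) ≫ rel.post i q (𝟙 B) (by simp) = homPost T q ≫ toRel i g := by
  ext c t
  refine Subtype.ext (Prod.ext (Category.assoc _ _ _) (Category.comp_id _))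

lemma isIso_presheaf {F G : Cᵒᵖ ⥤ Type v} (φ : F ⟶ G)
    (h : ∀ c, Function.Bijective (φ.app c)) : IsIso φ := by
  have : ∀ c, IsIso (φ.app c) := fun c => (isIso_iff_bijective _).2 (h c)
  exact NatIso.isIso_of_isIso_app φ

lemma bijective_of_isIso {F G : Cᵒᵖ ⥤ Type v} (φ : F ⟶ G) [IsIso φ] (c : Cᵒᵖ) :
    Function.Bijective (φ.app c) :=
  (isIso_iff_bijective _).1 inferInstance

instance isIso_toRel_id (φ : E ⟶ B) : IsIso (toRel (𝟙 S) φ) := by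
  refine isIso_presheaf _ fun c => ⟨fun t t' h => ?_, fun p => ⟨p.1.1, ?_⟩⟩
  · exact (Category.id_comp _).symm.trans
      ((congrArg (fun z => z.1.1) h).trans (Category.id_comp _))
  · exact Subtype.ext (Prod.ext (Category.id_comp _) (p.2.trans (Category.id_comp _)))

end

/-! ### Lifting classes -/

section

variable (V : MorphismProperty (Cᵒᵖ ⥤ Type v)) {E B D : Cᵒᵖ ⥤ SSet.{v}}

/-- The maps `i : S ⟶ T` for which the map from `T`-points of `E` to squares is in `V`. -/
def relClass (φ : E ⟶ B) : MorphismProperty SSet.{v} := fun _ _ i => V (toRel i φ)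

/-- The maps `i : S ⟶ T` for which restriction of `T`-points of `E` to `S`-points is in `V`. -/
def homClass (E : Cᵒᵖ ⥤ SSet.{v}) : MorphismProperty SSet.{v} := fun _ _ i => V (homPre i E)

variable [V.IsMultiplicative] [V.IsStableUnderBaseChange]

lemma mem_of_isIso {F G : Cᵒᵖ ⥤ Type v} (φ : F ⟶ G) [IsIso φ] : V φ :=
  have := MorphismProperty.IsStableUnderBaseChange.respectsIso (P := V)
  MorphismProperty.of_isIso V φ

instance relClass_isMultiplicative (φ : E ⟶ B) : (relClass V φ).IsMultiplicative where
  id_mem S := mem_of_isIso V (toRel (𝟙 S) φ)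
  comp_mem i j hi hj := by
    change V _
    rw [toRel_comp]
    exact V.comp_mem _ _ hj (V.of_isPullback (isPullback_toRel_comp i j φ) hi)

instance relClass_isStableUnderCobaseChange (φ : E ⟶ B) :
    (relClass V φ).IsStableUnderCobaseChange where
  of_isPushout h hi := V.of_isPullback (isPullback_toRel_of_isPushout h φ) hi

instance homClass_isMultiplicative (E : Cᵒᵖ ⥤ SSet.{v}) : (homClass V E).IsMultiplicative where
  id_mem S := by
    change V (homPre (𝟙 S) E)
    have : homPre (𝟙 S) E = 𝟙 _ := by
      ext c t
      exact Category.id_comp _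
    rw [this]
    exact V.id_mem _
  comp_mem i j hi hj := by
    change V _
    rw [homPre_comp]
    exact V.comp_mem _ _ hj hi

instance homClass_isStableUnderCobaseChange (E : Cᵒᵖ ⥤ SSet.{v}) :
    (homClass V E).IsStableUnderCobaseChange where
  of_isPushout h hi := V.of_isPullback (isPullback_homPre h.flip E) hi

end

/-! ### Filtrations of horns -/

section

open SSet

/-- The simplicial subset of `Δ[k]` of simplices which avoid at least one vertex in `S`. -/
def avoid (k : ℕ) (S : Set (Fin (k + 1))) : (Δ[k] : SSet.{v}).Subcomplex where
  obj _ := Set.ofPred (fun s => ∃ j ∈ S, ∀ t, stdSimplex.asOrderHom s t ≠ j)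
  map φ s hs := by
    obtain ⟨j, hj, h⟩ := hs
    exact ⟨j, hj, fun t => h _⟩

lemma mem_avoid {k : ℕ} {S : Set (Fin (k + 1))} {m : SimplexCategoryᵒᵖ}
    (s : (Δ[k] : SSet.{v}).obj m) :
    s ∈ (avoid.{v} k S).obj m ↔ ∃ j ∈ S, ∀ t, stdSimplex.asOrderHom s t ≠ j := Iff.rfl

lemma horn_eq_avoid (k : ℕ) (i : Fin (k + 1)) : horn.{v} k i = avoid k {i}ᶜ := by
  ext m s
  rw [mem_horn_iff, mem_avoid, Ne, Set.eq_univ_iff_forall, not_forall]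
  refine exists_congr fun j => ?_
  simp

lemma avoid_mono {k : ℕ} {S T : Set (Fin (k + 1))} (h : S ⊆ T) : avoid.{v} k S ≤ avoid k T := by
  rintro m s ⟨j, hj, h'⟩
  exact ⟨j, h hj, h'⟩

lemma asOrderHom_δ {k : ℕ} (j : Fin (k + 2)) {m : SimplexCategoryᵒᵖ}
    (s : (Δ[k] : SSet.{v}).obj m) (t) :
    stdSimplex.asOrderHom ((stdSimplex.δ j).app m s) t =
      j.succAbove (stdSimplex.asOrderHom s t) := rfl

lemma avoid_le_preimage {k : ℕ} (j : Fin (k + 2)) (S : Set (Fin (k + 2))) :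
    avoid.{v} k (j.succAbove ⁻¹' S) ≤ (avoid (k + 1) S).preimage (stdSimplex.δ j) := by
  rintro m s ⟨l, hl, h⟩
  exact ⟨_, hl, fun t ht => h t (Fin.succAbove_right_injective ht)⟩

/-- The face map `Δ[k] ⟶ Δ[k + 1]` restricted to the simplices avoiding a vertex in `S`. -/
def avoidFace {k : ℕ} (j : Fin (k + 2)) (S : Set (Fin (k + 2))) :
    (avoid.{v} k (j.succAbove ⁻¹' S)).toSSet ⟶ (avoid (k + 1) S).toSSet :=
  Subcomplex.lift ((avoid k (j.succAbove ⁻¹' S)).ι ≫ stdSimplex.δ j) (by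
    rintro d _ ⟨x, rfl⟩
    exact avoid_le_preimage j S d x.2)

/-- The face map `Δ[k] ⟶ Δ[k + 1]`, as a map to the simplices avoiding `j` or a vertex in `S`. -/
def faceAvoid {k : ℕ} (j : Fin (k + 2)) (S : Set (Fin (k + 2))) (hj : j ∈ S) :
    Δ[k] ⟶ (avoid.{v} (k + 1) S).toSSet :=
  Subcomplex.lift (stdSimplex.δ j) (by
    rintro d _ ⟨x, rfl⟩
    exact ⟨j, hj, fun t => Fin.succAbove_ne _ _⟩)

lemma exists_δ_of_avoid {k : ℕ} (j : Fin (k + 2)) {m : SimplexCategoryᵒᵖ}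
    (s : (Δ[k + 1] : SSet.{v}).obj m) (h : ∀ t, stdSimplex.asOrderHom s t ≠ j) :
    ∃ s' : (Δ[k] : SSet.{v}).obj m, (stdSimplex.δ j).app m s' = s := by
  choose f hf using fun t => Fin.exists_succAbove_eq (h t)
  refine ⟨stdSimplex.objMk ⟨f, fun a b hab => ?_⟩, ?_⟩
  · rw [← (Fin.strictMono_succAbove j).le_iff_le, hf, hf]
    exact (stdSimplex.asOrderHom s).monotone hab
  · apply stdSimplex.objEquiv.injective
    ext t : 3
    exact hf t

lemma δ_app_injective {k : ℕ} (j : Fin (k + 2)) (m : SimplexCategoryᵒᵖ) :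
    Function.Injective ((stdSimplex.{v}.δ j).app m : (Δ[k] : SSet.{v}).obj m → _) := by
  intro s s' h
  apply stdSimplex.objEquiv.injective
  ext t : 3
  have := congrArg (fun z => stdSimplex.asOrderHom z t) h
  exact Fin.succAbove_right_injective (p := j) this

/-- Allowing `j` as an avoided vertex glues on the face opposite `j`, along those of its simplices
which already avoid a vertex of `S`. -/
lemma isPushout_avoid {k : ℕ} (j : Fin (k + 2)) (S : Set (Fin (k + 2))) (hj : j ∉ S) :
    IsPushout (avoidFace.{v} j S) (avoid k (j.succAbove ⁻¹' S)).ι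
      (Subcomplex.homOfLE (avoid_mono (Set.subset_insert j S)))
      (faceAvoid j (insert j S) (Set.mem_insert _ _)) := by
  refine IsPushout.of_forall_isPushout_app fun m => ?_
  have : Mono ((Subcomplex.homOfLE (avoid_mono.{v} (Set.subset_insert j S))).app m) := by
    rw [mono_iff_injective]
    intro x y h
    exact Subtype.ext (congrArg (fun z => z.1) h)
  refine Types.isPushout_of_isPullback_of_mono' ?_ ?_ ?_
  · rw [Types.isPullback_iff]
    refine ⟨rfl, fun x y h => Subtype.ext h.2, ?_⟩
    rintro ⟨x, hx⟩ y h
    obtain rfl : x = (stdSimplex.δ j).app m y := congrArg Subtype.val h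
    obtain ⟨l, hl, h'⟩ := hx
    obtain ⟨l', rfl⟩ := Fin.exists_succAbove_eq (fun e : l = j => hj (e ▸ hl))
    exact ⟨⟨y, l', hl, fun t ht => h' t (by rw [asOrderHom_δ, ht])⟩, Subtype.ext rfl, rfl⟩
  · refine Set.eq_univ_iff_forall.2 ?_
    rintro ⟨x, l, hl, h⟩
    rcases hl with rfl | hl
    · obtain ⟨s, rfl⟩ := exists_δ_of_avoid l x h
      exact Or.inr ⟨s, rfl⟩
    · exact Or.inl ⟨⟨x, l, hl, h⟩, rfl⟩
  · intro x y _ _ h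
    exact δ_app_injective j m (congrArg Subtype.val h)

variable (P : MorphismProperty SSet.{v})

/-- The vertices of `U` are added to `S` one at a time, each by a cobase change of an inclusion
`avoid` into a simplex of one dimension less. There the avoided set is nonempty because `S` is, and
it omits a vertex because `i ∉ U`. -/
lemma homOfLE_avoid_mem [P.IsMultiplicative] [P.IsStableUnderCobaseChange] {k : ℕ}
    (h : ∀ (S : Set (Fin (k + 1))) (i : Fin (k + 1)), i ∉ S → S.Nonempty → P (avoid k S).ι)
    (i : Fin (k + 2)) (S U : Set (Fin (k + 2))) (hS : S.Nonempty) (hSU : S ⊆ U) (hi : i ∉ U) :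
    P (Subcomplex.homOfLE (avoid_mono.{v} hSU)) := by
  classical
  suffices H : ∀ (F : Finset (Fin (k + 2))) (U : Set (Fin (k + 2))) (hSU : S ⊆ U), U = S ∪ F →
      i ∉ U → P (Subcomplex.homOfLE (avoid_mono.{v} hSU)) from
    H U.toFinset U hSU (by simpa using (Set.union_eq_self_of_subset_left hSU).symm) hi
  clear hi hSU U
  intro F
  induction F using Finset.induction_on with
  | empty =>
    intro U hSU e hi
    obtain rfl : U = S := by simpa using e
    exact MorphismProperty.id_mem P (avoid.{v} (k + 1) U).toSSet
  | insert j F hj IH =>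
    intro U hSU e hi
    have hSF : S ⊆ S ∪ F := Set.subset_union_left
    rw [Finset.coe_insert, Set.union_insert] at e
    by_cases hjS : j ∈ S ∪ (F : Set (Fin (k + 2)))
    · rw [Set.insert_eq_of_mem hjS] at e
      exact IH U hSU e hi
    · subst e
      have hij : i ≠ j := by rintro rfl; exact hi (Set.mem_insert _ _)
      obtain ⟨i', hi'⟩ := Fin.exists_succAbove_eq hij
      have key : P (Subcomplex.homOfLE (avoid_mono.{v} (Set.subset_insert j (S ∪ F)))) := by
        refine MorphismProperty.of_isPushout (isPushout_avoid j _ hjS) ?_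
        refine h _ i' (fun h' => hi (Or.inr ?_)) ?_
        · exact hi' ▸ h'
        · obtain ⟨l, hl⟩ := hS
          obtain ⟨l', rfl⟩ := Fin.exists_succAbove_eq
            (fun e : l = j => hjS (Or.inl (e ▸ hl)))
          exact ⟨l', Or.inl hl⟩
      exact P.comp_mem _ _ (IH _ hSF rfl (fun h' => hi (Or.inr h'))) key

/-- The set `S` is enlarged to the complement of `i`, whose `avoid` is a horn; the last step is the
horn inclusion. The pieces attached on the way are handled by induction on `k`. -/
lemma avoid_ι_mem [P.IsMultiplicative] [P.IsStableUnderCobaseChange] (k : ℕ)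
    (h : ∀ m ≤ k, 0 < m → ∀ i : Fin (m + 1), P (horn m i).ι)
    (S : Set (Fin (k + 1))) (i : Fin (k + 1)) (hi : i ∉ S) (hS : S.Nonempty) :
    P (avoid k S).ι := by
  classical
  induction k with
  | zero =>
    obtain ⟨l, hl⟩ := hS
    exact (hi (Subsingleton.elim (α := Fin 1) l i ▸ hl)).elim
  | succ k IH =>
    have key := homOfLE_avoid_mem P (fun S i => IH (fun m hm => h m (by omega)) S i) i S {i}ᶜ hS
      (fun j hj e => hi (e ▸ hj)) (by simp)
    have h2 := h (k + 1) le_rfl (by omega) i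
    rw [horn_eq_avoid] at h2
    exact P.comp_mem _ _ key h2

/-! ### Vertices of simplices and horns -/

/-- The vertex `i` of `Δ[k]`. -/
def vertex (k : ℕ) (i : Fin (k + 1)) : (Δ[0] : SSet.{v}) ⟶ Δ[k] :=
  SSet.stdSimplex.map (SimplexCategory.const ⦋0⦌ ⦋k⦌ i)

lemma vertex_δ {k : ℕ} (j : Fin (k + 2)) (i : Fin (k + 1)) :
    vertex.{v} k i ≫ stdSimplex.δ j = vertex (k + 1) (j.succAbove i) := by
  change SSet.stdSimplex.map _ ≫ SSet.stdSimplex.map _ = SSet.stdSimplex.map _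
  exact (Functor.map_comp SSet.stdSimplex _ _).symm

lemma vertex_mem_horn {k : ℕ} (i : Fin (k + 2)) :
    Subcomplex.range (vertex.{v} (k + 1) i) ≤ horn (k + 1) i := by
  rintro m _ ⟨x, rfl⟩
  rw [horn_eq_avoid]
  obtain ⟨j, hj⟩ := exists_ne i
  exact ⟨j, hj, fun t => Ne.symm hj⟩

/-- The vertex `i` of the horn `Λ[k + 1, i]`. -/
def hornVertex (k : ℕ) (i : Fin (k + 2)) : (Δ[0] : SSet.{v}) ⟶ (horn (k + 1) i).toSSet :=
  Subcomplex.lift (vertex (k + 1) i) (vertex_mem_horn i)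

lemma hornVertex_ι (k : ℕ) (i : Fin (k + 2)) :
    hornVertex.{v} k i ≫ (horn (k + 1) i).ι = vertex (k + 1) i := rfl

instance isIso_faceAvoid {k : ℕ} (j : Fin (k + 2)) :
    IsIso (faceAvoid.{v} j {j} (Set.mem_singleton j)) := by
  have : ∀ m, IsIso ((faceAvoid.{v} j {j} (Set.mem_singleton j)).app m) := by
    intro m
    rw [isIso_iff_bijective]
    refine ⟨fun x y h => δ_app_injective j m (congrArg Subtype.val h), ?_⟩
    rintro ⟨x, l, rfl, h⟩
    obtain ⟨s, rfl⟩ := exists_δ_of_avoid l x h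
    exact ⟨s, rfl⟩
  exact NatIso.isIso_of_isIso_app _

/-- The vertex `i` lies in the face opposite some `j ≠ i`; that face is `avoid {j}`, which grows to
the horn `avoid {i}ᶜ`. The two families feed each other: a vertex of a simplex is a vertex of a horn
followed by the horn inclusion. For the horn of dimension `k + 1` only horns of dimension at most
`k` are needed, which makes the induction in `hornProp` possible. -/
theorem hornVertex_mem_and_vertex_mem [P.IsMultiplicative] [P.IsStableUnderCobaseChange] (k : ℕ) :
    ((∀ m ≤ k, 0 < m → ∀ i : Fin (m + 1), P (horn m i).ι) →
      ∀ i : Fin (k + 1), P (vertex k i)) ∧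
    ((∀ m ≤ k, 0 < m → ∀ i : Fin (m + 1), P (horn m i).ι) →
      ∀ i : Fin (k + 2), P (hornVertex k i)) := by
  classical
  have := MorphismProperty.IsStableUnderCobaseChange.respectsIso (P := P)
  suffices H : ∀ k, ((∀ m ≤ k, 0 < m → ∀ i : Fin (m + 1), P (horn m i).ι) →
      ∀ i : Fin (k + 1), P (vertex k i)) →
      ((∀ m ≤ k, 0 < m → ∀ i : Fin (m + 1), P (horn m i).ι) →
      ∀ i : Fin (k + 2), P (hornVertex k i)) by
    induction k with
    | zero =>
      have h0 : ((∀ m ≤ 0, 0 < m → ∀ i : Fin (m + 1), P (horn m i).ι) →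
          ∀ i : Fin (0 + 1), P (vertex 0 i)) := by
        intro _ i
        have e : vertex.{v} 0 i = 𝟙 _ := by
          have : SimplexCategory.const ⦋0⦌ ⦋0⦌ i = 𝟙 _ := by
            ext t : 3
            exact Subsingleton.elim (α := Fin 1) _ _
          rw [vertex, this]
          exact CategoryTheory.Functor.map_id _ _
        rw [e]
        exact P.id_mem _
      exact ⟨h0, H 0 h0⟩
    | succ k IH =>
      have h1 : ((∀ m ≤ k + 1, 0 < m → ∀ i : Fin (m + 1), P (horn m i).ι) →
          ∀ i : Fin (k + 1 + 1), P (vertex (k + 1) i)) := by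
        intro h i
        rw [← hornVertex_ι]
        exact P.comp_mem _ _ (IH.2 (fun m hm => h m (by omega)) i) (h _ le_rfl (by omega) i)
      exact ⟨h1, H _ h1⟩
  intro k hv h i
  obtain ⟨j, hj⟩ := exists_ne i
  obtain ⟨i', hi'⟩ := Fin.exists_succAbove_eq hj.symm
  have key := homOfLE_avoid_mem P (fun S i => avoid_ι_mem P k h S i) i {j} {i}ᶜ ⟨j, rfl⟩
      (by simpa using hj.symm) (by simp)
  have h2 := P.comp_mem _ _ (P.comp_mem _ _ (hv h i')
    (MorphismProperty.of_isIso P (faceAvoid.{v} j {j} (Set.mem_singleton j)))) key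
  refine (P.cancel_right_of_respectsIso _
    (Subcomplex.eqToIso (horn_eq_avoid.{v} (k + 1) i)).hom).1 ?_
  convert h2 using 1
  rw [← cancel_mono (Subcomplex.ι _)]
  change vertex (k + 1) i = vertex k i' ≫ stdSimplex.δ j
  rw [vertex_δ, hi']

end

/-! ### Covers of presheaves -/

section

variable {W : MorphismProperty C}

lemma IsCovers.respectsIso (hW : IsCovers W) : W.RespectsIso :=
  have := hW.isStableUnderBaseChange
  MorphismProperty.IsStableUnderBaseChange.respectsIso

lemma IsCovers.presheaf_isMultiplicative (hW : IsCovers W) : W.presheaf.IsMultiplicative :=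
  have := hW.respectsIso
  have := hW.isMultiplicative
  inferInstance

lemma presheaf_isStableUnderBaseChange (W : MorphismProperty C) :
    W.presheaf.IsStableUnderBaseChange :=
  MorphismProperty.relative_isStableUnderBaseChange W

/-- Maps between representables come from `C`, where the pullback axiom for covers applies. -/
lemma IsCovers.presheaf_map (hW : IsCovers W) {A B : C} {w : A ⟶ B} (h : W w) :
    W.presheaf (yoneda.map w) := by
  have := hW.respectsIso
  have := hW.isStableUnderBaseChange
  refine MorphismProperty.relative.of_exists fun D g => ?_
  obtain ⟨g, rfl⟩ := yoneda.map_surjective g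
  have := hW.hasPullback g w h
  have sq := (IsPullback.of_hasPullback g w).flip
  exact ⟨_, _, _, sq.map yoneda, W.of_isPullback sq h⟩

lemma IsCovers.presheaf_map_iff (hW : IsCovers W) {A B : C} {w : A ⟶ B} :
    W.presheaf (yoneda.map w) ↔ W w :=
  ⟨MorphismProperty.of_relative_map, hW.presheaf_map⟩

/-- This is the source of the existence of horn limits: a presheaf which covers a representable one
is its own pullback along an isomorphism from a representable, hence representable. -/
lemma isRepresentable_of_presheaf {F G : Cᵒᵖ ⥤ Type v} {φ : F ⟶ G} (h : W.presheaf φ)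
    (hG : G.IsRepresentable) : F.IsRepresentable := by
  have sq := h.rep.isPullback G.representableBy.toIso.hom
  have : IsIso (h.rep.fst G.representableBy.toIso.hom) := sq.isIso_fst_of_isIso
  exact Functor.IsRepresentable.mk' (asIso (h.rep.fst G.representableBy.toIso.hom))

lemma isRepresentable_of_isIso {F G : Cᵒᵖ ⥤ Type v} (φ : F ⟶ G) [IsIso φ]
    (hG : G.IsRepresentable) : F.IsRepresentable :=
  Functor.IsRepresentable.mk' (G.representableBy.toIso ≪≫ (asIso φ).symm)

lemma IsCovers.presheaf_iff_of_representableBy (hW : IsCovers W) {F G : Cᵒᵖ ⥤ Type v} {φ : F ⟶ G}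
    {A B : C} (eF : yoneda.obj A ≅ F) (eG : yoneda.obj B ≅ G) (w : A ⟶ B)
    (h : yoneda.map w ≫ eG.hom = eF.hom ≫ φ) : W.presheaf φ ↔ W w := by
  have := hW.respectsIso
  rw [← hW.presheaf_map_iff]
  exact W.presheaf.arrow_mk_iso_iff (Arrow.isoMk eF eG h.symm).symm

lemma isIso_iff_of_representableBy {F G : Cᵒᵖ ⥤ Type v} {φ : F ⟶ G}
    {A B : C} (eF : yoneda.obj A ≅ F) (eG : yoneda.obj B ≅ G) (w : A ⟶ B)
    (h : yoneda.map w ≫ eG.hom = eF.hom ≫ φ) : IsIso φ ↔ IsIso w := by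
  rw [← isIso_iff_of_reflects_iso w yoneda]
  exact (MorphismProperty.isomorphisms _).arrow_mk_iso_iff (Arrow.isoMk eF eG h.symm).symm

/-- Representability of the targets lets the composite be computed in `C`, where right cancellation
is an axiom; it is not assumed for general presheaves. -/
lemma IsCovers.presheaf_cancel (hW : IsCovers W) {F G H : Cᵒᵖ ⥤ Type v} (φ : F ⟶ G) (ψ : G ⟶ H)
    (hG : G.IsRepresentable) (hH : H.IsRepresentable) (h : W.presheaf (φ ≫ ψ))
    (h' : W.presheaf φ) : W.presheaf ψ := by
  have hF := isRepresentable_of_presheaf h' hG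
  let eF := F.representableBy.toIso
  let eG := G.representableBy.toIso
  let eH := H.representableBy.toIso
  obtain ⟨a, ha⟩ := yoneda.map_surjective (eF.hom ≫ φ ≫ eG.inv)
  obtain ⟨b, hb⟩ := yoneda.map_surjective (eG.hom ≫ ψ ≫ eH.inv)
  refine (hW.presheaf_iff_of_representableBy eG eH b (by simp [hb])).2 (hW.cancel a b ?_ ?_)
  · exact (hW.presheaf_iff_of_representableBy eF eH (a ≫ b) (by simp [ha, hb])).1 h
  · exact (hW.presheaf_iff_of_representableBy eF eG a (by simp [ha])).1 h'

lemma exists_lift_of_presheaf {F G : Cᵒᵖ ⥤ Type v} {φ : F ⟶ G} (h : W.presheaf φ) {c : C}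
    (y : G.obj (op c)) :
    ∃ (d : C) (w : d ⟶ c) (x : F.obj (op d)), W w ∧ φ.app (op d) x = G.map w.op y := by
  have sq := h.rep.isPullback (yonedaEquiv.symm y)
  refine ⟨_, h.rep.snd (yonedaEquiv.symm y), yonedaEquiv (h.rep.fst (yonedaEquiv.symm y)),
    h.property_snd _, ?_⟩
  rw [← yonedaEquiv_comp, sq.w, ← yonedaEquiv_naturality, Equiv.apply_symm_apply]

/-- The sheaf condition for covers. -/
def IsSheafFor (W : MorphismProperty C) (F : Cᵒᵖ ⥤ Type v) : Prop :=
  ∀ {d c : C} (w : d ⟶ c), W w → ∀ x : F.obj (op d),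
    (∀ {e : C} (a b : e ⟶ d), a ≫ w = b ≫ w → F.map a.op x = F.map b.op x) →
    ∃! y : F.obj (op c), F.map w.op y = x

lemma IsSheafFor.ext {F : Cᵒᵖ ⥤ Type v} (hF : IsSheafFor W F) {d c : C} (w : d ⟶ c) (hw : W w)
    {y y' : F.obj (op c)} (h : F.map w.op y = F.map w.op y') : y = y' := by
  refine (hF w hw (F.map w.op y) fun a b hab => ?_).unique rfl h.symm
  simp only [← Functor.map_comp_apply, ← op_comp, hab]

lemma IsSheafFor.of_iso {F G : Cᵒᵖ ⥤ Type v} (φ : F ⟶ G) [IsIso φ] (hF : IsSheafFor W F) :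
    IsSheafFor W G := by
  intro d c w hw x hx
  obtain ⟨x, rfl⟩ := (bijective_of_isIso φ _).2 x
  obtain ⟨y, hy, hy'⟩ := hF w hw x fun a b hab => by
    have := hx a b hab
    rw [← NatTrans.naturality_apply, ← NatTrans.naturality_apply] at this
    exact (bijective_of_isIso φ _).1 this
  refine ⟨φ.app _ y, (NatTrans.naturality_apply φ w.op y).symm.trans (congrArg _ hy), fun z hz => ?_⟩
  obtain ⟨z, rfl⟩ := (bijective_of_isIso φ _).2 z
  rw [hy' z]
  rw [← NatTrans.naturality_apply] at hz
  exact (bijective_of_isIso φ _).1 hz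

/-- The sheaf condition for a representable presheaf is the statement that covers are coequalizers
of their kernel pairs. -/
lemma IsCovers.isSheafFor_yoneda (hW : IsCovers W) (A : C) : IsSheafFor W (yoneda.obj A) := by
  intro d c w hw x hx
  have := hW.hasPullback w w hw
  have k := IsKernelPair.of_hasPullback w
  obtain ⟨hc⟩ := hW.effectiveEpi w _ _ k hw
  obtain ⟨y, hy, hy'⟩ := Cofork.IsColimit.existsUnique hc (W := A) x (hx _ _ k.w)
  exact ⟨y, hy, hy'⟩

lemma IsCovers.isSheafFor (hW : IsCovers W) {F : Cᵒᵖ ⥤ Type v} (hF : F.IsRepresentable) :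
    IsSheafFor W F :=
  IsSheafFor.of_iso F.representableBy.toIso.hom (hW.isSheafFor_yoneda _)

/-- Local preimages agree on overlaps by injectivity, so they glue in `F`; separatedness of `G`
shows that the result is a preimage. -/
lemma isIso_of_isSheafFor {F G : Cᵒᵖ ⥤ Type v} (φ : F ⟶ G) (hF : IsSheafFor W F)
    (hG : IsSheafFor W G) (inj : ∀ c, Function.Injective (φ.app c))
    (surj : ∀ {c : C} (y : G.obj (op c)), ∃ (d : C) (w : d ⟶ c) (x : F.obj (op d)), W w ∧
      φ.app (op d) x = G.map w.op y) : IsIso φ := by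
  refine isIso_presheaf φ fun c => ⟨inj c, fun y => ?_⟩
  obtain ⟨d, w, x, hw, hx⟩ := surj (c := c.unop) y
  obtain ⟨z, hz, -⟩ := hF w hw x fun a b hab => inj _ (by
    simp only [NatTrans.naturality_apply, hx, ← Functor.map_comp_apply, ← op_comp, hab])
  refine ⟨z, hG.ext w hw ?_⟩
  rw [← hx, ← hz]
  exact (NatTrans.naturality_apply φ w.op z).symm

end

/-! ### Comparison with the limits in the category -/

section

variable {W : MorphismProperty C} {X Y : SimplicialObject C}

/-- Maps `Δ[k] ⟶ Hom(c, X)` correspond to maps `c ⟶ X_k`. -/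
def simplexIso (X : SimplicialObject C) (k : ℕ) :
    yoneda.obj (X _⦋k⦌) ≅ homPsh Δ[k] (pts.obj X) :=
  NatIso.ofComponents (fun c => Equiv.toIso
    (SSet.yonedaEquiv (X := (pts.obj X).obj c) (n := ⦋k⦌)).symm)
    (fun {c d} u => by
      ext x
      exact (SSet.yonedaEquiv_symm_comp (n := ⦋k⦌) (X := (pts.obj X).obj c) x
        ((pts.obj X).map u)).symm)

lemma tautSimplex_map (X : SimplicialObject C) (k : ℕ) (c : Cᵒᵖ) (x : c.unop ⟶ X _⦋k⦌) :
    tautSimplex X k ≫ (pts.obj X).map x.op = (simplexIso X k).hom.app c x :=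
  (SSet.yonedaEquiv_symm_comp (n := ⦋k⦌) _ _).trans
    (congrArg (SSet.yonedaEquiv (X := (pts.obj X).obj c) (n := ⦋k⦌)).symm (Category.comp_id x))

lemma simplexIso_homPre {S : SSet.{v}} {k : ℕ} (i : S ⟶ Δ[k]) {L : C}
    (R : (homPresheaf S X).RepresentableBy L) :
    yoneda.map (homMap i R) ≫ R.toIso.hom = (simplexIso X k).hom ≫ homPre i (pts.obj X) := by
  ext c x
  refine (R.homEquiv_comp x (homMap i R)).trans ?_
  refine (congrArg _ (R.homEquiv.apply_symm_apply _)).trans ?_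
  refine (Category.assoc i (tautSimplex X k) ((pts.obj X).map x.op)).trans ?_
  exact congrArg (i ≫ ·) (tautSimplex_map X k c x)

/-- `rel i (pts.map f)` unfolds to `relPresheaf i f`, so `R` represents both. Consequently
`relMap_iff` and `isIso_relMap_iff` express conditions on `relMap` without reference to the chosen
limit. -/
lemma simplexIso_toRel {S : SSet.{v}} {k : ℕ} (i : S ⟶ Δ[k]) (f : X ⟶ Y) {L : C}
    (R : (relPresheaf i f).RepresentableBy L) :
    yoneda.map (relMap i f R) ≫ R.toIso.hom = (simplexIso X k).hom ≫ toRel i (pts.map f) := by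
  ext c x
  refine (R.homEquiv_comp x (relMap i f R)).trans ?_
  refine (congrArg _ (R.homEquiv.apply_symm_apply _)).trans ?_
  refine Subtype.ext (Prod.ext ?_ ?_)
  · exact (Category.assoc i (tautSimplex X k) ((pts.obj X).map x.op)).trans
      (congrArg (i ≫ ·) (tautSimplex_map X k c x))
  · refine (Category.assoc (tautSimplex X k) ((pts.map f).app _) ((pts.obj Y).map x.op)).trans ?_
    refine (congrArg (tautSimplex X k ≫ ·) ((pts.map f).naturality x.op).symm).trans ?_
    exact (Category.assoc (tautSimplex X k) ((pts.obj X).map x.op) ((pts.map f).app c)).symm.trans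
      (congrArg (· ≫ (pts.map f).app c) (tautSimplex_map X k c x))

lemma IsCovers.relMap_iff (hW : IsCovers W) {S : SSet.{v}} {k : ℕ} (i : S ⟶ Δ[k]) (f : X ⟶ Y)
    {L : C} (R : (relPresheaf i f).RepresentableBy L) :
    W (relMap i f R) ↔ W.presheaf (toRel i (pts.map f)) :=
  (hW.presheaf_iff_of_representableBy (simplexIso X k) R.toIso _ (simplexIso_toRel i f R)).symm

lemma isIso_relMap_iff {S : SSet.{v}} {k : ℕ} (i : S ⟶ Δ[k]) (f : X ⟶ Y)
    {L : C} (R : (relPresheaf i f).RepresentableBy L) :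
    IsIso (relMap i f R) ↔ IsIso (toRel i (pts.map f)) :=
  (isIso_iff_of_representableBy (simplexIso X k) R.toIso _ (simplexIso_toRel i f R)).symm

lemma IsCovers.homMap_iff (hW : IsCovers W) {S : SSet.{v}} {k : ℕ} (i : S ⟶ Δ[k])
    {L : C} (R : (homPresheaf S X).RepresentableBy L) :
    W (homMap i R) ↔ W.presheaf (homPre i (pts.obj X)) :=
  (hW.presheaf_iff_of_representableBy (simplexIso X k) R.toIso _ (simplexIso_homPre i R)).symm

lemma IsStack.presheaf_toRel (hW : IsCovers W) {N : ℕ∞} {f : X ⟶ Y} (hf : IsStack W N f)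
    (k : ℕ) (hk : 0 < k) (i : Fin (k + 1)) :
    (rel (SSet.horn k i).ι (pts.map f)).IsRepresentable ∧
    W.presheaf (toRel (SSet.horn k i).ι (pts.map f)) ∧
    (N < k → IsIso (toRel (SSet.horn k i).ι (pts.map f))) := by
  obtain ⟨L, R, h1, h2⟩ := hf.horn k hk i
  exact ⟨⟨L, ⟨R⟩⟩, (hW.relMap_iff _ f R).1 h1, fun h => (isIso_relMap_iff _ f R).1 (h2 h)⟩

lemma IsLieGroupoid.presheaf_homPre (hW : IsCovers W) {N : ℕ∞} (hX : IsLieGroupoid W N X)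
    (k : ℕ) (hk : 0 < k) (i : Fin (k + 1)) :
    W.presheaf (homPre (SSet.horn k i).ι (pts.obj X)) := by
  obtain ⟨L, R, h1, h2⟩ := hX k hk i
  exact (hW.homMap_iff _ R).1 h1

end

/-! ### Weak strictifications -/

section

variable {W : MorphismProperty C} {E T B : Cᵒᵖ ⥤ SSet.{v}}

/-- The map on `U`-points factors as `toRel i q` followed by a base change of the map on `S`-points.
-/
lemma homPost_mem (V : MorphismProperty (Cᵒᵖ ⥤ Type v)) [V.IsMultiplicative]
    [V.IsStableUnderBaseChange] {S U : SSet.{v}} (i : S ⟶ U) (q : E ⟶ T)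
    (h : V (homPost S q)) (hi : V (toRel i q)) : V (homPost U q) := by
  rw [← toRel_snd i q]
  exact V.comp_mem _ _ hi (V.of_isPullback (rel.isPullback i q) h)

lemma comp_eq_of_range_le {K L : SSet.{v}} {A : K.Subcomplex} {s s' : K ⟶ L}
    (h : A.ι ≫ s = A.ι ≫ s') {D : SSet.{v}} (a : D ⟶ K) (ha : SSet.Subcomplex.range a ≤ A) :
    a ≫ s = a ≫ s' := by
  rw [← SSet.Subcomplex.lift_ι a ha, Category.assoc, h, Category.assoc]

lemma range_δ_le_horn {k : ℕ} {i j : Fin (k + 2)} (h : j ≠ i) :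
    SSet.Subcomplex.range (SSet.stdSimplex.{v}.δ j) ≤ SSet.horn (k + 1) i := by
  rintro m _ ⟨x, rfl⟩
  rw [horn_eq_avoid]
  exact ⟨j, h, fun t => Fin.succAbove_ne _ _⟩

lemma range_δ_δ_le_horn {k : ℕ} (i : Fin (k + 3)) (l : Fin (k + 2)) :
    SSet.Subcomplex.range (SSet.stdSimplex.{v}.δ l ≫ SSet.stdSimplex.δ i) ≤
      SSet.horn (k + 2) i := by
  rintro m _ ⟨x, rfl⟩
  rw [horn_eq_avoid]
  refine ⟨i.succAbove l, Fin.succAbove_ne _ _, fun t h => ?_⟩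
  exact Fin.succAbove_ne _ _ (Fin.succAbove_right_injective h)

/-- Maps `q : E ⟶ T` and `g : T ⟶ B` of simplicial presheaves with the properties
of an `n`-strictification which force `g` to be an `n`-stack if `q ≫ g` is an `∞`-stack. -/
structure IsWeakStrictification (W : MorphismProperty C) (n : ℕ) (q : E ⟶ T) (g : T ⟶ B) :
    Prop where
  isIso : ∀ k < n, IsIso (homPost Δ[k] q)
  cover : W.presheaf (homPost Δ[n] q)
  isRepresentable : (homPsh Δ[n] T).IsRepresentable
  -- Above dimension `n` only the sheaf condition is required: for `strictPsh`, representability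
  -- there is a consequence of `hornProp`.
  isSheafFor : ∀ k, n < k → IsSheafFor W (homPsh Δ[k] T)
  ext : ∀ k, n ≤ k → ∀ (c : Cᵒᵖ) (t t' : Δ[k + 1] ⟶ T.obj c), t ≫ g.app c = t' ≫ g.app c →
    (∀ j : Fin (k + 2), (k = n → j ≠ 1) →
      SSet.stdSimplex.δ j ≫ t = SSet.stdSimplex.δ j ≫ t') → t = t'
  exch : ∀ (c : Cᵒᵖ) (x x' : Δ[n + 1] ⟶ E.obj c) (i : Fin (n + 2)),
    x ≫ (q ≫ g).app c = x' ≫ (q ≫ g).app c →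
    (∀ j ≠ i, SSet.stdSimplex.δ j ≫ x ≫ q.app c = SSet.stdSimplex.δ j ≫ x' ≫ q.app c) →
    SSet.stdSimplex.δ i ≫ x ≫ q.app c = SSet.stdSimplex.δ i ≫ x' ≫ q.app c

namespace IsWeakStrictification

variable {n : ℕ} {q : E ⟶ T} {g : T ⟶ B} (h : IsWeakStrictification W n q g)

-- The boundary of the missing face lies in the horn. If `k > n`, that face is therefore determined
-- by the horn and the base, and then so is the simplex. If `k = n`, the missing face has index 1
-- and is not needed.
include h in
lemma toRel_horn_injective (k : ℕ) (hk : n ≤ k) (i : Fin (k + 2)) (hi : k = n → i = 1) (c : Cᵒᵖ) :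
    Function.Injective ((toRel (SSet.horn (k + 1) i).ι g).app c) := by
  intro (s : Δ[k + 1] ⟶ T.obj c) (s' : Δ[k + 1] ⟶ T.obj c) e
  have e1 : (SSet.horn (k + 1) i).ι ≫ s = (SSet.horn (k + 1) i).ι ≫ s' :=
    congrArg (fun z => z.1.1) e
  have e2 : s ≫ g.app c = s' ≫ g.app c := congrArg (fun z => z.1.2) e
  refine h.ext k hk c s s' e2 fun j hj => ?_
  by_cases hij : j = i
  · subst hij
    have hkn : k ≠ n := fun e => hj e (hi e)
    obtain ⟨k, rfl⟩ : ∃ l, k = l + 1 := ⟨k - 1, by omega⟩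
    refine h.ext k (by omega) c _ _ (by rw [Category.assoc, Category.assoc, e2]) fun l _ => ?_
    have := comp_eq_of_range_le e1 _ (range_δ_δ_le_horn j l)
    exact (Category.assoc _ _ s).symm.trans (this.trans (Category.assoc _ _ s'))
  · exact comp_eq_of_range_le e1 _ (range_δ_le_horn hij)

-- After passing to a cover, both simplices lift to `E`, where `exch` forces their faces `i` to
-- agree; the sheaf condition descends the equality.
include h in
lemma toRel_horn_injective_of_lift (hW : IsCovers W)
    (hq : W.presheaf (homPost Δ[n + 1] q)) (i : Fin (n + 2)) (c : Cᵒᵖ) :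
    Function.Injective ((toRel (SSet.horn (n + 1) i).ι g).app c) := by
  intro (s : Δ[n + 1] ⟶ T.obj c) (s' : Δ[n + 1] ⟶ T.obj c) e
  have e1 : (SSet.horn (n + 1) i).ι ≫ s = (SSet.horn (n + 1) i).ι ≫ s' :=
    congrArg (fun z => z.1.1) e
  have e2 : s ≫ g.app c = s' ≫ g.app c := congrArg (fun z => z.1.2) e
  obtain ⟨d, w, x, hw, hx⟩ := exists_lift_of_presheaf hq (c := c.unop) s
  obtain ⟨d', w', x', hw', hx'⟩ := exists_lift_of_presheaf hq (c := d)
    (s' ≫ T.map w.op : Δ[n + 1] ⟶ _)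
  change Δ[n + 1] ⟶ E.obj (op d) at x
  change Δ[n + 1] ⟶ E.obj (op d') at x'
  have hww : W (w' ≫ w) := hW.isMultiplicative.comp_mem _ _ hw' hw
  refine IsSheafFor.ext (h.isSheafFor (n + 1) (by omega)) (w' ≫ w) hww ?_
  change s ≫ T.map (w' ≫ w).op = s' ≫ T.map (w' ≫ w).op
  have hx : x ≫ q.app _ = s ≫ T.map w.op := hx
  have hx' : x' ≫ q.app _ = (s' ≫ T.map w.op) ≫ T.map w'.op := hx'
  have hy : (x ≫ E.map w'.op) ≫ q.app _ = s ≫ T.map (w' ≫ w).op := by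
    rw [Category.assoc, NatTrans.naturality, ← Category.assoc, hx, op_comp, Functor.map_comp,
      Category.assoc]
  have hy' : x' ≫ q.app _ = s' ≫ T.map (w' ≫ w).op := by
    rw [hx', op_comp, Functor.map_comp, Category.assoc]
  have hg : (s ≫ T.map (w' ≫ w).op) ≫ g.app _ = (s' ≫ T.map (w' ≫ w).op) ≫ g.app _ := by
    rw [Category.assoc, Category.assoc, NatTrans.naturality, ← Category.assoc, e2, Category.assoc]
  have hδ : ∀ j ≠ i, SSet.stdSimplex.δ j ≫ s ≫ T.map (w' ≫ w).op =
      SSet.stdSimplex.δ j ≫ s' ≫ T.map (w' ≫ w).op := by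
    intro j hj
    have := comp_eq_of_range_le e1 _ (range_δ_le_horn hj)
    rw [← Category.assoc, this, Category.assoc]
  refine h.ext n le_rfl _ _ _ hg fun j _ => ?_
  by_cases hij : j = i
  · subst hij
    rw [← hy, ← hy'] at hg hδ ⊢
    exact h.exch _ _ _ j (by simpa only [NatTrans.comp_app, Category.assoc] using hg) hδ
  · exact hδ j hij

/-- The properties of `g` and `q` relative to horns of dimension `k`. -/
def HornProp (W : MorphismProperty C) (n : ℕ) (q : E ⟶ T) (g : T ⟶ B) (k : ℕ) (i : Fin (k + 1)) :
    Prop :=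
  W.presheaf (toRel (SSet.horn k i).ι g) ∧ (n < k → IsIso (toRel (SSet.horn k i).ι g)) ∧
  W.presheaf (toRel (SSet.horn k i).ι q) ∧ (k < n → IsIso (toRel (SSet.horn k i).ι q))

include h in
lemma cover_zero (hW : IsCovers W) : W.presheaf (homPost Δ[0] q) := by
  have := hW.presheaf_isMultiplicative
  have := presheaf_isStableUnderBaseChange W
  rcases Nat.eq_zero_or_pos n with rfl | hn
  · exact h.cover
  · have := h.isIso 0 hn
    exact mem_of_isIso _ _

include h in
lemma isRepresentable_zero (hE : (homPsh Δ[0] E).IsRepresentable) :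
    (homPsh Δ[0] T).IsRepresentable := by
  rcases Nat.eq_zero_or_pos n with rfl | hn
  · exact h.isRepresentable
  · have := h.isIso 0 hn
    exact isRepresentable_of_isIso (inv (homPost Δ[0] q)) hE

/-- If `g` satisfies the horn conditions in dimensions `≤ k`, then the horns of dimension `k + 1`
have representable mapping presheaves. -/
lemma isRepresentable_rel_horn (hW : IsCovers W)
    (hT : (homPsh Δ[0] T).IsRepresentable) {k : ℕ}
    (hg : ∀ m ≤ k, 0 < m → ∀ i : Fin (m + 1), W.presheaf (toRel (SSet.horn m i).ι g))
    (hB : ∀ m, 0 < m → ∀ i : Fin (m + 1), W.presheaf (homPre (SSet.horn m i).ι B))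
    (i : Fin (k + 2)) : (rel (SSet.horn (k + 1) i).ι g).IsRepresentable := by
  have := hW.presheaf_isMultiplicative
  have := presheaf_isStableUnderBaseChange W
  -- The relative horn object covers the relative object of the single vertex `i`, which covers
  -- `T_0` as a base change of restriction from `Δ[k + 1]` to a vertex in `B`.
  have h1 : W.presheaf (toRel (hornVertex k i) g) :=
    (hornVertex_mem_and_vertex_mem (relClass W.presheaf g) k).2 hg i
  have h2 : W.presheaf (homPre (vertex (k + 1) i) B) :=
    (hornVertex_mem_and_vertex_mem (homClass W.presheaf B) (k + 1)).1 (fun m _ => hB m) i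
  have h3 := W.presheaf.of_isPullback (rel.isPullback (vertex (k + 1) i) g).flip h2
  have h4 := W.presheaf.of_isPullback
    (isPullback_toRel_comp (hornVertex k i) (SSet.horn (k + 1) i).ι g) h1
  exact isRepresentable_of_presheaf h4 (isRepresentable_of_presheaf h3 hT)

-- The map from `E_{k+1}` to the relative horn object of `g` passes through that of `q ≫ g`, where
-- both factors are covers by the induction hypothesis for `q`. It also passes through `T_{k+1}`,
-- which gives the claim for `g`. The claim for `q` has to be carried along to keep the induction
-- going.
include h in
theorem hornProp (hW : IsCovers W) (hE : (homPsh Δ[0] E).IsRepresentable)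
    (hqg : ∀ k, 0 < k → ∀ i : Fin (k + 1), W.presheaf (toRel (SSet.horn k i).ι (q ≫ g)))
    (hB : ∀ k, 0 < k → ∀ i : Fin (k + 1), W.presheaf (homPre (SSet.horn k i).ι B)) (k : ℕ)
    (i : Fin (k + 2)) : HornProp W n q g (k + 1) i := by
  have := hW.presheaf_isMultiplicative
  have := presheaf_isStableUnderBaseChange W
  have hT := h.isRepresentable_zero hE
  have hq0 := h.cover_zero hW
  induction k using Nat.strong_induction_on with
  | _ k IH =>
  have IH' : ∀ m ≤ k, 0 < m → ∀ i : Fin (m + 1), HornProp W n q g m i := by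
    intro m hm h0 i
    obtain ⟨m, rfl⟩ : ∃ l, m = l + 1 := ⟨m - 1, by omega⟩
    exact IH m (by omega) i
  have hΛ : ∀ i : Fin (k + 2), (rel (SSet.horn (k + 1) i).ι g).IsRepresentable :=
    fun i => isRepresentable_rel_horn hW hT (fun m hm h0 i => (IH' m hm h0 i).1) hB i
  have hqΛ : ∀ i : Fin (k + 2), W.presheaf (homPost (SSet.horn (k + 1) i).toSSet q) := fun i =>
    homPost_mem W.presheaf (hornVertex k i) q hq0
      ((hornVertex_mem_and_vertex_mem (relClass W.presheaf q) k).2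
        (fun m hm h0 i => (IH' m hm h0 i).2.2.1) i)
  have hcomp : ∀ i : Fin (k + 2),
      W.presheaf (homPost Δ[k + 1] q ≫ toRel (SSet.horn (k + 1) i).ι g) := by
    intro i
    rw [← toRel_comp_post]
    exact W.presheaf.comp_mem _ _ (hqg _ (by omega) i)
      (W.presheaf.of_isPullback (isPullback_rel_post _ q g) (hqΛ i))
  have hiso : k + 1 ≤ n → ∀ i : Fin (k + 2),
      IsIso (homPost (SSet.horn (k + 1) i).toSSet q) := fun hk i =>
    homPost_mem (.isomorphisms _) (hornVertex k i) q (h.isIso 0 (by omega))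
      ((hornVertex_mem_and_vertex_mem (relClass (.isomorphisms _) q) k).2
        (fun m hm h0 i => (IH' m hm h0 i).2.2.2 (by omega)) i)
  have hsnd : k + 1 ≤ n → ∀ i : Fin (k + 2),
      IsIso (rel.snd (SSet.horn (k + 1) i).ι q) := fun hk i =>
    (MorphismProperty.isomorphisms _).of_isPullback (rel.isPullback (SSet.horn (k + 1) i).ι q)
      (hiso hk i)
  rcases lt_trichotomy (k + 1) n with hk | hk | hk
  · have := h.isIso (k + 1) hk
    have := hsnd hk.le i
    have e : toRel (SSet.horn (k + 1) i).ι q =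
        homPost Δ[k + 1] q ≫ inv (rel.snd (SSet.horn (k + 1) i).ι q) := by
      rw [← toRel_snd (SSet.horn (k + 1) i).ι q]
      simp
    have : IsIso (toRel (SSet.horn (k + 1) i).ι q) := by
      rw [e]; infer_instance
    refine ⟨?_, fun h' => by omega, mem_of_isIso _ _, fun _ => this⟩
    have := hW.presheaf_isMultiplicative
    exact (W.presheaf.cancel_left_of_respectsIso _ _).1 (hcomp i)
  · subst hk
    have := hsnd le_rfl i
    have e : toRel (SSet.horn (k + 1) i).ι q =
        homPost Δ[k + 1] q ≫ inv (rel.snd (SSet.horn (k + 1) i).ι q) := by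
      rw [← toRel_snd (SSet.horn (k + 1) i).ι q]
      simp
    refine ⟨hW.presheaf_cancel _ _ h.isRepresentable (hΛ i) (hcomp i) h.cover,
      fun h' => by omega, ?_, fun h' => by omega⟩
    rw [e]
    exact W.presheaf.comp_mem _ _ h.cover (mem_of_isIso _ _)
  -- Local surjectivity comes from the cover `hcomp`, so only injectivity remains.
  · have key : ∀ i : Fin (k + 2),
        (∀ c, Function.Injective ((toRel (SSet.horn (k + 1) i).ι g).app c)) →
        IsIso (toRel (SSet.horn (k + 1) i).ι g) := by
      intro i hi
      refine isIso_of_isSheafFor _ (h.isSheafFor _ hk) (hW.isSheafFor (hΛ i)) hi fun {c} y => ?_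
      obtain ⟨d, w, x, hw, hx⟩ := exists_lift_of_presheaf (hcomp i) y
      exact ⟨d, w, _, hw, hx⟩
    have : IsIso (toRel (SSet.horn (k + 1) i).ι g) := by
      rcases (show n ≤ k by omega).eq_or_lt with rfl | hk'
      -- In dimension `n + 1`, `ext` directly handles only the horn with `i = 1`. Its invertibility
      -- shows that `q` is a cover on `Δ[n + 1]`, as needed to lift simplices for the other `i`.
      · have h1 := key 1 (h.toRel_horn_injective n le_rfl 1 (fun _ => rfl))
        refine key i (h.toRel_horn_injective_of_lift hW ?_ i)
        exact (W.presheaf.cancel_right_of_respectsIso _ _).1 (hcomp 1)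
      · exact key i (h.toRel_horn_injective k hk'.le i (fun e => by omega))
    refine ⟨mem_of_isIso _ _, fun _ => this, ?_, fun h' => by omega⟩
    have h1 : IsIso (rel.post (SSet.horn (k + 1) i).ι (φ := q) (φ' := q ≫ g) (𝟙 E) g (by simp)) :=
      (MorphismProperty.isomorphisms _).of_isPullback (isPullback_rel_post_toRel _ q g) this
    refine (W.presheaf.cancel_right_of_respectsIso _
      (rel.post (SSet.horn (k + 1) i).ι (φ := q) (φ' := q ≫ g) (𝟙 E) g _)).1 ?_
    rw [toRel_post]
    exact hqg _ (by omega) i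

end IsWeakStrictification

end

/-! ### Homotopies relative to the boundary in a Kan fibration -/

section

open SimplexCategory

variable {A B : SSet.{v}}

lemma map_map {a b c : SimplexCategory} (α : a ⟶ b) (β : b ⟶ c) (x : A.obj (op c)) :
    A.map α.op (A.map β.op x) = A.map (α ≫ β).op x := by
  rw [op_comp, Functor.map_comp_apply]

/-- A map of simplicial sets has fillers for the horn `Λ[k + 1, i]`, where the horn is given by a
compatible family of simplices. -/
def HornFilling (φ : A ⟶ B) (k : ℕ) (i : Fin (k + 2)) : Prop :=
  ∀ (x : Fin (k + 2) → A _⦋k⦌) (y : B _⦋k + 1⦌),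
    (∀ j ≠ i, ∀ l ≠ i, ∀ (r : ℕ) (α β : ⦋r⦌ ⟶ ⦋k⦌), α ≫ δ j = β ≫ δ l →
      A.map α.op (x j) = A.map β.op (x l)) →
    (∀ j ≠ i, φ.app _ (x j) = B.map (δ j).op y) →
    ∃ z : A _⦋k + 1⦌, φ.app _ z = y ∧ ∀ j ≠ i, A.map (δ j).op z = x j

/-- The map `α` does not have the vertex `l` in its image. -/
def Misses {a b : SimplexCategory} (α : a ⟶ b) (l : Fin (b.len + 1)) : Prop :=
  ∀ t, α.toOrderHom t ≠ l

lemma Misses.comp_left {a b c : SimplexCategory} {β : b ⟶ c} {l : Fin (c.len + 1)}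
    (h : Misses β l) (α : a ⟶ b) : Misses (α ≫ β) l := fun _ => h _

lemma Misses.comp_δ {a : SimplexCategory} {k : ℕ} {α : a ⟶ ⦋k⦌} {l : Fin (k + 1)}
    (h : Misses α l) (J : Fin (k + 2)) : Misses (α ≫ δ J) (J.succAbove l) :=
  fun t e => h t (Fin.succAbove_right_injective (p := J) e)

lemma Misses.of_comp_δ {a : SimplexCategory} {k : ℕ} {α : a ⟶ ⦋k⦌} {l : Fin (k + 1)}
    {J : Fin (k + 2)} (h : Misses (α ≫ δ J) (J.succAbove l)) : Misses α l :=
  fun t e => h t (congrArg J.succAbove e)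

lemma misses_δ {k : ℕ} (j : Fin (k + 2)) : Misses (δ j) j := fun _ => Fin.succAbove_ne _ _

lemma Misses.exists_eq_comp_δ {a : SimplexCategory} {k : ℕ} {α : a ⟶ ⦋k + 1⦌} {l : Fin (k + 2)}
    (h : Misses α l) : ∃ β : a ⟶ ⦋k⦌, α = β ≫ δ l := by
  choose f hf using fun t => Fin.exists_succAbove_eq (h t)
  refine ⟨Hom.mk ⟨f, fun a b hab => ?_⟩, ?_⟩
  · rw [← (Fin.strictMono_succAbove l).le_iff_le, hf, hf]
    exact α.toOrderHom.monotone hab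
  · ext t : 3
    exact (hf t).symm

/-- The horn at `m` whose face `J` is `h` and whose other faces are those of `G` is filled. The
hypothesis `hG` is exactly the compatibility of `h` with these other faces. -/
lemma exists_replace_face {φ : A ⟶ B} {k : ℕ} {J m : Fin (k + 2)}
    (hφ : HornFilling φ k m) (G : A _⦋k + 1⦌) (h : A _⦋k⦌)
    (hh : φ.app _ h = φ.app _ (A.map (δ J).op G))
    (hG : ∀ (r : ℕ) (α : ⦋r⦌ ⟶ ⦋k⦌) (l : Fin (k + 2)), l ≠ J → l ≠ m → Misses (α ≫ δ J) l →
      A.map α.op h = A.map (α ≫ δ J).op G) (hJm : J ≠ m) :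
    ∃ H : A _⦋k + 1⦌, φ.app _ H = φ.app _ G ∧ A.map (δ J).op H = h ∧
      ∀ (r : ℕ) (γ : ⦋r⦌ ⟶ ⦋k + 1⦌) (l : Fin (k + 2)), l ≠ J → l ≠ m → Misses γ l →
        A.map γ.op H = A.map γ.op G := by
  obtain ⟨H, h1, h2⟩ := hφ (fun j => if j = J then h else A.map (δ j).op G) (φ.app _ G) (by
    intro j hj l hl r α β e
    by_cases hjJ : j = J
    · by_cases hlJ : l = J
      · subst hjJ hlJ
        rw [(cancel_mono (δ l)).1 e]
      · subst hjJ
        simp only [if_true, if_neg hlJ, map_map]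
        rw [← e, hG r α l hlJ hl (e ▸ (misses_δ l).comp_left β)]
    · by_cases hlJ : l = J
      · subst hlJ
        simp only [if_true, if_neg hjJ, map_map]
        rw [e, hG r β j hjJ hj (e ▸ (misses_δ j).comp_left α)]
      · simp only [if_neg hjJ, if_neg hlJ, map_map, e]) (by
    intro j _
    by_cases hjJ : j = J
    · subst hjJ
      simp only [if_true, hh, NatTrans.naturality_apply]
    · simp only [if_neg hjJ, NatTrans.naturality_apply])
  refine ⟨H, h1, by simpa using h2 J hJm, fun r γ l hlJ hlm hγ => ?_⟩
  obtain ⟨β, rfl⟩ := hγ.exists_eq_comp_δ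
  have := h2 l hlm
  simp only [if_neg hlJ] at this
  rw [← map_map, this, map_map]

/-- The endomorphism of `[n + 1]` which sends `n + 1` to `n`, and is the identity on `[n]`. -/
def collapse (n : ℕ) : ⦋n + 1⦌ ⟶ ⦋n + 1⦌ := σ (Fin.last n) ≫ δ (Fin.last (n + 1))

/-- The endomorphism of `[n + 1]` which sends `n` to `n + 1`, and is the identity elsewhere. -/
def collapse' (n : ℕ) : ⦋n + 1⦌ ⟶ ⦋n + 1⦌ := σ (Fin.last n) ≫ δ (Fin.last n).castSucc

lemma val_δ {k : ℕ} (j : Fin (k + 2)) (t : Fin (k + 1)) :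
    ((δ j).toOrderHom t).1 = if t.1 < j.1 then t.1 else t.1 + 1 := by
  change (j.succAbove t).1 = _
  rw [Fin.succAbove]
  simp only [Fin.lt_def, Fin.val_castSucc]
  split_ifs <;> simp

lemma val_σ {k : ℕ} (j : Fin (k + 1)) (t : Fin (k + 2)) :
    ((σ j).toOrderHom t).1 = if j.1 < t.1 then t.1 - 1 else t.1 := by
  change (j.predAbove t).1 = _
  rw [Fin.predAbove]
  simp only [Fin.lt_def, Fin.val_castSucc]
  split_ifs <;> simp

lemma hom_ext_val {a b : SimplexCategory} {α β : a ⟶ b}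
    (h : ∀ t, (α.toOrderHom t).1 = (β.toOrderHom t).1) : α = β := by
  ext t : 3
  exact Fin.ext (h t)

lemma val_comp {a b c : SimplexCategory} (α : a ⟶ b) (β : b ⟶ c) (t) :
    ((α ≫ β).toOrderHom t).1 = (β.toOrderHom (α.toOrderHom t)).1 := rfl

lemma δ_last_σ (n : ℕ) : δ (Fin.last (n + 1)) ≫ σ (Fin.last n) = 𝟙 _ := by
  refine hom_ext_val fun (t : Fin (n + 1)) => ?_
  have := t.2
  simp only [val_comp, val_σ, val_δ, Fin.val_last, SimplexCategory.id_toOrderHom,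
    OrderHom.id_coe, id_eq]
  split_ifs <;> omega

lemma δ_castSucc_last_σ (n : ℕ) : δ (Fin.last n).castSucc ≫ σ (Fin.last n) = 𝟙 _ := by
  refine hom_ext_val fun (t : Fin (n + 1)) => ?_
  have := t.2
  simp only [val_comp, val_σ, val_δ, Fin.val_last, SimplexCategory.id_toOrderHom,
    OrderHom.id_coe, id_eq, Fin.val_castSucc]
  split_ifs <;> omega

lemma collapse_σ (n : ℕ) : collapse n ≫ σ (Fin.last n) = σ (Fin.last n) := by
  rw [collapse, Category.assoc, δ_last_σ, Category.comp_id]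

lemma collapse'_collapse (n : ℕ) : collapse' n ≫ collapse n = collapse n := by
  rw [collapse', collapse, Category.assoc, ← Category.assoc (δ _), δ_castSucc_last_σ,
    Category.id_comp]

lemma val_collapse (n : ℕ) (t : Fin (n + 2)) :
    ((collapse n).toOrderHom t).1 = if t.1 < n + 1 then t.1 else n := by
  have := t.2
  rw [collapse, val_comp, val_δ, val_σ]
  simp only [Fin.val_last]
  split_ifs <;> omega

lemma val_collapse' (n : ℕ) (t : Fin (n + 2)) :
    ((collapse' n).toOrderHom t).1 = if t.1 < n then t.1 else n + 1 := by
  have := t.2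
  rw [collapse', val_comp, val_δ, val_σ]
  simp only [Fin.val_last, Fin.val_castSucc]
  split_ifs <;> omega

lemma Misses.comp_collapse {a : SimplexCategory} {n : ℕ} {α : a ⟶ ⦋n + 1⦌} {l : Fin (n + 2)}
    (h : Misses α l) (hl : l.1 < n) : Misses (α ≫ collapse n) l := by
  intro t e
  have e' := congrArg Fin.val e
  rw [val_comp, val_collapse] at e'
  refine h t (Fin.ext ?_)
  split_ifs at e' <;> omega

lemma Misses.comp_collapse' {a : SimplexCategory} {n : ℕ} {α : a ⟶ ⦋n + 1⦌} {l : Fin (n + 2)}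
    (h : Misses α l) (hl : l.1 < n) : Misses (α ≫ collapse' n) l := by
  intro t e
  have e' := congrArg Fin.val e
  rw [val_comp, val_collapse'] at e'
  refine h t (Fin.ext ?_)
  split_ifs at e' <;> omega

lemma Misses.comp_collapse'_eq {a : SimplexCategory} {n : ℕ} {α : a ⟶ ⦋n + 1⦌} {l : Fin (n + 2)}
    (h : Misses α l) (hl : l.1 = n) : α ≫ collapse' n = α := by
  refine hom_ext_val fun t => ?_
  have h1 : (α.toOrderHom t).1 ≠ n := fun e => h t (Fin.ext (e.trans hl.symm))
  have h2 : (α.toOrderHom t).1 < n + 2 := (α.toOrderHom t).2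
  rw [val_comp, val_collapse']
  split_ifs <;> omega

/-- The indices used to replace the face `j` of an `(n + 1)`-simplex: degenerating by `s`, the
face `J` becomes a degeneracy of the face `j`, and the face `m` becomes the simplex itself. -/
lemma exists_degeneracy (n : ℕ) (j : Fin (n + 2)) :
    ∃ (J m : Fin (n + 3)) (s : ⦋n + 2⦌ ⟶ ⦋n + 1⦌),
      δ J ≫ s = σ (Fin.last n) ≫ δ j ∧ δ m ≫ s = 𝟙 _ ∧ m.succAbove j = J ∧
      δ j ≫ δ m = δ (Fin.last (n + 1)) ≫ δ J ∧ J.succAbove (Fin.last (n + 1)) = m := by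
  have hj := j.2
  by_cases h : j.1 = n + 1
  · refine ⟨Fin.last (n + 2), (Fin.last (n + 1)).castSucc, σ (Fin.last n).castSucc,
      hom_ext_val fun (t : Fin (n + 2)) => ?_, hom_ext_val fun (t : Fin (n + 2)) => ?_, Fin.ext ?_,
      hom_ext_val fun (t : Fin (n + 1)) => ?_, Fin.ext ?_⟩
    · have := t.2
      simp only [val_comp, val_σ, val_δ, Fin.val_last, Fin.val_castSucc]
      split_ifs <;> omega
    · have := t.2
      simp only [val_comp, val_σ, val_δ, Fin.val_last, Fin.val_castSucc,
        SimplexCategory.id_toOrderHom, OrderHom.id_coe, id_eq]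
      split_ifs <;> omega
    · refine (val_δ _ _).trans ?_
      simp only [Fin.val_last, Fin.val_castSucc]
      split_ifs <;> omega
    · have := t.2
      simp only [val_comp, val_δ, Fin.val_last, Fin.val_castSucc]
      split_ifs <;> omega
    · refine (val_δ _ _).trans ?_
      simp only [Fin.val_last, Fin.val_castSucc]
      split_ifs <;> omega
  · refine ⟨j.castSucc, Fin.last (n + 2), σ (Fin.last (n + 1)),
      hom_ext_val fun (t : Fin (n + 2)) => ?_, δ_last_σ _, Fin.ext ?_,
      hom_ext_val fun (t : Fin (n + 1)) => ?_, Fin.ext ?_⟩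
    · have := t.2
      simp only [val_comp, val_σ, val_δ, Fin.val_last, Fin.val_castSucc]
      split_ifs <;> omega
    · refine (val_δ _ _).trans ?_
      simp only [Fin.val_last, Fin.val_castSucc]
      split_ifs <;> omega
    · have := t.2
      simp only [val_comp, val_δ, Fin.val_last, Fin.val_castSucc]
      split_ifs <;> omega
    · refine (val_δ _ _).trans ?_
      simp only [Fin.val_last, Fin.val_castSucc]
      split_ifs <;> omega

/-- A homotopy relative to the boundary between `n`-simplices in the fibers of `φ`. -/
structure IsHtpy (φ : A ⟶ B) {n : ℕ} (h : A _⦋n + 1⦌) : Prop where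
  base : φ.app _ h = B.map (collapse n).op (φ.app _ h)
  face : ∀ (r : ℕ) (α : ⦋r⦌ ⟶ ⦋n + 1⦌) (l : Fin (n + 2)), l.1 < n → Misses α l →
    A.map α.op h = A.map (α ≫ collapse n).op h

/-- While `collapse` compares `h` with the degeneracy of its end, `collapse'` compares it with the
degeneracy of its start. In `face'` this allows also `l = n`, as a simplex missing `n` is fixed by
`collapse'`. -/
lemma IsHtpy.base' {φ : A ⟶ B} {n : ℕ} {h : A _⦋n + 1⦌} (hh : IsHtpy φ h) :
    φ.app _ h = B.map (collapse' n).op (φ.app _ h) := by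
  conv_rhs => rw [hh.base, map_map, collapse'_collapse, ← hh.base]

lemma IsHtpy.face' {φ : A ⟶ B} {n : ℕ} {h : A _⦋n + 1⦌} (hh : IsHtpy φ h) {r : ℕ}
    (α : ⦋r⦌ ⟶ ⦋n + 1⦌) (l : Fin (n + 2)) (hl : l.1 ≤ n) (hα : Misses α l) :
    A.map α.op h = A.map (α ≫ collapse' n).op h := by
  rcases hl.eq_or_lt with hl | hl
  · rw [hα.comp_collapse'_eq hl]
  · rw [hh.face r α l hl hα, hh.face r _ l hl (hα.comp_collapse' hl), Category.assoc,
      collapse'_collapse]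

/-! ### The homotopy relation -/

/-- Two `n`-simplices are homotopic relative to the boundary, in the fibers of `φ`. -/
def Htpy (φ : A ⟶ B) {n : ℕ} (x y : A _⦋n⦌) : Prop :=
  ∃ h : A _⦋n + 1⦌, IsHtpy φ h ∧ A.map (δ (Fin.last n).castSucc).op h = x ∧
    A.map (δ (Fin.last (n + 1))).op h = y

variable {φ : A ⟶ B} {n : ℕ} (hφ : ∀ i, HornFilling φ (n + 1) i)

-- In the degenerate simplex `s^* a`, the face `J` is the degeneracy of the face `j` of `a`. The
-- homotopy replaces it; the face `m`, which was `a`, turns into `a'`.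
include hφ in
lemma Htpy.exists_replace_face (a : A _⦋n + 1⦌) (j : Fin (n + 2)) {b : A _⦋n⦌}
    (hab : Htpy φ (A.map (δ j).op a) b) :
    ∃ a' : A _⦋n + 1⦌, φ.app _ a' = φ.app _ a ∧ A.map (δ j).op a' = b ∧
      ∀ (r : ℕ) (γ : ⦋r⦌ ⟶ ⦋n + 1⦌) (l : Fin (n + 2)), l ≠ j → Misses γ l →
        A.map γ.op a' = A.map γ.op a := by
  obtain ⟨h, hh, h1, rfl⟩ := hab
  obtain ⟨J, m, s, e1, e2, e3, e4, e5⟩ := exists_degeneracy n j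
  obtain ⟨H, H1, H2, H3⟩ := HigherStack.exists_replace_face (hφ m) (A.map s.op a) h (J := J) (by
      rw [map_map, e1, ← map_map, ← h1, map_map]
      rw [NatTrans.naturality_apply]
      exact hh.base') (by
      intro r α l hlJ hlm hα
      obtain ⟨l, rfl⟩ := Fin.exists_succAbove_eq hlJ
      have hl : l ≠ Fin.last (n + 1) := fun e => hlm (e ▸ e5)
      have hl' : l.1 ≤ n := by
        have := l.2
        have : l.1 ≠ n + 1 := fun e => hl (Fin.ext e)
        omega
      rw [map_map, Category.assoc, e1, ← Category.assoc, ← map_map, ← h1, map_map,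
        Category.assoc]
      exact hh.face' α l hl' hα.of_comp_δ) (e3 ▸ Fin.succAbove_ne _ _)
  refine ⟨A.map (δ m).op H, ?_, ?_, fun r γ l hl hγ => ?_⟩
  · rw [NatTrans.naturality_apply, H1, ← NatTrans.naturality_apply, map_map, e2, op_id,
      Functor.map_id_apply]
  · rw [map_map, e4, ← map_map, H2]
  · rw [map_map, H3 r _ (m.succAbove l) (fun e => hl ?_) (Fin.succAbove_ne _ _) (hγ.comp_δ m),
      map_map, Category.assoc, e2, Category.comp_id]
    exact Fin.succAbove_right_injective (e.trans e3.symm)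

-- This is the reverse construction: in the degenerate simplex `s^* a` the face `m`, which is `a`,
-- is replaced by `a'`, and the face `J` of the filler is the homotopy.
include hφ in
lemma htpy_of_agree (a a' : A _⦋n + 1⦌) (j : Fin (n + 2)) (h : φ.app _ a' = φ.app _ a)
    (haa' : ∀ (r : ℕ) (γ : ⦋r⦌ ⟶ ⦋n + 1⦌) (l : Fin (n + 2)), l ≠ j → Misses γ l →
      A.map γ.op a' = A.map γ.op a) :
    Htpy φ (A.map (δ j).op a) (A.map (δ j).op a') := by
  obtain ⟨J, m, s, e1, e2, e3, e4, e5⟩ := exists_degeneracy n j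
  have hJm : J ≠ m := e3 ▸ Fin.succAbove_ne _ _
  obtain ⟨H, H1, H2, H3⟩ := HigherStack.exists_replace_face (hφ J) (A.map s.op a) a' (J := m) (by
      rw [map_map, e2, op_id, Functor.map_id_apply, h]) (by
      intro r α l hlm hlJ hα
      obtain ⟨l, rfl⟩ := Fin.exists_succAbove_eq hlm
      rw [map_map, Category.assoc, e2, Category.comp_id]
      exact haa' r α l (fun e => hlJ (e ▸ e3)) hα.of_comp_δ) hJm.symm
  -- All faces of the new simplex except the last agree with those of the degeneracy of the face `j`
  -- of `a`.
  have key : ∀ (r : ℕ) (α : ⦋r⦌ ⟶ ⦋n + 1⦌) (l : Fin (n + 2)), l.1 ≤ n → Misses α l →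
      A.map α.op (A.map (δ J).op H) = A.map (α ≫ σ (Fin.last n) ≫ δ j).op a := by
    intro r α l hl hα
    rw [map_map, H3 r _ (J.succAbove l) ?_ (Fin.succAbove_ne _ _) (hα.comp_δ J), map_map,
      Category.assoc, e1]
    rw [← e5]
    intro e
    have := Fin.succAbove_right_injective e
    subst this
    simp at hl
  refine ⟨A.map (δ J).op H, ⟨?_, fun r α l hl hα => ?_⟩, ?_, ?_⟩
  · rw [NatTrans.naturality_apply, H1, NatTrans.naturality_apply, map_map, map_map, e1,
      ← Category.assoc, collapse_σ]
  · rw [key r α l hl.le hα, key r _ l hl.le (hα.comp_collapse hl), Category.assoc,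
      ← Category.assoc (collapse n), collapse_σ]
  · rw [key n _ (Fin.last n).castSucc (by simp) (misses_δ _), ← Category.assoc, δ_castSucc_last_σ,
      Category.id_comp]
  · rw [map_map, ← e4, ← map_map, H2]

lemma Htpy.refl (x : A _⦋n⦌) : Htpy φ x x := by
  refine ⟨A.map (σ (Fin.last n)).op x, ⟨?_, fun r α l hl hα => ?_⟩, ?_, ?_⟩
  · rw [NatTrans.naturality_apply, map_map, collapse_σ]
  · rw [map_map, map_map, Category.assoc, collapse_σ]
  · rw [map_map, δ_castSucc_last_σ, op_id, Functor.map_id_apply]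
  · rw [map_map, δ_last_σ, op_id, Functor.map_id_apply]

-- Replacing the face `x` of the homotopy from `x` to `y` by `z` leaves a homotopy from `z` to `y`.
-- With reflexivity, symmetry and transitivity are formal consequences.
include hφ in
lemma Htpy.of_common_source {x y z : A _⦋n⦌} (hy : Htpy φ x y) (hz : Htpy φ x z) :
    Htpy φ z y := by
  obtain ⟨h, hh, rfl, rfl⟩ := hy
  obtain ⟨h', H1, H2, H3⟩ := Htpy.exists_replace_face hφ h _ hz
  refine ⟨h', ⟨?_, fun r α l hl hα => ?_⟩, H2, ?_⟩
  · rw [H1]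
    exact hh.base
  · have hl' : l ≠ (Fin.last n).castSucc := by
      rintro rfl
      simp at hl
    rw [H3 r α l hl' hα, H3 r _ l hl' (hα.comp_collapse hl)]
    exact hh.face r α l hl hα
  · refine H3 n _ (Fin.last (n + 1)) (fun e => ?_) (misses_δ _)
    simpa using congrArg Fin.val e

include hφ in
lemma Htpy.symm {x y : A _⦋n⦌} (h : Htpy φ x y) : Htpy φ y x :=
  Htpy.of_common_source hφ (Htpy.refl x) h

include hφ in
lemma Htpy.trans {x y z : A _⦋n⦌} (h : Htpy φ x y) (h' : Htpy φ y z) : Htpy φ x z :=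
  Htpy.of_common_source hφ h' (h.symm hφ)

include hφ in
/-- If all faces but one of two simplices over the same base are homotopic, then so is the
remaining face. -/
lemma htpy_face_of_htpy_faces (a a' : A _⦋n + 1⦌) (i : Fin (n + 2)) (h : φ.app _ a = φ.app _ a')
    (haa' : ∀ j ≠ i, Htpy φ (A.map (δ j).op a) (A.map (δ j).op a')) :
    Htpy φ (A.map (δ i).op a) (A.map (δ i).op a') := by
  classical
  -- The faces of `a` in `F` are replaced by those of `a'` one after the other, without touching the
  -- rest. For all faces but `i`, the result agrees with `a'` and `htpy_of_agree` applies.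
  have key : ∀ F : Finset (Fin (n + 2)), i ∉ F → ∃ b : A _⦋n + 1⦌, φ.app _ b = φ.app _ a ∧
      (∀ l ∈ F, A.map (δ l).op b = A.map (δ l).op a') ∧
      (∀ l ∉ F, A.map (δ l).op b = A.map (δ l).op a) := by
    intro F
    induction F using Finset.induction_on with
    | empty => exact fun _ => ⟨a, rfl, by simp, fun _ _ => rfl⟩
    | insert j F hj IH =>
      intro hi
      simp only [Finset.mem_insert, not_or] at hi
      obtain ⟨b, b1, b2, b3⟩ := IH hi.2
      obtain ⟨b', c1, c2, c3⟩ := Htpy.exists_replace_face hφ b j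
        (b := A.map (δ j).op a') (by rw [b3 j hj]; exact haa' j (Ne.symm hi.1))
      refine ⟨b', c1.trans b1, fun l hl => ?_, fun l hl => ?_⟩
      · by_cases hlj : l = j
        · rw [hlj, c2]
        · rw [c3 n (δ l) l hlj (misses_δ l), b2 l ((Finset.mem_insert.1 hl).resolve_left hlj)]
      · simp only [Finset.mem_insert, not_or] at hl
        rw [c3 n (δ l) l hl.1 (misses_δ l), b3 l hl.2]
  obtain ⟨b, b1, b2, b3⟩ := key (Finset.univ.erase i) (by simp)
  rw [← b3 i (by simp)]
  refine htpy_of_agree hφ b a' i (h.symm.trans b1.symm) fun r γ l hl hγ => ?_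
  obtain ⟨β, rfl⟩ := hγ.exists_eq_comp_δ
  rw [← map_map, ← map_map, b2 l (by simpa using hl)]

end

/-! ### Horns as compatible families -/

section

open SimplexCategory

/-- A family of simplices which is compatible, for pairs of simplices of dimension `≤ d`. -/
def IsCompatible (A : SSet.{v}) {k : ℕ} {i : Fin (k + 2)} (x : {j // j ≠ i} → A _⦋k⦌) : Prop :=
  ∀ (j l : {j // j ≠ i}) (r : SimplexCategory) (α β : r ⟶ ⦋k⦌), α ≫ δ j.1 = β ≫ δ l.1 →
    A.map α.op (x j) = A.map β.op (x l)

lemma exists_section {r : SimplexCategory} {k : ℕ} (α : r ⟶ ⦋k⦌) :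
    ∃ (m : ℕ) (_ : m < k + 1) (π : r ⟶ ⦋m⦌) (s : ⦋m⦌ ⟶ r), π ≫ s ≫ α = α := by
  obtain ⟨I, π, μ, hπ, hμ, e⟩ : ∃ (I : SimplexCategory) (π : r ⟶ I) (μ : I ⟶ ⦋k⦌),
      Epi π ∧ Mono μ ∧ π ≫ μ = α :=
    ⟨_, factorThruImage α, image.ι α, inferInstance, inferInstance, image.fac α⟩
  have := isSplitEpi_of_epi π
  refine ⟨I.len, Nat.lt_succ_of_le (len_le_of_mono μ), π, section_ π, ?_⟩
  rw [← e, IsSplitEpi.id_assoc]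

/-- Surjections in the simplex category split, so every coincidence of simplices is a degeneracy of
one in dimension at most `k`. This leaves finitely many relations, so that a horn limit is a finite
limit. -/
lemma isCompatible_of_le {A : SSet.{v}} {k : ℕ} {i : Fin (k + 2)} (x : {j // j ≠ i} → A _⦋k⦌)
    (h : ∀ (j l : {j // j ≠ i}) (r : ℕ), r < k + 1 → ∀ (α β : ⦋r⦌ ⟶ ⦋k⦌),
      α ≫ δ j.1 = β ≫ δ l.1 → A.map α.op (x j) = A.map β.op (x l)) : IsCompatible A x := by
  intro j l r α β e
  obtain ⟨m, hm, π, s, hα⟩ := exists_section α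
  have hβ : π ≫ s ≫ β = β := by
    rw [← cancel_mono (δ l.1), Category.assoc, Category.assoc, ← e, ← Category.assoc s,
      ← Category.assoc π, hα]
  have := h j l m hm (s ≫ α) (s ≫ β) (by
    rw [Category.assoc, Category.assoc, e])
  calc A.map α.op (x j) = A.map π.op (A.map (s ≫ α).op (x j)) := by rw [map_map, hα]
    _ = A.map π.op (A.map (s ≫ β).op (x l)) := congrArg _ this
    _ = _ := by rw [map_map, hβ]

lemma exists_of_mem_horn {k : ℕ} {i : Fin (k + 2)} {m : SimplexCategoryᵒᵖ}
    (s : (SSet.horn.{v} (k + 1) i).toSSet.obj m) :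
    ∃ (j : {j // j ≠ i}) (α : m.unop ⟶ ⦋k⦌), SSet.stdSimplex.objEquiv s.1 = α ≫ δ j.1 := by
  obtain ⟨s, hs⟩ := s
  rw [horn_eq_avoid] at hs
  obtain ⟨j, hj, h⟩ := hs
  obtain ⟨α, hα⟩ := Misses.exists_eq_comp_δ (α := SSet.stdSimplex.objEquiv s) (l := j) h
  exact ⟨⟨j, hj⟩, α, hα⟩

/-- For each simplex of the horn a face containing it is chosen; compatibility makes the value
independent of the choice. -/
lemma IsCompatible.exists_desc {A : SSet.{v}} {k : ℕ} {i : Fin (k + 2)}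
    {x : {j // j ≠ i} → A _⦋k⦌} (h : IsCompatible A x) :
    ∃ s : (SSet.horn.{v} (k + 1) i).toSSet ⟶ A,
      ∀ j : {j // j ≠ i}, SSet.yonedaEquiv (SSet.horn.ι i j.1 j.2 ≫ s) = x j := by
  choose f α hα using fun m => exists_of_mem_horn (k := k) (i := i) (m := m)
  let s : (SSet.horn.{v} (k + 1) i).toSSet ⟶ A :=
    { app := fun m => ↾fun σ => A.map (α m σ).op (x (f m σ))
      naturality := fun m m' u => by
        ext σ
        change A.map (α m' _).op (x (f m' _)) = A.map u (A.map (α m σ).op (x (f m σ)))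
        rw [← u.op_unop, map_map]
        refine h _ _ _ _ _ ?_
        rw [← hα, Category.assoc, ← hα]
        rfl }
  refine ⟨s, fun j => ?_⟩
  have e : SSet.yonedaEquiv (SSet.horn.ι i j.1 j.2 ≫ s) = s.app _ (SSet.horn.face i j.1 j.2) := by
    rw [SSet.yonedaEquiv_comp, SSet.horn.yonedaEquiv_ι]
  rw [e]
  change A.map (α _ _).op (x (f _ _)) = x j
  refine (h _ j _ _ (𝟙 _) ?_).trans ?_
  · rw [← hα, Category.id_comp]
    rfl
  · rw [op_id, Functor.map_id_apply]

lemma horn_hom_ext {A : SSet.{v}} {k : ℕ} {i : Fin (k + 2)}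
    {s s' : (SSet.horn.{v} (k + 1) i).toSSet ⟶ A}
    (h : ∀ j : {j // j ≠ i}, SSet.horn.ι i j.1 j.2 ≫ s = SSet.horn.ι i j.1 j.2 ≫ s') : s = s' := by
  refine SSet.horn.hom_ext _ _ fun j hj => ?_
  have := congrArg SSet.yonedaEquiv (h ⟨j, hj⟩)
  rwa [SSet.yonedaEquiv_comp, SSet.yonedaEquiv_comp, SSet.horn.yonedaEquiv_ι] at this

/-! ### Horn limits are finite limits -/

/-- The pairs of simplices of faces of the horn `Λ[k + 1, i]` which agree in `Δ[k + 1]`. -/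
structure HornOverlap (k : ℕ) (i : Fin (k + 2)) where
  /-- the first face -/
  j : {j // j ≠ i}
  /-- the second face -/
  l : {j // j ≠ i}
  /-- the dimension -/
  r : Fin (k + 1)
  /-- the simplex of the first face -/
  α : ⦋r.1⦌ ⟶ ⦋k⦌
  /-- the simplex of the second face -/
  β : ⦋r.1⦌ ⟶ ⦋k⦌
  /-- the simplices agree -/
  w : α ≫ δ j.1 = β ≫ δ l.1

instance (k : ℕ) (i : Fin (k + 2)) : Finite (HornOverlap k i) := by
  refine Finite.of_injective (β := Σ r : Fin (k + 1), {j // j ≠ i} × {j // j ≠ i} ×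
    (Fin (r.1 + 1) → Fin (k + 1)) × (Fin (r.1 + 1) → Fin (k + 1)))
    (fun o => ⟨o.r, o.j, o.l, o.α.toOrderHom, o.β.toOrderHom⟩) ?_
  rintro ⟨j, l, r, α, β, w⟩ ⟨j', l', r', α', β', w'⟩ h
  obtain rfl : r = r' := congrArg Sigma.fst h
  have h2 := eq_of_heq (Sigma.mk.inj h).2
  simp only [Prod.mk.injEq, DFunLike.coe_fn_eq] at h2
  obtain ⟨rfl, rfl, h3, h4⟩ := h2
  obtain rfl := SimplexCategory.Hom.ext _ _ h3
  obtain rfl := SimplexCategory.Hom.ext _ _ h4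
  rfl

/-- The shape of the diagram of the faces of a horn and of a simplex. -/
def hornShape (k : ℕ) (i : Fin (k + 2)) : MulticospanShape where
  L := Option {j // j ≠ i}
  R := HornOverlap k i ⊕ {j // j ≠ i}
  fst := Sum.elim (fun o => some o.j) some
  snd := Sum.elim (fun o => some o.l) (fun _ => none)

/-- The diagram of the faces of a relative horn. -/
def hornIndex {X Y : SimplicialObject C} (f : X ⟶ Y) (k : ℕ) (i : Fin (k + 2)) :
    MulticospanIndex (hornShape k i) C where
  left o := match o with
    | none => Y _⦋k + 1⦌
    | some _ => X _⦋k⦌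
  right o := match o with
    | .inl o => X _⦋o.r⦌
    | .inr _ => Y _⦋k⦌
  fst o := match o with
    | .inl o => X.map o.α.op
    | .inr _ => f.app _
  snd o := match o with
    | .inl o => X.map o.β.op
    | .inr j => Y.map (δ j.1).op

variable {X Y : SimplicialObject C} {f : X ⟶ Y} {k : ℕ} {i : Fin (k + 2)} {L : C}
  (R : (relPresheaf (SSet.horn (k + 1) i).ι f).RepresentableBy L)

/-- The faces of the universal relative horn. -/
def hornFace (j : {j // j ≠ i}) : L ⟶ X _⦋k⦌ :=
  SSet.yonedaEquiv (X := (pts.obj X).obj (op L)) (n := ⦋k⦌)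
    (SSet.horn.ι i j.1 j.2 ≫ (R.homEquiv (𝟙 L)).1.1)

/-- The base of the universal relative horn. -/
def hornBase : L ⟶ Y _⦋k + 1⦌ :=
  SSet.yonedaEquiv (X := (pts.obj Y).obj (op L)) (n := ⦋k + 1⦌) (R.homEquiv (𝟙 L)).1.2

lemma comp_hornFace {Z : C} (m : Z ⟶ L) (j : {j // j ≠ i}) :
    m ≫ hornFace R j = SSet.yonedaEquiv (X := (pts.obj X).obj (op Z)) (n := ⦋k⦌)
      (SSet.horn.ι i j.1 j.2 ≫ (R.homEquiv m).1.1) := by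
  have e : (R.homEquiv m).1.1 = (R.homEquiv (𝟙 L)).1.1 ≫ (pts.obj X).map m.op := by
    rw [R.homEquiv_eq]; rfl
  rw [e]
  rfl

lemma comp_hornBase {Z : C} (m : Z ⟶ L) :
    m ≫ hornBase R = SSet.yonedaEquiv (X := (pts.obj Y).obj (op Z)) (n := ⦋k + 1⦌)
      (R.homEquiv m).1.2 := by
  have e : (R.homEquiv m).1.2 = (R.homEquiv (𝟙 L)).1.2 ≫ (pts.obj Y).map m.op := by
    rw [R.homEquiv_eq]; rfl
  rw [e]
  rfl

lemma horn_ι_comp {i : Fin (k + 2)} {j l : {j // j ≠ i}} {r : SimplexCategory} {α β : r ⟶ ⦋k⦌}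
    (h : α ≫ δ j.1 = β ≫ δ l.1) :
    SSet.stdSimplex.{v}.map α ≫ SSet.horn.ι i j.1 j.2 =
      SSet.stdSimplex.{v}.map β ≫ SSet.horn.ι i l.1 l.2 := by
  rw [← cancel_mono (SSet.horn (k + 1) i).ι, Category.assoc, Category.assoc, SSet.horn.ι_ι,
    SSet.horn.ι_ι]
  exact (SSet.stdSimplex.map_comp α (δ j.1)).symm.trans
    ((congrArg _ h).trans (SSet.stdSimplex.map_comp β (δ l.1)))

lemma hornFace_comp_map {j l : {j // j ≠ i}} {r : SimplexCategory} {α β : r ⟶ ⦋k⦌}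
    (h : α ≫ δ j.1 = β ≫ δ l.1) :
    hornFace R j ≫ X.map α.op = hornFace R l ≫ X.map β.op := by
  have e := fun (j : {j // j ≠ i}) (α : r ⟶ ⦋k⦌) =>
    SSet.yonedaEquiv_naturality α (SSet.horn.ι i j.1 j.2 ≫ (R.homEquiv (𝟙 L)).1.1)
  refine (e j α).trans (Eq.trans ?_ (e l β).symm)
  exact congrArg _ ((Category.assoc _ _ _).symm.trans
    ((congrArg (· ≫ (R.homEquiv (𝟙 L)).1.1) (horn_ι_comp h)).trans (Category.assoc _ _ _)))

lemma hornFace_comp_app (j : {j // j ≠ i}) :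
    hornFace R j ≫ f.app _ = hornBase R ≫ Y.map (δ j.1).op := by
  have h := (R.homEquiv (𝟙 L)).2
  have e := SSet.yonedaEquiv_naturality (δ j.1) (R.homEquiv (𝟙 L)).1.2
  have e' := SSet.yonedaEquiv_comp (SSet.horn.ι i j.1 j.2 ≫ (R.homEquiv (𝟙 L)).1.1)
    ((pts.map f).app (op L))
  refine e'.symm.trans (Eq.trans ?_ e.symm)
  refine congrArg _ ?_
  rw [Category.assoc, h]
  exact (Category.assoc _ _ _).symm.trans (congrArg (· ≫ (R.homEquiv (𝟙 L)).1.2)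
    (SSet.horn.ι_ι i j.1 j.2))

lemma hornFace_hom_ext {Z : C} {m m' : Z ⟶ L}
    (h : ∀ j, m ≫ hornFace R j = m' ≫ hornFace R j) (h' : m ≫ hornBase R = m' ≫ hornBase R) :
    m = m' := by
  refine R.homEquiv.injective (Subtype.ext (Prod.ext ?_ ?_))
  · refine horn_hom_ext fun j => SSet.yonedaEquiv.injective ?_
    rw [← comp_hornFace, ← comp_hornFace, h]
  · refine SSet.yonedaEquiv.injective ?_
    rw [← comp_hornBase, ← comp_hornBase, h']

lemma exists_hornLift {Z : C} (x : {j // j ≠ i} → (Z ⟶ X _⦋k⦌)) (y : Z ⟶ Y _⦋k + 1⦌)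
    (hx : ∀ (j l : {j // j ≠ i}) (r : ℕ), r < k + 1 → ∀ (α β : ⦋r⦌ ⟶ ⦋k⦌),
      α ≫ δ j.1 = β ≫ δ l.1 → x j ≫ X.map α.op = x l ≫ X.map β.op)
    (hy : ∀ j : {j // j ≠ i}, x j ≫ f.app _ = y ≫ Y.map (δ j.1).op) :
    ∃ m : Z ⟶ L, (∀ j, m ≫ hornFace R j = x j) ∧ m ≫ hornBase R = y := by
  obtain ⟨s, hs⟩ := (isCompatible_of_le (A := (pts.obj X).obj (op Z)) x hx).exists_desc
  let t : Δ[k + 1] ⟶ (pts.obj Y).obj (op Z) :=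
    SSet.yonedaEquiv.symm (y : ((pts.obj Y).obj (op Z)).obj (op ⦋k + 1⦌))
  have ht : SSet.yonedaEquiv t = y := SSet.yonedaEquiv.apply_symm_apply _
  have hst : s ≫ (pts.map f).app (op Z) = (SSet.horn (k + 1) i).ι ≫ t := by
    refine horn_hom_ext fun j => SSet.yonedaEquiv.injective ?_
    rw [← Category.assoc, ← Category.assoc, SSet.horn.ι_ι, SSet.yonedaEquiv_comp, hs]
    refine (hy j).trans ?_
    rw [← ht]
    exact SSet.yonedaEquiv_naturality (δ j.1) t
  refine ⟨R.homEquiv.symm ⟨(s, t), hst⟩, fun j => ?_, ?_⟩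
  · refine (comp_hornFace R _ j).trans (Eq.trans ?_ (hs j))
    exact congrArg (fun z => SSet.yonedaEquiv (SSet.horn.ι i j.1 j.2 ≫ z.1.1))
      (R.homEquiv.apply_symm_apply _)
  · refine (comp_hornBase R _).trans (Eq.trans ?_ ht)
    exact congrArg (fun z => SSet.yonedaEquiv z.1.2) (R.homEquiv.apply_symm_apply _)

/-- The faces of the universal relative horn form a multifork. -/
def hornFork : Multifork (hornIndex f k i) :=
  Multifork.ofι _ L (fun o => match o with
    | none => hornBase R
    | some j => hornFace R j) (by
    rintro (o | j)
    · exact hornFace_comp_map R o.w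
    · exact hornFace_comp_app R j)

/-- A relative horn is the limit of its faces. -/
lemma nonempty_isLimit_hornFork : Nonempty (IsLimit (hornFork R)) := by
  have key : ∀ E : Multifork (hornIndex f k i), ∃ m : E.pt ⟶ L,
      (∀ j, m ≫ hornFace R j = E.ι (some j)) ∧ m ≫ hornBase R = E.ι none := fun E =>
    exists_hornLift R (fun j => E.ι (some j)) (E.ι none)
      (fun j l r hr α β h => E.condition (.inl ⟨j, l, ⟨r, hr⟩, α, β, h⟩))
      (fun j => E.condition (.inr j))
  choose m h h' using key
  refine ⟨Multifork.IsLimit.mk _ m ?_ ?_⟩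
  · rintro E (_ | j)
    · exact h' E
    · exact h E j
  · intro E m' hm'
    refine hornFace_hom_ext R (fun j => ?_) ?_
    · exact (hm' (some j)).trans (h E j).symm
    · exact (hm' none).trans (h' E).symm

section

variable (p : C ⥤ Type v) [PreservesFiniteLimits p]

/-- Preservation of finite limits identifies the value of `p` on a relative horn object with
compatible families of elements. -/
lemma bijective_map_hornFork : Function.Bijective ((hornFork R).map p).toSections := by
  classical
  have : Fintype (hornShape k i).L := inferInstanceAs (Fintype (Option {j // j ≠ i}))
  have : Finite (hornShape k i).R := inferInstanceAs (Finite (HornOverlap k i ⊕ {j // j ≠ i}))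
  have := Fintype.ofFinite (hornShape k i).R
  exact (Multifork.isLimit_types_iff _).1
    ⟨Multifork.isLimitMapOfPreserves _ p (nonempty_isLimit_hornFork R).some⟩

lemma map_hornFace_ext {a b : p.obj L}
    (h : ∀ j, p.map (hornFace R j) a = p.map (hornFace R j) b)
    (h' : p.map (hornBase R) a = p.map (hornBase R) b) : a = b := by
  refine (bijective_map_hornFork R p).1 (MulticospanIndex.sections.ext ?_)
  funext o
  match o with
  | none => exact h'
  | some j => exact h j

lemma exists_map_hornLift (x : {j // j ≠ i} → p.obj (X _⦋k⦌)) (y : p.obj (Y _⦋k + 1⦌))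
    (hx : ∀ (j l : {j // j ≠ i}) (r : ℕ) (α β : ⦋r⦌ ⟶ ⦋k⦌),
      α ≫ δ j.1 = β ≫ δ l.1 → p.map (X.map α.op) (x j) = p.map (X.map β.op) (x l))
    (hy : ∀ j : {j // j ≠ i}, p.map (f.app _) (x j) = p.map (Y.map (δ j.1).op) y) :
    ∃ a : p.obj L, (∀ j, p.map (hornFace R j) a = x j) ∧ p.map (hornBase R) a = y := by
  obtain ⟨a, ha⟩ := (bijective_map_hornFork R p).2
    { val := fun o => match o with
        | none => y
        | some j => x j
      property := by
        rintro (o | j)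
        · exact hx o.j o.l o.r o.α o.β o.w
        · exact hy j }
  refine ⟨a, fun j => ?_, ?_⟩
  · exact congrFun (congrArg MulticospanIndex.sections.val ha) (some j)
  · exact congrFun (congrArg MulticospanIndex.sections.val ha) none

end

lemma yonedaEquiv_tautSimplex (X : SimplicialObject C) (k : ℕ) :
    SSet.yonedaEquiv (tautSimplex X k) = (𝟙 (X _⦋k⦌) : X _⦋k⦌ ⟶ X _⦋k⦌) :=
  SSet.yonedaEquiv.apply_symm_apply _

lemma relMap_hornFace (j : {j // j ≠ i}) :
    relMap (SSet.horn (k + 1) i).ι f R ≫ hornFace R j = X.map (δ j.1).op := by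
  refine (comp_hornFace R _ j).trans ((congrArg (fun z => SSet.yonedaEquiv
    (SSet.horn.ι i j.1 j.2 ≫ z.1.1)) (R.homEquiv.apply_symm_apply _)).trans ?_)
  change SSet.yonedaEquiv (SSet.horn.ι i j.1 j.2 ≫ (SSet.horn (k + 1) i).ι ≫ tautSimplex X _) = _
  rw [← Category.assoc, SSet.horn.ι_ι]
  refine (SSet.yonedaEquiv_naturality (δ j.1) (tautSimplex X (k + 1))).symm.trans ?_
  exact (congrArg (fun z => ((pts.obj X).obj (op (X _⦋k + 1⦌))).map (δ j.1).op z)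
    (yonedaEquiv_tautSimplex X (k + 1))).trans (Category.id_comp _)

lemma relMap_hornBase :
    relMap (SSet.horn (k + 1) i).ι f R ≫ hornBase R = f.app _ := by
  refine (comp_hornBase R _).trans ((congrArg (fun z => SSet.yonedaEquiv z.1.2)
    (R.homEquiv.apply_symm_apply _)).trans ?_)
  change SSet.yonedaEquiv (tautSimplex X _ ≫ _) = _
  rw [SSet.yonedaEquiv_comp]
  exact (congrArg (fun z => ((pts.map f).app (op (X _⦋k + 1⦌))).app _ z)
    (yonedaEquiv_tautSimplex X (k + 1))).trans (Category.id_comp _)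

/-- The map of simplicial sets induced by `f` and a functor to sets. -/
abbrev mapSSet (p : C ⥤ Type v) (f : X ⟶ Y) :
    ((SimplicialObject.whiskering C (Type v)).obj p).obj X ⟶
      ((SimplicialObject.whiskering C (Type v)).obj p).obj Y :=
  ((SimplicialObject.whiskering C (Type v)).obj p).map f

/-- A horn at the point is an element of `p(L)`, and the cover to `L` becomes a surjection there. -/
lemma hornFilling_mapSSet {W : MorphismProperty C} {N : ℕ∞} (hf : IsStack W N f) {p : C ⥤ Type v}
    (hp : IsPoint W p) (k : ℕ) (i : Fin (k + 2)) : HornFilling (mapSSet p f) k i := by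
  have := hp.preservesFiniteLimits
  intro x y hx hy
  obtain ⟨L, R, hR, -⟩ := hf.horn (k + 1) k.succ_pos i
  obtain ⟨a, ha, ha'⟩ := exists_map_hornLift R p (fun j => x j.1) y
    (fun j l r α β h => hx j.1 j.2 l.1 l.2 r α β h) (fun j => hy j.1 j.2)
  obtain ⟨z, rfl⟩ := hp.surjective _ hR a
  refine ⟨z, ?_, fun j hj => ?_⟩
  · rw [← ha', ← Functor.map_comp_apply, relMap_hornBase]
    rfl
  · have := ha ⟨j, hj⟩
    rw [← this, ← Functor.map_comp_apply, relMap_hornFace]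
    rfl

end

/-! ### The orbit space of the higher morphism space, at points -/

section

open SimplexCategory

/-- A homotopy ending at `y` has the same base and the same faces other than `n` as the degenerate
simplex on `y`. Homotopies thus form a pullback of relative horn maps, which is compatible with
points. -/
lemma isHtpy_iff {A B : SSet.{v}} {φ : A ⟶ B} {n : ℕ} (h : A _⦋n + 1⦌) (y : A _⦋n⦌) :
    (IsHtpy φ h ∧ A.map (δ (Fin.last (n + 1))).op h = y) ↔
      φ.app _ h = φ.app _ (A.map (σ (Fin.last n)).op y) ∧
      ∀ j : {j : Fin (n + 2) // j ≠ (Fin.last n).castSucc},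
        A.map (δ j.1).op h = A.map (δ j.1).op (A.map (σ (Fin.last n)).op y) := by
  constructor
  · rintro ⟨hh, rfl⟩
    rw [map_map]
    refine ⟨hh.base.trans (NatTrans.naturality_apply φ (collapse n).op h).symm, ?_⟩
    rintro ⟨j, hj⟩
    have := j.2
    have hj' : j.1 ≠ n := fun e => hj (Fin.ext e)
    rcases eq_or_ne j (Fin.last (n + 1)) with rfl | hj''
    · rw [map_map, ← Category.assoc, δ_last_σ, Category.id_comp]
    · have hj'' : j.1 ≠ n + 1 := fun e => hj'' (Fin.ext e)
      rw [map_map]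
      exact hh.face n (δ j) j (by omega) (misses_δ j)
  · rintro ⟨h1, h2⟩
    obtain rfl : A.map (δ (Fin.last (n + 1))).op h = y := by
      rw [h2 ⟨Fin.last (n + 1), fun e => by simpa using congrArg Fin.val e⟩, map_map, δ_last_σ,
        op_id, Functor.map_id_apply]
    rw [map_map] at h1
    refine ⟨⟨h1.trans (NatTrans.naturality_apply φ (collapse n).op h), fun r α l hl hα => ?_⟩, rfl⟩
    obtain ⟨β, rfl⟩ := hα.exists_eq_comp_δ
    have hl' : l ≠ (Fin.last n).castSucc := by
      rintro rfl
      simp at hl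
    rw [← map_map, h2 ⟨l, hl'⟩, map_map, map_map, map_map]
    simp only [collapse, Category.assoc]

lemma joinFunctor_map_const (n : ℕ) :
    (joinFunctor n).map (SimplexCategory.const ⦋1⦌ ⦋0⦌ 0) = σ (Fin.last n) := by
  refine hom_ext_val fun (t : Fin (n + 2)) => ?_
  have ht := t.2
  refine Eq.trans ?_ (val_σ (Fin.last n) t).symm
  by_cases h : t.1 < n
  · refine (joinHom_of_lt n _ t h).trans ?_
    rw [if_neg (by simp; omega)]
  · refine (joinHom_of_not_lt n _ t h).trans ?_
    have : ((SimplexCategory.const ⦋1⦌ ⦋0⦌ 0).toOrderHom ⟨t.1 - n, by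
      change t.1 - n < 2; omega⟩).1 = 0 := rfl
    simp only [this, Fin.val_last]
    split_ifs <;> omega

lemma joinFunctor_map_δ_zero (n : ℕ) :
    (joinFunctor n).map (δ (0 : Fin 2)) = δ (Fin.last n).castSucc := by
  refine hom_ext_val fun (t : Fin (n + 1)) => ?_
  have ht := t.2
  refine Eq.trans ?_ (val_δ (Fin.last n).castSucc t).symm
  by_cases h : t.1 < n
  · refine (joinHom_of_lt n (a := 0) _ t h).trans ?_
    rw [if_pos (by simpa using h)]
  · refine (joinHom_of_not_lt n (a := 0) _ t h).trans ?_
    rw [val_δ]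
    simp only [Fin.val_last, Fin.val_castSucc, Fin.val_zero]
    split_ifs <;> omega

lemma joinFunctor_map_δ_one (n : ℕ) :
    (joinFunctor n).map (δ (1 : Fin 2)) = δ (Fin.last (n + 1)) := by
  refine hom_ext_val fun (t : Fin (n + 1)) => ?_
  have ht := t.2
  refine Eq.trans ?_ (val_δ (Fin.last (n + 1)) t).symm
  by_cases h : t.1 < n
  · refine (joinHom_of_lt n (a := 0) _ t h).trans ?_
    rw [if_pos (by simp; omega)]
  · refine (joinHom_of_not_lt n (a := 0) _ t h).trans ?_
    rw [val_δ]
    simp only [Fin.val_last, Fin.val_one]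
    split_ifs <;> omega

variable {X Y : SimplicialObject C} {f : X ⟶ Y} {n : ℕ}

/-- This translates the join description of `P^{≥n}(f)_1` into conditions on one (n+1)-simplex: `id
+ θ` for the constant `θ : [1] → [0]` is the last degeneracy. -/
lemma mem_higherMorphismsAt_one {c : C} (x : c ⟶ X _⦋n + 1⦌) :
    x ∈ (higherMorphismsAt n f (op c)).obj (op ⦋1⦌) ↔
      IsHtpy (A := (pts.obj X).obj (op c)) ((pts.map f).app (op c)) x := by
  let A := (pts.obj X).obj (op c)
  let B := (pts.obj Y).obj (op c)
  let φ : A ⟶ B := (pts.map f).app (op c)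
  let x' : A _⦋n + 1⦌ := x
  constructor
  · rintro ⟨⟨⟨h1, h2⟩, h⟩, e1, e2⟩
    have e3 : φ.app _ x' = B.map (σ (Fin.last n)).op (SSet.yonedaEquiv (n := ⦋n⦌) h2) := by
      rw [← joinFunctor_map_const]
      refine Eq.trans ?_ (SSet.yonedaEquiv_naturality
        ((joinFunctor n).map (SimplexCategory.const ⦋1⦌ ⦋0⦌ 0)) h2).symm
      exact (SSet.yonedaEquiv.apply_symm_apply _).symm.trans
        (congrArg SSet.yonedaEquiv (SSet.yonedaEquiv_symm_comp x' φ ▸ e2))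
    refine ⟨?_, fun r α l hl hα => ?_⟩
    · refine e3.trans ?_
      rw [← collapse_σ, ← map_map, ← e3]
    · have e4 := fun (α : ⦋r⦌ ⟶ ⦋n + 1⦌) (hα : Misses α l) =>
        ConcreteCategory.congr_hom (congr_app e1 (op ⦋r⦌))
          ⟨SSet.stdSimplex.objEquiv.symm α, l.1, hl, fun t e => hα t (Fin.ext e)⟩
      refine (e4 α hα).trans (Eq.trans ?_ (e4 _ (hα.comp_collapse hl)).symm)
      refine congrArg (fun z => h1.app (op ⦋r⦌) z) (Subtype.ext ?_)
      refine congrArg (fun z => SSet.stdSimplex.objEquiv.symm z) ?_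
      change α ≫ (joinFunctor n).map (SimplexCategory.const ⦋1⦌ ⦋0⦌ 0) =
        (α ≫ collapse n) ≫ (joinFunctor n).map (SimplexCategory.const ⦋1⦌ ⦋0⦌ 0)
      rw [joinFunctor_map_const]
      exact (congrArg (α ≫ ·) (collapse_σ n)).symm.trans (Category.assoc _ _ _).symm
  · intro hh
    -- The required vertex of the target is given by the end of the homotopy, its face opposite `n +
    -- 1`.
    let y : Δ[n] ⟶ A := SSet.yonedaEquiv.symm (A.map (δ (Fin.last (n + 1))).op x')
    have ey : joinMap n (SimplexCategory.const ⦋1⦌ ⦋0⦌ 0) ≫ y =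
        SSet.yonedaEquiv.symm (A.map (collapse n).op x') := by
      refine (SSet.yonedaEquiv_symm_naturality_left
        ((joinFunctor n).map (SimplexCategory.const ⦋1⦌ ⦋0⦌ 0)) _).trans ?_
      rw [joinFunctor_map_const]
      exact congrArg SSet.yonedaEquiv.symm (map_map _ _ x')
    refine ⟨⟨((boundaryJoin n 0).ι ≫ y, y ≫ φ), Category.assoc _ _ _⟩, ?_, ?_⟩
    · change _ = boundaryJoinMap n (SimplexCategory.const ⦋1⦌ ⦋0⦌ 0) ≫ (boundaryJoin n 0).ι ≫ y
      rw [← Category.assoc]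
      erw [boundaryJoinMap_ι]
      rw [Category.assoc, ey]
      ext ⟨⟨r⟩⟩ ⟨s, l, hl, hs⟩
      have := hh.face r (SSet.stdSimplex.objEquiv s) ⟨l, by omega⟩ hl
        (fun t e => hs t (congrArg Fin.val e))
      refine this.trans ?_
      exact (map_map (SSet.stdSimplex.objEquiv s) (collapse n) x').symm
    · change _ = joinMap n (SimplexCategory.const ⦋1⦌ ⦋0⦌ 0) ≫ y ≫ φ
      rw [← Category.assoc, ey]
      refine (SSet.yonedaEquiv_symm_comp x' φ).trans ?_
      refine Eq.trans ?_ (SSet.yonedaEquiv_symm_comp _ φ).symm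
      refine congrArg SSet.yonedaEquiv.symm ?_
      exact hh.base.trans (NatTrans.naturality_apply φ (collapse n).op x').symm

section

variable {W : MorphismProperty C} (hW : IsCovers W) {Q : C} {q : X _⦋n⦌ ⟶ Q}
  (hq : IsOrbitSpace W (higherMorphisms n f) (higherMorphismsVertices n f) q)

include hq

lemma IsOrbitSpace.comp_eq {c : C} (h : c ⟶ X _⦋n + 1⦌)
    (hh : IsHtpy (A := (pts.obj X).obj (op c)) ((pts.map f).app (op c)) h) :
    (h ≫ X.map (δ (Fin.last n).castSucc).op) ≫ q = (h ≫ X.map (δ (Fin.last (n + 1))).op) ≫ q := by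
  have := hq.condition (c := c) ⟨h, (mem_higherMorphismsAt_one h).2 hh⟩
  have e0 : (higherMorphismsVertices n f).homEquiv.symm (((higherMorphisms n f).obj (op c)).δ 0
      ⟨h, (mem_higherMorphismsAt_one h).2 hh⟩) = h ≫ X.map ((joinFunctor n).map (δ (0 : Fin 2))).op :=
    rfl
  have e1 : (higherMorphismsVertices n f).homEquiv.symm (((higherMorphisms n f).obj (op c)).δ 1
      ⟨h, (mem_higherMorphismsAt_one h).2 hh⟩) = h ≫ X.map ((joinFunctor n).map (δ (1 : Fin 2))).op :=
    rfl
  rw [e0, e1, joinFunctor_map_δ_zero, joinFunctor_map_δ_one] at this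
  exact this

lemma IsOrbitSpace.existsUnique_desc {Z : C} (ε : X _⦋n⦌ ⟶ Z)
    (hε : ∀ (c : C) (h : c ⟶ X _⦋n + 1⦌),
      IsHtpy (A := (pts.obj X).obj (op c)) ((pts.map f).app (op c)) h →
      (h ≫ X.map (δ (Fin.last n).castSucc).op) ≫ ε = (h ≫ X.map (δ (Fin.last (n + 1))).op) ≫ ε) :
    ∃! u : Q ⟶ Z, q ≫ u = ε := by
  refine hq.desc ε fun {c} p => ?_
  have e0 : (higherMorphismsVertices n f).homEquiv.symm (((higherMorphisms n f).obj (op c)).δ 0 p) =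
    p.1 ≫ X.map ((joinFunctor n).map (δ (0 : Fin 2))).op := rfl
  have e1 : (higherMorphismsVertices n f).homEquiv.symm (((higherMorphisms n f).obj (op c)).δ 1 p) =
    p.1 ≫ X.map ((joinFunctor n).map (δ (1 : Fin 2))).op := rfl
  rw [e0, e1, joinFunctor_map_δ_zero, joinFunctor_map_δ_one]
  exact hε c p.1 ((mem_higherMorphismsAt_one (c := c) p.1).1 p.2)

include hW in
/-- At a point, two simplices have the same image in the orbit space if and only if they are
homotopic. -/
lemma IsOrbitSpace.map_eq_iff {N : ℕ∞} (hf : IsStack W N f) {p : C ⥤ Type v} (hp : IsPoint W p)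
    (a b : p.obj (X _⦋n⦌)) :
    p.map q a = p.map q b ↔
      Htpy (A := ((SimplicialObject.whiskering C (Type v)).obj p).obj X) (mapSSet p f) a b := by
  have := hp.preservesFiniteLimits
  have := hp.preservesColimits
  have hfill := fun i => hornFilling_mapSSet hf hp (n + 1) i
  obtain ⟨L, R, hR, -⟩ := hf.horn (n + 1) n.succ_pos (Fin.last n).castSucc
  let r := relMap (SSet.horn (n + 1) (Fin.last n).castSucc).ι f R
  let s : X _⦋n⦌ ⟶ X _⦋n + 1⦌ := X.map (σ (Fin.last n)).op
  have hK := hW.hasPullback (s ≫ r) r hR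
  -- By `isHtpy_iff` this object represents the homotopies `h`, paired with their ends `y`.
  let K := pullback (s ≫ r) r
  let y : K ⟶ X _⦋n⦌ := pullback.fst _ _
  let h : K ⟶ X _⦋n + 1⦌ := pullback.snd _ _
  have hKp : IsPullback y h (s ≫ r) r := IsPullback.of_hasPullback _ _
  have hface : ∀ j : {j : Fin (n + 2) // j ≠ (Fin.last n).castSucc},
      h ≫ X.map (δ j.1).op = (y ≫ s) ≫ X.map (δ j.1).op := fun j => by
    rw [← relMap_hornFace R j, ← Category.assoc, ← hKp.w]
    simp only [Category.assoc, r]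
  have hbase : h ≫ f.app _ = (y ≫ s) ≫ f.app _ := by
    rw [← relMap_hornBase R, ← Category.assoc, ← hKp.w]
    simp only [Category.assoc, r]
  have hh := (isHtpy_iff (A := (pts.obj X).obj (op K)) (φ := (pts.map f).app (op K)) h y).2
    ⟨hbase, hface⟩
  have hy : h ≫ X.map (δ (Fin.last (n + 1))).op = y := hh.2
  have w : (h ≫ X.map (δ (Fin.last n).castSucc).op) ≫ q = y ≫ q := by
    have := hq.comp_eq h hh.1
    rwa [hy] at this
  have hcolim : Nonempty (IsColimit (Cofork.ofπ q w)) := by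
    have key : ∀ s : Cofork (h ≫ X.map (δ (Fin.last n).castSucc).op) y,
        ∃! u : Q ⟶ s.pt, q ≫ u = s.π := fun t => by
      refine hq.existsUnique_desc t.π fun c h' hh' => ?_
      obtain ⟨e1, e2⟩ := (isHtpy_iff (A := (pts.obj X).obj (op c)) (φ := (pts.map f).app (op c)) h'
        (h' ≫ X.map (δ (Fin.last (n + 1))).op)).1 ⟨hh', rfl⟩
      have e : (h' ≫ X.map (δ (Fin.last (n + 1))).op) ≫ s ≫ r = h' ≫ r := by
        refine hornFace_hom_ext R (fun j => ?_) ?_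
        · simp only [Category.assoc, r, relMap_hornFace]
          exact ((e2 j).trans ((Category.assoc _ _ _).trans (Category.assoc _ _ _))).symm
        · simp only [Category.assoc, r, relMap_hornBase]
          exact (e1.trans ((Category.assoc _ _ _).trans (Category.assoc _ _ _))).symm
      rw [← hKp.lift_fst _ _ e]
      rw [Category.assoc _ y, ← t.condition, ← Category.assoc, ← Category.assoc, hKp.lift_snd]
    choose u hu hu' using key
    exact ⟨Cofork.IsColimit.mk _ u hu fun t m hm => hu' t m hm⟩
  obtain ⟨hcolim⟩ := hcolim
  have : PreservesColimitsOfSize.{0, 0} p := preservesSmallestColimits_of_preservesColimits p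
  have hcolim' := isColimitCoforkMapOfIsColimit p w hcolim
  let A := ((SimplicialObject.whiskering C (Type v)).obj p).obj X
  constructor
  · intro hab
    -- The homotopy class of `a` is saturated for the two maps from `p(K)`, because homotopy is an
    -- equivalence relation; so it is a full preimage under the coequalizer `p(q)`.
    let U : Set (p.obj (X _⦋n⦌)) := Set.ofPred fun b => Htpy (A := A) (mapSSet p f) a b
    have hU := Types.coequalizer_preimage_image_eq_of_preimage_eq _ _ _ _ hcolim' U (by
      ext κ
      have hκ : Htpy (A := A) (mapSSet p f) (p.map (h ≫ X.map (δ (Fin.last n).castSucc).op) κ)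
          (p.map y κ) := by
        have hb := ConcreteCategory.congr_hom (congrArg p.map hbase) κ
        have hf := fun j => ConcreteCategory.congr_hom (congrArg p.map (hface j)) κ
        simp only [Functor.map_comp_apply] at hb hf
        obtain ⟨e1, e2⟩ := (isHtpy_iff (A := A) (φ := mapSSet p f) (p.map h κ) (p.map y κ)).2
          ⟨hb, hf⟩
        exact ⟨_, e1, (Functor.map_comp_apply p h _ κ).symm, e2⟩
      exact ⟨fun h1 => Htpy.trans hfill h1 hκ, fun h1 => Htpy.trans hfill h1 (hκ.symm hfill)⟩)
    have : b ∈ (p.map q) ⁻¹' (p.map q '' U) := ⟨a, Htpy.refl (A := A) (n := n) a, hab⟩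
    rw [hU] at this
    exact this
  · rintro ⟨h', hh', rfl, rfl⟩
    -- A homotopy at the point is an element of `p(K)`, since `p` preserves the pullback, and on `K`
    -- the relation `w` holds.
    obtain ⟨e1, e2⟩ := (isHtpy_iff (A := A) (φ := mapSSet p f) h' _).1 ⟨hh', rfl⟩
    obtain ⟨κ, -, rfl⟩ := ((Types.isPullback_iff _ _ _ _).1 (hKp.map p)).2.2
      (p.map (X.map (δ (Fin.last (n + 1))).op) h') h' (by
        refine map_hornFace_ext R p (fun j => ?_) ?_
        · refine Eq.trans ?_ ((e2 j).symm.trans ?_)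
          · rw [← Functor.map_comp_apply, Category.assoc, relMap_hornFace, Functor.map_comp_apply]
            rfl
          · exact (ConcreteCategory.congr_hom ((p.map_comp _ _).symm.trans
              (congrArg p.map (relMap_hornFace R j))) h').symm
        · refine Eq.trans ?_ (e1.symm.trans ?_)
          · rw [← Functor.map_comp_apply, Category.assoc, relMap_hornBase, Functor.map_comp_apply]
            rfl
          · exact (ConcreteCategory.congr_hom ((p.map_comp _ _).symm.trans
              (congrArg p.map (relMap_hornBase R))) h').symm)
    change p.map q (p.map _ (p.map h κ)) = p.map q (p.map _ (p.map h κ))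
    rw [← Functor.map_comp_apply, ← Functor.map_comp_apply, ← Functor.map_comp_apply,
      ← Functor.map_comp_apply, ← Category.assoc, w, ← Category.assoc, hy]

include hW in
/-- If all faces but one of two simplices over the same base agree in the orbit space, then so
does the remaining face. -/
lemma IsOrbitSpace.exchange (hC : EnoughPoints W) {N : ℕ∞} (hf : IsStack W N f) (i : Fin (n + 2))
    {c : C} (x x' : c ⟶ X _⦋n + 1⦌) (hx : x ≫ f.app _ = x' ≫ f.app _)
    (hxx' : ∀ j ≠ i, x ≫ X.map (δ j).op ≫ q = x' ≫ X.map (δ j).op ≫ q) :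
    x ≫ X.map (δ i).op ≫ q = x' ≫ X.map (δ i).op ≫ q := by
  -- A failure would be visible at some point, where it contradicts the homotopy statement.
  by_contra hne
  obtain ⟨p, hp, hpne⟩ := hC _ _ hne
  refine hpne (ConcreteCategory.hom_ext _ _ fun t => ?_)
  simp only [Functor.map_comp_apply]
  refine (hq.map_eq_iff hW hf hp _ _).2 (htpy_face_of_htpy_faces
    (A := ((SimplicialObject.whiskering C (Type v)).obj p).obj X)
    (fun i => hornFilling_mapSSet hf hp (n + 1) i) (p.map x t) (p.map x' t) i ?_ fun j hj => ?_)
  · have := ConcreteCategory.congr_hom (congrArg p.map hx) t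
    simp only [Functor.map_comp_apply] at this
    exact this
  · refine (hq.map_eq_iff hW hf hp _ _).1 ?_
    have := ConcreteCategory.congr_hom (congrArg p.map (hxx' j hj)) t
    simp only [Functor.map_comp_apply] at this
    exact this

end

end

/-! ### Skeleta of simplices -/

section

open SimplexCategory

lemma exists_misses {l k : ℕ} (α : ⦋l⦌ ⟶ ⦋k⦌) (h : l < k) : ∃ j, Misses α j := by
  by_contra! hα
  have : Epi α := SimplexCategory.epi_iff_surjective.2 fun j => by
    by_contra hj
    exact hα j fun t e => hj ⟨t, e⟩
  have := len_le_of_epi α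
  simp at this
  omega

/-- A simplex of dimension at most `k` in `Δ[k + 1]` lies in a face. -/
lemma map_comp_eq_of_faces {A : SSet.{v}} {k l : ℕ} (hl : l ≤ k) {t t' : Δ[k + 1] ⟶ A}
    (h : ∀ j, SSet.stdSimplex.δ j ≫ t = SSet.stdSimplex.δ j ≫ t') (α : ⦋l⦌ ⟶ ⦋k + 1⦌) :
    SSet.stdSimplex.map α ≫ t = SSet.stdSimplex.map α ≫ t' := by
  obtain ⟨j, hj⟩ := exists_misses α (by omega)
  obtain ⟨β, rfl⟩ := hj.exists_eq_comp_δ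
  have e : SSet.stdSimplex.{v}.map (β ≫ δ j) = SSet.stdSimplex.map β ≫ SSet.stdSimplex.δ j :=
    SSet.stdSimplex.map_comp _ _
  rw [e]
  exact (Category.assoc _ _ t).trans ((congrArg _ (h j)).trans (Category.assoc _ _ t').symm)

lemma exists_of_mem_skeleton {K : SSet.{v}} {d : ℕ} {m : SimplexCategoryᵒᵖ} {z : K.obj m}
    (hz : z ∈ (K.skeleton d).obj m) :
    ∃ (l : ℕ) (_ : l < d) (x : K _⦋l⦌) (γ : m.unop ⟶ ⦋l⦌), z = K.map γ.op x := by
  let D : K.Subcomplex :=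
    { obj := fun m => Set.ofPred fun z =>
        ∃ (l : ℕ) (_ : l < d) (x : K _⦋l⦌) (γ : m.unop ⟶ ⦋l⦌), z = K.map γ.op x
      map := by
        rintro m m' u _ ⟨l, hl, x, γ, rfl⟩
        exact ⟨l, hl, x, u.unop ≫ γ, by rw [← map_map]; rfl⟩ }
  have hD : K.skeleton d ≤ D := by
    refine iSup_le fun l => iSup_le fun x => ?_
    rw [SSet.Subcomplex.ofSimplex_le_iff]
    exact ⟨l, l.2, x.1, 𝟙 _, by rw [op_id, Functor.map_id_apply]⟩
  exact hD m hz

lemma skeleton_hom_ext {K A : SSet.{v}} {d : ℕ} {s s' : (K.skeleton d).toSSet ⟶ A}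
    (h : ∀ l (hl : l < d) (x : K _⦋l⦌),
      s.app _ ⟨x, K.mem_skeleton x hl⟩ = s'.app _ ⟨x, K.mem_skeleton x hl⟩) : s = s' := by
  ext m ⟨z, hz⟩
  obtain ⟨l, hl, x, γ, rfl⟩ := exists_of_mem_skeleton hz
  have e := fun s : (K.skeleton d).toSSet ⟶ A =>
    NatTrans.naturality_apply s γ.op ⟨x, K.mem_skeleton x hl⟩
  exact (e s).trans ((congrArg _ (h l hl x)).trans (e s').symm)

lemma skeleton_ι_comp_eq {A : SSet.{v}} {k d : ℕ} (hd : d ≤ k + 1) {t t' : Δ[k + 1] ⟶ A}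
    (h : ∀ j, SSet.stdSimplex.δ j ≫ t = SSet.stdSimplex.δ j ≫ t') :
    (SSet.skeleton Δ[k + 1] d).ι ≫ t = (SSet.skeleton Δ[k + 1] d).ι ≫ t' := by
  refine skeleton_hom_ext fun l hl x => ?_
  have e := fun t : Δ[k + 1] ⟶ A => congrArg (fun z => t.app (op ⦋l⦌) z)
    (SSet.yonedaEquiv_map (SSet.stdSimplex.objEquiv x))
  exact (e t).symm.trans ((congrArg SSet.yonedaEquiv
    (map_comp_eq_of_faces (by omega) h (SSet.stdSimplex.objEquiv x))).trans (e t'))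

/-! ### Simplices and morphisms -/

variable {X Y : SimplicialObject C}

lemma yonedaEquiv_map_comp {c : Cᵒᵖ} {m k : ℕ} (α : ⦋m⦌ ⟶ ⦋k⦌) (x : Δ[k] ⟶ (pts.obj X).obj c) :
    (SSet.yonedaEquiv (SSet.stdSimplex.map α ≫ x) : c.unop ⟶ X _⦋m⦌) =
      (SSet.yonedaEquiv x : c.unop ⟶ X _⦋k⦌) ≫ X.map α.op :=
  (SSet.yonedaEquiv_naturality α x).symm

lemma simplexIso_homPost (f : X ⟶ Y) (k : ℕ) :
    yoneda.map (f.app (op ⦋k⦌)) ≫ (simplexIso Y k).hom =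
      (simplexIso X k).hom ≫ homPost Δ[k] (pts.map f) := by
  ext c x
  exact (SSet.yonedaEquiv_symm_comp (n := ⦋k⦌) (X := (pts.obj X).obj c) x
    ((pts.map f).app c)).symm

variable {W : MorphismProperty C} (hW : IsCovers W) {f : X ⟶ Y} {n : ℕ}

include hW in
/-- If all faces but one of two simplices over the same base agree in the orbit space, then so
does the remaining face. -/
lemma IsOrbitSpace.exchange_stdSimplex (hC : EnoughPoints W) {N : ℕ∞} (hf : IsStack W N f)
    {Q : C} {q : X _⦋n⦌ ⟶ Q}
    (hq : IsOrbitSpace W (higherMorphisms n f) (higherMorphismsVertices n f) q) (i : Fin (n + 2))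
    {c : Cᵒᵖ} (x x' : Δ[n + 1] ⟶ (pts.obj X).obj c)
    (hx : x ≫ (pts.map f).app c = x' ≫ (pts.map f).app c)
    (hxx' : ∀ j ≠ i, (SSet.yonedaEquiv (SSet.stdSimplex.δ j ≫ x) : c.unop ⟶ X _⦋n⦌) ≫ q =
      (SSet.yonedaEquiv (SSet.stdSimplex.δ j ≫ x') : c.unop ⟶ X _⦋n⦌) ≫ q) :
    (SSet.yonedaEquiv (SSet.stdSimplex.δ i ≫ x) : c.unop ⟶ X _⦋n⦌) ≫ q =
      (SSet.yonedaEquiv (SSet.stdSimplex.δ i ≫ x') : c.unop ⟶ X _⦋n⦌) ≫ q := by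
  have e := fun (j : Fin (n + 2)) (x : Δ[n + 1] ⟶ (pts.obj X).obj c) =>
    (congrArg (· ≫ q) (yonedaEquiv_map_comp (δ j) x)).trans (Category.assoc _ _ _)
  refine (e i x).trans (Eq.trans ?_ (e i x').symm)
  refine hq.exchange hW hC hf i _ _ (congrArg SSet.yonedaEquiv hx) fun j hj => ?_
  exact (e j x).symm.trans ((hxx' j hj).trans (e j x'))

/-- The horn presheaves need not be representable a priori: restriction to a vertex makes each of
them a cover of `T_0`. -/
lemma isLieGroupoid_of_presheaf_homPre {T : SimplicialObject C} (hW : IsCovers W)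
    (hT : ∀ k, 0 < k → ∀ i : Fin (k + 1), W.presheaf (homPre (SSet.horn k i).ι (pts.obj T))) :
    IsLieGroupoid W ⊤ T := by
  have := hW.presheaf_isMultiplicative
  have := presheaf_isStableUnderBaseChange W
  intro k hk i
  obtain ⟨k, rfl⟩ : ∃ l, k = l + 1 := ⟨k - 1, by omega⟩
  have h1 : W.presheaf (homPre (hornVertex k i) (pts.obj T)) :=
    (hornVertex_mem_and_vertex_mem (homClass W.presheaf (pts.obj T)) k).2
      (fun m _ h0 i => hT m h0 i) i
  obtain ⟨L, ⟨R⟩⟩ := isRepresentable_of_presheaf h1 (Functor.IsRepresentable.mk' (simplexIso T 0))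
  exact ⟨L, R, (hW.homMap_iff _ R).2 (hT _ hk i), fun h => absurd h not_top_lt⟩

/-! ### Strictifications are `n`-stacks -/

namespace IsStrictification

variable {T : SimplicialObject C} {g : T ⟶ Y} {q : X ⟶ T} (h : IsStrictification W n f g q)

include hW h

/-- Uniqueness in dimension `n + 1` is the horn condition, and above it the coskeletal condition,
because the (n+1)-skeleton is then contained in the boundary. -/
theorem isWeakStrictification (hC : EnoughPoints W) {N : ℕ∞} (hf : IsStack W N f) :
    IsWeakStrictification W n (pts.map q) (pts.map g) where
  isIso k hk := (isIso_iff_of_representableBy (simplexIso X k) (simplexIso T k) _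
    (simplexIso_homPost q k)).2 (h.isIso_of_lt k hk)
  cover := (hW.presheaf_iff_of_representableBy (simplexIso X n) (simplexIso T n) _
    (simplexIso_homPost q n)).2 h.orbitSpace.cover
  isRepresentable := Functor.IsRepresentable.mk' (simplexIso T n)
  isSheafFor k _ := hW.isSheafFor (Functor.IsRepresentable.mk' (simplexIso T k))
  ext k hk c t t' e ht := by
    rcases hk.eq_or_lt with rfl | hk
    · obtain ⟨L, R, hR⟩ := h.horn
      have := (isIso_relMap_iff _ g R).1 hR
      refine (bijective_of_isIso (toRel (SSet.horn (n + 1) 1).ι (pts.map g)) c).1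
        (Subtype.ext (Prod.ext (horn_hom_ext fun j => ?_) e))
      have e' := SSet.horn.ι_ι (1 : Fin (n + 2)) j.1 j.2
      exact (Category.assoc _ _ t).symm.trans ((congrArg (· ≫ t) e').trans
        ((ht j.1 fun _ => j.2).trans ((congrArg (· ≫ t') e'.symm).trans (Category.assoc _ _ t'))))
    · obtain ⟨L, R, hR⟩ := h.coskeletal (k + 1)
      have := (isIso_relMap_iff _ g R).1 hR
      refine (bijective_of_isIso (toRel (SSet.skeleton Δ[k + 1] (n + 2)).ι (pts.map g)) c).1
        (Subtype.ext (Prod.ext (skeleton_ι_comp_eq (by omega) fun j => ?_) e))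
      exact ht j fun e => by omega
  exch c x x' i e hxx' := by
    rw [← Functor.map_comp, h.fac] at e
    refine SSet.yonedaEquiv.injective ?_
    exact h.orbitSpace.exchange_stdSimplex hW hC hf i x x' e fun j hj =>
      congrArg SSet.yonedaEquiv (hxx' j hj)

/-- Besides `hornProp`, `T` must be a Lie groupoid: restriction of its simplices to a horn factors
through the relative horn object, followed by a base change of the corresponding cover for `Y`. -/
theorem isStack (hC : EnoughPoints W) (hf : IsStack W ⊤ f) : IsStack W n g := by
  have := hW.presheaf_isMultiplicative
  have := presheaf_isStableUnderBaseChange W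
  have hw := h.isWeakStrictification hW hC hf
  have hB := fun k hk i => hf.target.presheaf_homPre hW k hk i
  have hE := Functor.IsRepresentable.mk' (simplexIso X 0)
  have hT := hw.isRepresentable_zero hE
  have hH : ∀ k, 0 < k → ∀ i : Fin (k + 1), IsWeakStrictification.HornProp W n (pts.map q)
      (pts.map g) k i := by
    intro k hk i
    obtain ⟨k, rfl⟩ : ∃ l, k = l + 1 := ⟨k - 1, by omega⟩
    refine hw.hornProp hW hE (fun k hk i => ?_) hB k i
    rw [← Functor.map_comp, h.fac]
    exact (hf.presheaf_toRel hW k hk i).2.1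
  refine ⟨isLieGroupoid_of_presheaf_homPre hW fun k hk i => ?_, hf.target, fun k hk i => ?_⟩
  · rw [← toRel_fst (SSet.horn k i).ι (pts.map g)]
    exact W.presheaf.comp_mem _ _ (hH k hk i).1
      (W.presheaf.of_isPullback (rel.isPullback _ _).flip (hB k hk i))
  · obtain ⟨k, rfl⟩ : ∃ l, k = l + 1 := ⟨k - 1, by omega⟩
    obtain ⟨L, ⟨R⟩⟩ := IsWeakStrictification.isRepresentable_rel_horn hW hT
      (fun m _ h0 i => (hH m h0 i).1) hB i
    exact ⟨L, R, (hW.relMap_iff _ g R).2 (hH _ hk i).1, fun hn => (isIso_relMap_iff _ g R).2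
      ((hH _ hk i).2.1 (Nat.cast_lt.1 hn))⟩

end IsStrictification

end

/-! ### Strictifications of `n`-stacks -/

section

open SimplexCategory

lemma isIso_toRel_of_isIso_homPost {S U : SSet.{v}} {E T : Cᵒᵖ ⥤ SSet.{v}} (i : S ⟶ U)
    (q : E ⟶ T) [IsIso (homPost S q)] [IsIso (homPost U q)] : IsIso (toRel i q) := by
  have : IsIso (rel.snd i q) :=
    (MorphismProperty.isomorphisms _).of_isPullback (rel.isPullback i q)
      (inferInstanceAs (IsIso (homPost S q)))
  have : IsIso (toRel i q ≫ rel.snd i q) := inferInstanceAs (IsIso (homPost U q))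
  exact IsIso.of_isIso_comp_right (toRel i q) (rel.snd i q)

lemma isIso_rel_post {S U : SSet.{v}} {E B E' B' : Cᵒᵖ ⥤ SSet.{v}} (i : S ⟶ U) {φ : E ⟶ B}
    {φ' : E' ⟶ B'} (α : E ⟶ E') (β : B ⟶ B') (w : φ ≫ β = α ≫ φ') [IsIso α] [IsIso β] :
    IsIso (rel.post i α β w) := by
  refine isIso_presheaf _ fun c => ⟨fun p p' h => ?_, fun p => ?_⟩
  · refine Subtype.ext (Prod.ext ?_ ?_)
    · exact (cancel_mono (α.app c)).1 (congrArg (fun z => z.1.1) h)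
    · exact (cancel_mono (β.app c)).1 (congrArg (fun z => z.1.2) h)
  · refine ⟨⟨(p.1.1 ≫ inv (α.app c), p.1.2 ≫ inv (β.app c)), ?_⟩, ?_⟩
    · have w' := congr_app w c
      have hp := p.2
      simp only [NatTrans.comp_app] at w'
      rw [← cancel_mono (β.app c)]
      simp only [Category.assoc, IsIso.inv_hom_id, Category.comp_id, w', IsIso.inv_hom_id_assoc]
      exact hp
    · refine Subtype.ext (Prod.ext ?_ ?_)
      · exact (Category.assoc _ _ _).trans ((congrArg (p.1.1 ≫ ·) (IsIso.inv_hom_id _)).trans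
          (Category.comp_id _))
      · exact (Category.assoc _ _ _).trans ((congrArg (p.1.2 ≫ ·) (IsIso.inv_hom_id _)).trans
          (Category.comp_id _))

lemma toRel_comp_rel_post {S U : SSet.{v}} {E B E' B' : Cᵒᵖ ⥤ SSet.{v}} (i : S ⟶ U) {φ : E ⟶ B}
    {φ' : E' ⟶ B'} (α : E ⟶ E') (β : B ⟶ B') (w : φ ≫ β = α ≫ φ') :
    toRel i φ ≫ rel.post i α β w = homPost U α ≫ toRel i φ' := by
  ext c t
  refine Subtype.ext (Prod.ext (Category.assoc _ _ _) ?_)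
  exact (Category.assoc _ _ _).trans ((congrArg (t ≫ ·) (congr_app w c)).trans
    (Category.assoc _ _ _).symm)

instance isIso_homPost (S : SSet.{v}) {E T : Cᵒᵖ ⥤ SSet.{v}} (q : E ⟶ T) [IsIso q] :
    IsIso (homPost S q) :=
  inferInstanceAs (IsIso (Functor.whiskerRight q _))

variable {W : MorphismProperty C} {X Y T Z : SimplicialObject C} {f : X ⟶ Y} {g : T ⟶ Z} {n : ℕ}

/-- The limits and covers are already given for `f`; only invertibility above `N` is transported
from `g`. -/
lemma IsStack.of_arrow_iso (hf : IsStack W ⊤ f) {N : ℕ∞} (hg : IsStack W N g)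
    (e : Arrow.mk f ≅ Arrow.mk g) : IsStack W N f := by
  refine ⟨hf.source, hf.target, fun k hk i => ?_⟩
  obtain ⟨L, R, hR, -⟩ := hf.horn k hk i
  refine ⟨L, R, hR, fun hN => (isIso_relMap_iff _ f R).2 ?_⟩
  obtain ⟨L', R', -, hR'⟩ := hg.horn k hk i
  have := (isIso_relMap_iff _ g R').1 (hR' hN)
  have w : pts.map f ≫ pts.map e.hom.right = pts.map e.hom.left ≫ pts.map g := by
    rw [← Functor.map_comp, ← Functor.map_comp]
    exact congrArg _ e.hom.w.symm
  have := isIso_rel_post (SSet.horn k i).ι _ _ w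
  have : IsIso (toRel (SSet.horn k i).ι (pts.map f) ≫ rel.post _ _ _ w) := by
    rw [toRel_comp_rel_post]
    infer_instance
  exact IsIso.of_isIso_comp_right _ (rel.post (SSet.horn k i).ι _ _ w)

/-- A homotopy has the same relative horn as a degenerate simplex, so it equals this simplex and its
two ends agree. The identity then descends along `q` and gives the inverse. -/
lemma IsOrbitSpace.isIso_of_isStack (hf : IsStack W n f) {Q : C} {q : X _⦋n⦌ ⟶ Q}
    (hq : IsOrbitSpace W (higherMorphisms n f) (higherMorphismsVertices n f) q) : IsIso q := by
  obtain ⟨L, R, -, hR⟩ := hf.horn (n + 1) n.succ_pos (Fin.last n).castSucc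
  have := hR (Nat.cast_lt.2 n.lt_succ_self)
  obtain ⟨u, hu, -⟩ := hq.existsUnique_desc (𝟙 _) fun c h hh => by
    obtain ⟨e1, e2⟩ := (isHtpy_iff (A := (pts.obj X).obj (op c)) (φ := (pts.map f).app (op c)) h
      (h ≫ X.map (δ (Fin.last (n + 1))).op)).1 ⟨hh, rfl⟩
    have e : h = (h ≫ X.map (δ (Fin.last (n + 1))).op) ≫ X.map (σ (Fin.last n)).op := by
      rw [← cancel_mono (relMap (SSet.horn (n + 1) (Fin.last n).castSucc).ι f R)]
      refine hornFace_hom_ext R (fun j => ?_) ?_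
      · simp only [Category.assoc, relMap_hornFace]
        exact (e2 j).trans ((Category.assoc _ _ _).trans (Category.assoc _ _ _))
      · simp only [Category.assoc, relMap_hornBase]
        exact e1.trans ((Category.assoc _ _ _).trans (Category.assoc _ _ _))
    conv_lhs => rw [e]
    have hs : X.map (σ (Fin.last n)).op ≫ X.map (δ (Fin.last n).castSucc).op = 𝟙 _ := by
      rw [← X.map_comp, ← op_comp, δ_castSucc_last_σ, op_id, X.map_id]
    simp only [Category.assoc, hs, Category.comp_id]
  refine ⟨u, hu, ?_⟩
  refine (hq.existsUnique_desc q fun c h hh => hq.comp_eq h hh).unique ?_ (Category.comp_id q)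
  rw [← Category.assoc, hu, Category.id_comp]

namespace IsStrictification

variable {T : SimplicialObject C} {g : T ⟶ Y} {q : X ⟶ T} (h : IsStrictification W n f g q)

include h

/-- Above dimension `n` both `X_k` and `T_k` are relative horn objects, which agree because horns
are built from lower dimensions; up to `n` the orbit map is the only case to check. -/
theorem isIso_of_isStack (hg : IsStack W n g) (hf : IsStack W n f) : IsIso q := by
  have key : ∀ k, (∀ i : Fin (k + 1), 0 < k → IsIso (toRel (SSet.horn k i).ι (pts.map q))) ∧
      IsIso (homPost Δ[k] (pts.map q)) := by
    intro k
    induction k using Nat.strong_induction_on with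
    | _ k IH =>
    have hlt : ∀ k ≤ n, IsIso (homPost Δ[k] (pts.map q)) := by
      intro k hk
      refine (isIso_iff_of_representableBy (simplexIso X k) (simplexIso T k) _
        (simplexIso_homPost q k)).2 ?_
      rcases hk.eq_or_lt with rfl | hk
      · exact h.orbitSpace.isIso_of_isStack hf
      · exact h.isIso_of_lt k hk
    rcases Nat.eq_zero_or_pos k with rfl | hk0
    · exact ⟨fun _ h0 => absurd h0 (lt_irrefl 0), hlt 0 n.zero_le⟩
    have hΛ : ∀ i : Fin (k + 1), IsIso (homPost (SSet.horn k i).toSSet (pts.map q)) := by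
      obtain ⟨k, rfl⟩ : ∃ l, k = l + 1 := ⟨k - 1, by omega⟩
      intro i
      exact homPost_mem (.isomorphisms _) (hornVertex k i) (pts.map q) (hlt 0 n.zero_le)
        ((hornVertex_mem_and_vertex_mem (relClass (.isomorphisms _) (pts.map q)) k).2
          (fun m hm h0 i => (IH m (by omega)).1 i h0) i)
    have hΔ : IsIso (homPost Δ[k] (pts.map q)) := by
      rcases le_or_gt k n with hk | hk
      · exact hlt k hk
      · have hk' : (n : ℕ∞) < k := Nat.cast_lt.2 hk
        obtain ⟨L, R, -, hR⟩ := hf.horn k hk0 0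
        obtain ⟨L', R', -, hR'⟩ := hg.horn k hk0 0
        have h1 := (isIso_relMap_iff _ f R).1 (hR hk')
        have h2 := (isIso_relMap_iff _ g R').1 (hR' hk')
        rw [← h.fac, Functor.map_comp] at h1
        have := hΛ 0
        have h3 : IsIso (rel.post (SSet.horn k 0).ι (φ := pts.map q ≫ pts.map g)
            (φ' := pts.map g) (pts.map q) (𝟙 _) (by simp)) :=
          (MorphismProperty.isomorphisms _).of_isPullback
            (isPullback_rel_post (SSet.horn k 0).ι (pts.map q) (pts.map g)) this
        have : IsIso (homPost Δ[k] (pts.map q) ≫ toRel (SSet.horn k 0).ι (pts.map g)) := by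
          rw [← toRel_comp_post]
          infer_instance
        exact IsIso.of_isIso_comp_right _ (toRel (SSet.horn k 0).ι (pts.map g))
    exact ⟨fun i _ => have := hΛ i; isIso_toRel_of_isIso_homPost _ _, hΔ⟩
  have : ∀ k, IsIso (q.app k) := fun ⟨⟨k⟩⟩ =>
    (isIso_iff_of_representableBy (simplexIso X k) (simplexIso T k) _
        (simplexIso_homPost q k)).1 (key k).2
  exact NatIso.isIso_of_isIso_app q

theorem tfae (hf : IsStack W ⊤ f) (hg : IsStack W n g) :
    (Nonempty (Arrow.mk f ≅ Arrow.mk g) ↔ IsStack W n f) ∧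
    (Nonempty (Over.mk f ≅ Over.mk g) ↔ IsStack W n f) ∧ (IsIso q ↔ IsStack W n f) := by
  have h1 : Nonempty (Arrow.mk f ≅ Arrow.mk g) → IsStack W n f := fun ⟨e⟩ => hf.of_arrow_iso hg e
  have h2 : Nonempty (Over.mk f ≅ Over.mk g) → Nonempty (Arrow.mk f ≅ Arrow.mk g) := fun ⟨e⟩ =>
    ⟨Arrow.isoMk ((Over.forget Y).mapIso e) (Iso.refl _) (by
      simpa using Over.w e.hom)⟩
  have h3 : IsIso q → Nonempty (Over.mk f ≅ Over.mk g) := fun _ =>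
    ⟨Over.isoMk (asIso q) h.fac⟩
  have h4 : IsStack W n f → IsIso q := h.isIso_of_isStack hg
  exact ⟨⟨h1, fun h => h2 (h3 (h4 h))⟩, ⟨fun h => h1 (h2 h), fun h => h3 (h4 h)⟩,
    ⟨fun h => h1 (h2 (h3 h)), h4⟩⟩

end IsStrictification

end

/-! ### Construction of the strictification as a simplicial presheaf -/

section

open SimplexCategory

variable {W : MorphismProperty C} {X Y : SimplicialObject C} {f : X ⟶ Y} {n : ℕ} {Q : C}
  {q : X _⦋n⦌ ⟶ Q}

section

variable (hq : IsOrbitSpace W (higherMorphisms n f) (higherMorphismsVertices n f) q)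

lemma δ_castSucc_last_collapse (n : ℕ) :
    δ (Fin.last n).castSucc ≫ collapse n = δ (Fin.last (n + 1)) := by
  rw [collapse, ← Category.assoc, δ_castSucc_last_σ, Category.id_comp]

include hq

/-- The two ends of a homotopy have the same boundary, so restriction to a proper face factors
through the orbit space. -/
lemma IsOrbitSpace.comp_map_eq {c : C} {x x' : c ⟶ X _⦋n⦌} (h : x ≫ q = x' ≫ q) {m : ℕ}
    (μ : ⦋m⦌ ⟶ ⦋n⦌) {l : Fin (n + 1)} (hμ : Misses μ l) : x ≫ X.map μ.op = x' ≫ X.map μ.op := by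
  obtain ⟨u, hu, -⟩ := hq.existsUnique_desc (X.map μ.op) fun c h hh => by
    have e : (h ≫ X.map (δ (Fin.last n).castSucc).op) ≫ X.map μ.op =
        h ≫ X.map (μ ≫ δ (Fin.last n).castSucc).op := by
      rw [Category.assoc, ← X.map_comp, ← op_comp]
    have e' : (h ≫ X.map (δ (Fin.last (n + 1))).op) ≫ X.map μ.op =
        h ≫ X.map (μ ≫ δ (Fin.last (n + 1))).op := by
      rw [Category.assoc, ← X.map_comp, ← op_comp]
    rw [e, e']
    rcases (Nat.lt_succ_iff.1 l.2).lt_or_eq with hl | hl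
    · have := hh.face m (μ ≫ δ (Fin.last n).castSucc) l.castSucc hl (by
        have := hμ.comp_δ (Fin.last n).castSucc
        rwa [Fin.succAbove_of_castSucc_lt _ _ (by simpa [Fin.lt_def] using hl)] at this)
      rw [Category.assoc, δ_castSucc_last_collapse] at this
      exact this
    -- Here the image of `μ` lies in the vertices below `n`, where the two face maps coincide.
    · congr 3
      refine hom_ext_val fun t => ?_
      have h1 : (μ.toOrderHom t).1 ≠ n := fun e => hμ t (Fin.ext (e.trans hl.symm))
      have h2 : (μ.toOrderHom t).1 < n + 1 := (μ.toOrderHom t).2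
      rw [val_comp, val_comp, val_δ, val_δ]
      simp only [Fin.val_last, Fin.val_castSucc]
      rw [if_pos (by omega), if_pos (by omega)]
  rw [← hu, ← Category.assoc, h, Category.assoc]

/-- The base of a homotopy is degenerate, so its two ends have the same base. -/
lemma IsOrbitSpace.comp_base_eq {c : C} {x x' : c ⟶ X _⦋n⦌} (h : x ≫ q = x' ≫ q) :
    x ≫ f.app (op ⦋n⦌) = x' ≫ f.app (op ⦋n⦌) := by
  obtain ⟨u, hu, -⟩ := hq.existsUnique_desc (f.app (op ⦋n⦌)) fun c h hh => by
    have hb : h ≫ f.app (op ⦋n + 1⦌) = (h ≫ f.app (op ⦋n + 1⦌)) ≫ Y.map (collapse n).op := hh.base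
    have e : Y.map (collapse n).op ≫ Y.map (δ (Fin.last n).castSucc).op =
        Y.map (δ (Fin.last (n + 1))).op := by
      rw [← Y.map_comp, ← op_comp, δ_castSucc_last_collapse]
    rw [Category.assoc, Category.assoc, f.naturality, f.naturality, ← Category.assoc,
      ← Category.assoc]
    conv_lhs => rw [hb]
    rw [Category.assoc, e]
  rw [← hu, ← Category.assoc, h, Category.assoc]

/-- An endomorphism of `[n]` misses a vertex or is the identity. -/
lemma IsOrbitSpace.comp_map_eq' {c : C} {x x' : c ⟶ X _⦋n⦌} (h : x ≫ q = x' ≫ q)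
    (θ : ⦋n⦌ ⟶ ⦋n⦌) : x ≫ X.map θ.op ≫ q = x' ≫ X.map θ.op ≫ q := by
  by_cases hθ : ∃ l, Misses θ l
  · obtain ⟨l, hl⟩ := hθ
    rw [← Category.assoc, hq.comp_map_eq h θ hl, Category.assoc]
  · have : Epi θ := SimplexCategory.epi_iff_surjective.2 fun j => by
      by_contra hj
      exact hθ ⟨j, fun t e => hj ⟨t, e⟩⟩
    rw [eq_id_of_epi θ, op_id, X.map_id, Category.id_comp, h]

end

/-- A simplex of the coskeleton of `Q` over `Y` is locally the image of a simplex of `X`. -/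
def IsLocalImage (W : MorphismProperty C) (f : X ⟶ Y) (q : X _⦋n⦌ ⟶ Q) {c : C}
    {k : SimplexCategory} (y : c ⟶ Y.obj (op k)) (r : (⦋n⦌ ⟶ k) → (c ⟶ Q)) : Prop :=
  ∃ (d : C) (w : d ⟶ c) (x : d ⟶ X.obj (op k)), W w ∧ x ≫ f.app (op k) = w ≫ y ∧
    ∀ θ : ⦋n⦌ ⟶ k, x ≫ X.map θ.op ≫ q = w ≫ r θ

lemma IsLocalImage.map {c : C} {k l : SimplexCategory} {y : c ⟶ Y.obj (op k)}
    {r : (⦋n⦌ ⟶ k) → (c ⟶ Q)} (h : IsLocalImage W f q y r) (α : l ⟶ k) :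
    IsLocalImage W f q (y ≫ Y.map α.op) (fun θ => r (θ ≫ α)) := by
  obtain ⟨d, w, x, hw, hx, hr⟩ := h
  refine ⟨d, w, x ≫ X.map α.op, hw, ?_, fun θ => ?_⟩
  · rw [Category.assoc, f.naturality, ← Category.assoc, hx, Category.assoc]
  · rw [Category.assoc, ← hr, op_comp, X.map_comp, Category.assoc]

lemma IsLocalImage.comp (hW : IsCovers W) {c d : C} {k : SimplexCategory} {y : c ⟶ Y.obj (op k)}
    {r : (⦋n⦌ ⟶ k) → (c ⟶ Q)} (h : IsLocalImage W f q y r) (u : d ⟶ c) :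
    IsLocalImage W f q (u ≫ y) (fun θ => u ≫ r θ) := by
  obtain ⟨e, w, x, hw, hx, hr⟩ := h
  have := hW.hasPullback u w hw
  have := hW.isStableUnderBaseChange
  refine ⟨pullback u w, pullback.fst u w, pullback.snd u w ≫ x,
    W.of_isPullback (IsPullback.of_hasPullback u w).flip hw, ?_, fun θ => ?_⟩
  · rw [Category.assoc, hx, pullback.condition_assoc]
  · rw [Category.assoc, hr, pullback.condition_assoc]

lemma IsLocalImage.of_comp (hW : IsCovers W) {c d : C} {k : SimplexCategory} {y : c ⟶ Y.obj (op k)}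
    {r : (⦋n⦌ ⟶ k) → (c ⟶ Q)} {w : d ⟶ c} (hw : W w)
    (h : IsLocalImage W f q (w ≫ y) (fun θ => w ≫ r θ)) : IsLocalImage W f q y r := by
  obtain ⟨e, w', x, hw', hx, hr⟩ := h
  refine ⟨e, w' ≫ w, x, hW.isMultiplicative.comp_mem _ _ hw' hw, ?_, fun θ => ?_⟩
  · rw [hx, Category.assoc]
  · rw [hr, Category.assoc]

/-- The simplicial presheaf of simplices of the coskeleton of `Q` over `Y` which are locally
images of simplices of `X`. -/
def strictPsh (hW : IsCovers W) (f : X ⟶ Y) (q : X _⦋n⦌ ⟶ Q) : Cᵒᵖ ⥤ SSet.{v} where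
  obj c :=
    { obj := fun k => { m : (c.unop ⟶ Y.obj k) × ((⦋n⦌ ⟶ k.unop) → (c.unop ⟶ Q)) //
        IsLocalImage W f q m.1 m.2 }
      map := fun α => ↾fun m => ⟨(m.1.1 ≫ Y.map α, fun θ => m.1.2 (θ ≫ α.unop)), m.2.map α.unop⟩
      map_id := fun k => by
        refine ConcreteCategory.hom_ext _ _ fun m => Subtype.ext (Prod.ext ?_ ?_)
        · exact (congrArg (m.1.1 ≫ ·) (Y.map_id k)).trans (Category.comp_id _)
        · funext θ
          exact congrArg m.1.2 (Category.comp_id θ)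
      map_comp := fun α β => by
        refine ConcreteCategory.hom_ext _ _ fun m => Subtype.ext (Prod.ext ?_ ?_)
        · exact (congrArg (m.1.1 ≫ ·) (Y.map_comp α β)).trans (Category.assoc _ _ _).symm
        · funext θ
          exact congrArg m.1.2 (Category.assoc _ _ _).symm }
  map u :=
    { app := fun k => ↾fun m => ⟨(u.unop ≫ m.1.1, fun θ => u.unop ≫ m.1.2 θ), m.2.comp hW u.unop⟩
      naturality := fun k l α => by
        refine ConcreteCategory.hom_ext _ _ fun m => ?_
        exact Subtype.ext (Prod.ext (Category.assoc _ _ _).symm rfl) }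
  map_id c := by
    refine NatTrans.ext (funext fun k => ConcreteCategory.hom_ext _ _ fun m => ?_)
    refine Subtype.ext (Prod.ext (Category.id_comp _) ?_)
    funext θ
    exact Category.id_comp _
  map_comp u u' := by
    refine NatTrans.ext (funext fun k => ConcreteCategory.hom_ext _ _ fun m => ?_)
    refine Subtype.ext (Prod.ext (Category.assoc _ _ _) ?_)
    funext θ
    exact Category.assoc _ _ _

variable (hW : IsCovers W)

/-- The map from simplices of `X`. -/
def toStrictPsh (f : X ⟶ Y) (q : X _⦋n⦌ ⟶ Q) : pts.obj X ⟶ strictPsh hW f q where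
  app c :=
    { app := fun k => ↾fun (x : c.unop ⟶ X.obj k) =>
        ⟨(x ≫ f.app k, fun θ => x ≫ X.map θ.op ≫ q), c.unop, 𝟙 _, x,
          hW.isMultiplicative.id_mem _, (Category.id_comp _).symm, fun _ => (Category.id_comp _).symm⟩
      naturality := fun k l α => by
        refine ConcreteCategory.hom_ext _ _ fun (x : c.unop ⟶ X.obj k) => ?_
        refine Subtype.ext (Prod.ext ?_ ?_)
        · change (x ≫ X.map α) ≫ f.app l = (x ≫ f.app k) ≫ Y.map α
          rw [Category.assoc, Category.assoc, f.naturality]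
        · funext θ
          change (x ≫ X.map α) ≫ X.map θ.op ≫ q = x ≫ X.map (θ ≫ α.unop).op ≫ q
          rw [op_comp, X.map_comp, Category.assoc, Category.assoc, Quiver.Hom.op_unop] }
  naturality c d u := by
    refine NatTrans.ext (funext fun k => ConcreteCategory.hom_ext _ _ fun
      (x : c.unop ⟶ X.obj k) => ?_)
    refine Subtype.ext (Prod.ext (Category.assoc _ _ _) ?_)
    funext θ
    exact Category.assoc _ _ _

/-- The map to simplices of `Y`. -/
def strictPshTo (f : X ⟶ Y) (q : X _⦋n⦌ ⟶ Q) : strictPsh hW f q ⟶ pts.obj Y where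
  app c := { app := fun k => ↾fun m => m.1.1 }

lemma toStrictPsh_comp (f : X ⟶ Y) (q : X _⦋n⦌ ⟶ Q) :
    toStrictPsh hW f q ≫ strictPshTo hW f q = pts.map f := rfl

namespace strictPsh

variable {hW} {c : Cᵒᵖ} {k : ℕ}

/-- The image in `Y`. -/
def base (t : Δ[k] ⟶ (strictPsh hW f q).obj c) : c.unop ⟶ Y _⦋k⦌ := (SSet.yonedaEquiv t).1.1

/-- The faces in `Q`. -/
def comp (t : Δ[k] ⟶ (strictPsh hW f q).obj c) (θ : ⦋n⦌ ⟶ ⦋k⦌) : c.unop ⟶ Q :=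
  (SSet.yonedaEquiv t).1.2 θ

lemma ext {t t' : Δ[k] ⟶ (strictPsh hW f q).obj c} (h : base t = base t')
    (h' : ∀ θ, comp t θ = comp t' θ) : t = t' :=
  SSet.yonedaEquiv.injective (Subtype.ext (Prod.ext h (funext h')))

lemma base_map {m : ℕ} (α : ⦋m⦌ ⟶ ⦋k⦌) (t : Δ[k] ⟶ (strictPsh hW f q).obj c) :
    base (SSet.stdSimplex.map α ≫ t) = base t ≫ Y.map α.op :=
  congrArg (fun z => z.1.1) (SSet.yonedaEquiv_naturality α t).symm

lemma comp_map {m : ℕ} (α : ⦋m⦌ ⟶ ⦋k⦌) (t : Δ[k] ⟶ (strictPsh hW f q).obj c) (θ : ⦋n⦌ ⟶ ⦋m⦌) :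
    comp (SSet.stdSimplex.map α ≫ t) θ = comp t (θ ≫ α) :=
  congrArg (fun z => z.1.2 θ) (SSet.yonedaEquiv_naturality α t).symm

lemma base_comp_map {d : Cᵒᵖ} (u : c ⟶ d) (t : Δ[k] ⟶ (strictPsh hW f q).obj c) :
    base (t ≫ (strictPsh hW f q).map u) = u.unop ≫ base t := rfl

lemma comp_comp_map {d : Cᵒᵖ} (u : c ⟶ d) (t : Δ[k] ⟶ (strictPsh hW f q).obj c)
    (θ : ⦋n⦌ ⟶ ⦋k⦌) : comp (t ≫ (strictPsh hW f q).map u) θ = u.unop ≫ comp t θ := rfl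

lemma yonedaEquiv_comp_to (t : Δ[k] ⟶ (strictPsh hW f q).obj c) :
    (SSet.yonedaEquiv (t ≫ (strictPshTo hW f q).app c) : c.unop ⟶ Y _⦋k⦌) = base t := rfl

lemma base_comp_toStrictPsh (x : Δ[k] ⟶ (pts.obj X).obj c) :
    base (x ≫ (toStrictPsh hW f q).app c) =
      (SSet.yonedaEquiv x : c.unop ⟶ X _⦋k⦌) ≫ f.app _ := rfl

lemma comp_comp_toStrictPsh (x : Δ[k] ⟶ (pts.obj X).obj c) (θ : ⦋n⦌ ⟶ ⦋k⦌) :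
    comp (x ≫ (toStrictPsh hW f q).app c) θ =
      (SSet.yonedaEquiv x : c.unop ⟶ X _⦋k⦌) ≫ X.map θ.op ≫ q := rfl

lemma exists_mk {y : c.unop ⟶ Y _⦋k⦌} {r : (⦋n⦌ ⟶ ⦋k⦌) → (c.unop ⟶ Q)}
    (h : IsLocalImage W f q y r) :
    ∃ t : Δ[k] ⟶ (strictPsh hW f q).obj c, base t = y ∧ ∀ θ, comp t θ = r θ := by
  let z : ((strictPsh hW f q).obj c).obj (op ⦋k⦌) := ⟨(y, r), h⟩
  have e : SSet.yonedaEquiv (SSet.yonedaEquiv.symm z) = z := SSet.yonedaEquiv.apply_symm_apply z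
  exact ⟨SSet.yonedaEquiv.symm z, congrArg (fun z => z.1.1) e,
    fun θ => congrArg (fun z => z.1.2 θ) e⟩

lemma isLocalImage (t : Δ[k] ⟶ (strictPsh hW f q).obj c) :
    IsLocalImage W f q (base t) (comp t) := (SSet.yonedaEquiv t).2

lemma exists_lift {c : C} (t : Δ[k] ⟶ (strictPsh hW f q).obj (op c)) :
    ∃ (d : C) (w : d ⟶ c) (x : Δ[k] ⟶ (pts.obj X).obj (op d)), W w ∧
      x ≫ (toStrictPsh hW f q).app (op d) = t ≫ (strictPsh hW f q).map w.op := by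
  obtain ⟨d, w, x, hw, hx, hr⟩ := isLocalImage t
  let x' : ((pts.obj X).obj (op d)).obj (op ⦋k⦌) := x
  have e : SSet.yonedaEquiv (SSet.yonedaEquiv.symm x') = x' := SSet.yonedaEquiv.apply_symm_apply x'
  refine ⟨d, w, SSet.yonedaEquiv.symm x', hw, ext ?_ fun θ => ?_⟩
  · exact (congrArg (fun z : d ⟶ X _⦋k⦌ => z ≫ f.app _) e).trans hx
  · exact (congrArg (fun z : d ⟶ X _⦋k⦌ => z ≫ X.map θ.op ≫ q) e).trans (hr θ)

/-- The components glue because `Y_k` and `Q` are representable, and being locally the image of a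
simplex of `X` can be tested on a cover. -/
lemma isSheafFor (k : ℕ) : IsSheafFor W (homPsh Δ[k] (strictPsh hW f q)) := by
  intro d c w hw (x : Δ[k] ⟶ (strictPsh hW f q).obj (op d)) hx
  have hx' : ∀ {e : C} (a b : e ⟶ d), a ≫ w = b ≫ w →
      x ≫ (strictPsh hW f q).map a.op = x ≫ (strictPsh hW f q).map b.op := hx
  obtain ⟨y, hy, -⟩ := hW.isSheafFor_yoneda (Y _⦋k⦌) w hw (base x)
    fun a b hab => congrArg base (hx' a b hab)
  have := fun θ => hW.isSheafFor_yoneda Q w hw (comp x θ)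
    fun a b hab => congrArg (comp · θ) (hx' a b hab)
  choose r hr _ using this
  have hy : w ≫ y = base x := hy
  have hr : ∀ θ, w ≫ r θ = comp x θ := hr
  obtain ⟨t, ht, ht'⟩ := exists_mk (hW := hW) (c := op c) (y := y) (r := r)
    (IsLocalImage.of_comp hW hw (by
      have := isLocalImage x
      rw [← hy] at this
      convert this using 2
      exact hr _))
  have htx : t ≫ (strictPsh hW f q).map w.op = x := by
    refine ext ?_ fun θ => ?_
    · rw [base_comp_map, ht]
      exact hy
    · rw [comp_comp_map, ht']
      exact hr θ
  refine ⟨t, htx, fun (t' : Δ[k] ⟶ (strictPsh hW f q).obj (op c)) ht' => ?_⟩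
  have ht'x : t' ≫ (strictPsh hW f q).map w.op = t ≫ (strictPsh hW f q).map w.op :=
    Eq.trans ht' htx.symm
  refine ext ?_ fun θ => ?_
  · exact IsSheafFor.ext (hW.isSheafFor_yoneda (Y _⦋k⦌)) w hw (congrArg base ht'x)
  · exact IsSheafFor.ext (hW.isSheafFor_yoneda Q) w hw (congrArg (comp · θ) ht'x)

end strictPsh

end

/-! ### Properties of the construction -/

section

open SimplexCategory

variable {W : MorphismProperty C} {X Y : SimplicialObject C} {f : X ⟶ Y} {n : ℕ} {Q : C}
  {q : X _⦋n⦌ ⟶ Q} {hW : IsCovers W}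

namespace strictPsh

lemma exists_lift₂ {k : ℕ} {c : C} (t t' : Δ[k] ⟶ (strictPsh hW f q).obj (op c)) :
    ∃ (d : C) (w : d ⟶ c) (x x' : Δ[k] ⟶ (pts.obj X).obj (op d)), W w ∧
      x ≫ (toStrictPsh hW f q).app (op d) = t ≫ (strictPsh hW f q).map w.op ∧
      x' ≫ (toStrictPsh hW f q).app (op d) = t' ≫ (strictPsh hW f q).map w.op := by
  obtain ⟨d, w, x, hw, hx⟩ := exists_lift t
  obtain ⟨d', w', x', hw', hx'⟩ := exists_lift (t' ≫ (strictPsh hW f q).map w.op)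
  refine ⟨d', w' ≫ w, x ≫ (pts.obj X).map w'.op, x', hW.isMultiplicative.comp_mem _ _ hw' hw,
    ?_, ?_⟩
  · rw [Category.assoc, NatTrans.naturality, ← Category.assoc, hx, op_comp, Functor.map_comp,
      Category.assoc]
  · rw [hx', op_comp, Functor.map_comp, Category.assoc]

lemma ext_of_cover {k : ℕ} {c d : C} {t t' : Δ[k] ⟶ (strictPsh hW f q).obj (op c)} {w : d ⟶ c}
    (hw : W w) (h : t ≫ (strictPsh hW f q).map w.op = t' ≫ (strictPsh hW f q).map w.op) : t = t' :=
  IsSheafFor.ext (isSheafFor (hW := hW) (f := f) (q := q) k) w hw h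

lemma comp_id_comp_toStrictPsh {c : Cᵒᵖ} (x : Δ[n] ⟶ (pts.obj X).obj c) :
    comp (x ≫ (toStrictPsh hW f q).app c) (𝟙 _) = (SSet.yonedaEquiv x : c.unop ⟶ X _⦋n⦌) ≫ q := by
  refine (comp_comp_toStrictPsh x (𝟙 _)).trans ?_
  rw [op_id, X.map_id, Category.id_comp]

lemma ext_of_faces {k : ℕ} (hk : n ≤ k) {c : Cᵒᵖ} {t t' : Δ[k + 1] ⟶ (strictPsh hW f q).obj c}
    (h : base t = base t') (h' : ∀ j, SSet.stdSimplex.δ j ≫ t = SSet.stdSimplex.δ j ≫ t') :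
    t = t' := by
  refine ext h fun θ => ?_
  obtain ⟨j, hj⟩ := exists_misses θ (by omega)
  obtain ⟨β, rfl⟩ := hj.exists_eq_comp_δ
  exact (comp_map (δ j) t β).symm.trans
    ((congrArg (comp · β) (h' j)).trans (comp_map (δ j) t' β))

/-- The `n`-simplices are represented by `Q`. -/
def toOrbitSpace (hW : IsCovers W) (f : X ⟶ Y) (q : X _⦋n⦌ ⟶ Q) :
    homPsh Δ[n] (strictPsh hW f q) ⟶ yoneda.obj Q where
  app c := ↾fun t => comp t (𝟙 _)

lemma simplexIso_toOrbitSpace :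
    (simplexIso X n).hom ≫ homPost Δ[n] (toStrictPsh hW f q) ≫ toOrbitSpace hW f q =
      yoneda.map q := by
  ext c x
  refine (comp_id_comp_toStrictPsh (hW := hW) (f := f) _).trans ?_
  exact congrArg (fun z : c.unop ⟶ X _⦋n⦌ => z ≫ q) (SSet.yonedaEquiv.apply_symm_apply _)

variable (hq : IsOrbitSpace W (higherMorphisms n f) (higherMorphismsVertices n f) q)

include hq

/-- Locally both simplices come from `X`, and the class in `Q` of an n-simplex determines its base
and the classes of all its images under endomorphisms of `[n]`. -/
lemma ext_of_comp_id {c : Cᵒᵖ} {t t' : Δ[n] ⟶ (strictPsh hW f q).obj c}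
    (h : comp t (𝟙 _) = comp t' (𝟙 _)) : t = t' := by
  obtain ⟨d, w, x, x', hw, hx, hx'⟩ := exists_lift₂ (c := c.unop) t t'
  refine ext_of_cover (c := c.unop) hw ?_
  have e : (SSet.yonedaEquiv x : d ⟶ X _⦋n⦌) ≫ q = (SSet.yonedaEquiv x' : d ⟶ X _⦋n⦌) ≫ q := by
    rw [← comp_id_comp_toStrictPsh (hW := hW) (f := f) (c := op d) x,
      ← comp_id_comp_toStrictPsh (hW := hW) (f := f) (c := op d) x', hx, hx']
    exact congrArg (w ≫ ·) h
  rw [← hx, ← hx']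
  exact ext (hq.comp_base_eq e) fun θ => hq.comp_map_eq' e θ

lemma isIso_toOrbitSpace : IsIso (toOrbitSpace hW f q) := by
  refine isIso_of_isSheafFor (W := W) _ (isSheafFor n) (hW.isSheafFor_yoneda Q)
    (fun c t t' h => ext_of_comp_id hq h) fun {c} y => ?_
  obtain ⟨d, w, x, hw, hx⟩ := exists_lift_of_presheaf (hW.presheaf_map hq.cover) y
  refine ⟨d, w, (SSet.yonedaEquiv (n := ⦋n⦌) (X := (pts.obj X).obj (op d))).symm x ≫
    (toStrictPsh hW f q).app (op d), hw, ?_⟩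
  refine (comp_id_comp_toStrictPsh (hW := hW) (f := f) _).trans (Eq.trans ?_ hx)
  exact congrArg (fun z : d ⟶ X _⦋n⦌ => z ≫ q) (SSet.yonedaEquiv.apply_symm_apply _)

lemma isIso_homPost_toStrictPsh {k : ℕ} (hk : k < n) :
    IsIso (homPost Δ[k] (toStrictPsh hW f q)) := by
  refine isIso_of_isSheafFor (W := W) _
    (hW.isSheafFor (Functor.IsRepresentable.mk' (simplexIso X k))) (isSheafFor k) ?_ ?_
  · intro c (x : Δ[k] ⟶ (pts.obj X).obj c) (x' : Δ[k] ⟶ (pts.obj X).obj c) e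
    have e : x ≫ (toStrictPsh hW f q).app c = x' ≫ (toStrictPsh hW f q).app c := e
    -- Pulling back along the retraction `θ` raises `x` to dimension `n`, where its class in `Q` is
    -- recorded. Its section `s` misses the last vertex, so restricting along `s` depends only on
    -- that class and recovers `x`.
    let θ : ⦋n⦌ ⟶ ⦋k⦌ := Hom.mk ⟨fun (t : Fin (n + 1)) => (⟨min t.1 k, by omega⟩ : Fin (k + 1)), fun a b hab => by
      have : a.1 ≤ b.1 := hab
      simp only [Fin.mk_le_mk]
      omega⟩
    let s : ⦋k⦌ ⟶ ⦋n⦌ := Hom.mk ⟨fun (t : Fin (k + 1)) => (⟨t.1, by omega⟩ : Fin (n + 1)), fun a b hab => hab⟩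
    have hsθ : s ≫ θ = 𝟙 _ := hom_ext_val fun (t : Fin (k + 1)) =>
      min_eq_left (Nat.lt_succ_iff.1 t.2)
    have hs : Misses s (Fin.last n) := fun (t : Fin (k + 1)) e => by
      have : t.1 = n := congrArg Fin.val e
      omega
    have h1 : ∀ x : c.unop ⟶ X _⦋k⦌, (x ≫ X.map θ.op) ≫ X.map s.op = x := fun x => by
      rw [Category.assoc, ← X.map_comp, ← op_comp, hsθ, op_id, X.map_id, Category.comp_id]
    have h2 := congrArg (comp · θ) e
    refine SSet.yonedaEquiv.injective ?_
    refine (h1 _).symm.trans (Eq.trans ?_ (h1 _))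
    refine hq.comp_map_eq ?_ s hs
    exact (Category.assoc _ _ _).trans (h2.trans (Category.assoc _ _ _).symm)
  · intro c y
    obtain ⟨d, w, x, hw, hx⟩ := exists_lift y
    exact ⟨d, w, x, hw, hx⟩

variable (hC : EnoughPoints W) {N : ℕ∞} (hf : IsStack W N f)

include hC hf

lemma exchange {c : Cᵒᵖ} (x x' : Δ[n + 1] ⟶ (pts.obj X).obj c) (i : Fin (n + 2))
    (hx : x ≫ (pts.map f).app c = x' ≫ (pts.map f).app c)
    (hxx' : ∀ j ≠ i, SSet.stdSimplex.δ j ≫ x ≫ (toStrictPsh hW f q).app c =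
      SSet.stdSimplex.δ j ≫ x' ≫ (toStrictPsh hW f q).app c) :
    SSet.stdSimplex.δ i ≫ x ≫ (toStrictPsh hW f q).app c =
      SSet.stdSimplex.δ i ≫ x' ≫ (toStrictPsh hW f q).app c := by
  have e := fun (j : Fin (n + 2)) (x : Δ[n + 1] ⟶ (pts.obj X).obj c) =>
    (congrArg (comp · (𝟙 _)) (Category.assoc (SSet.stdSimplex.δ j) x
      ((toStrictPsh hW f q).app c))).symm.trans
      (comp_id_comp_toStrictPsh (hW := hW) (f := f) (q := q) (SSet.stdSimplex.δ j ≫ x))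
  refine ext_of_comp_id hq ((e i x).trans (Eq.trans ?_ (e i x').symm))
  refine hq.exchange_stdSimplex hW hC hf i x x' hx fun j hj => ?_
  exact (e j x).symm.trans ((congrArg (comp · (𝟙 _)) (hxx' j hj)).trans (e j x'))

lemma face_eq {c : Cᵒᵖ} (t t' : Δ[n + 1] ⟶ (strictPsh hW f q).obj c) (i : Fin (n + 2))
    (ht : base t = base t')
    (htt' : ∀ j ≠ i, SSet.stdSimplex.δ j ≫ t = SSet.stdSimplex.δ j ≫ t') :
    SSet.stdSimplex.δ i ≫ t = SSet.stdSimplex.δ i ≫ t' := by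
  obtain ⟨d, w, x, x', hw, hx, hx'⟩ := exists_lift₂ (c := c.unop) t t'
  refine ext_of_cover (c := c.unop) hw ?_
  refine (Category.assoc _ _ _).trans (Eq.trans ?_ (Category.assoc _ _ _).symm)
  rw [← hx, ← hx']
  refine exchange hq hC hf x x' i (SSet.yonedaEquiv.injective ?_) fun j hj => ?_
  · have e1 := congrArg base hx
    have e2 := congrArg base hx'
    rw [base_comp_toStrictPsh (c := op d)] at e1 e2
    exact e1.trans ((congrArg (w ≫ ·) ht).trans e2.symm)
  · rw [hx, hx', ← Category.assoc, ← Category.assoc, htt' j hj]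

theorem isWeakStrictification :
    IsWeakStrictification W n (toStrictPsh hW f q) (strictPshTo hW f q) where
  isIso k hk := isIso_homPost_toStrictPsh hq hk
  cover := by
    have := isIso_toOrbitSpace (hW := hW) hq
    refine (hW.presheaf_iff_of_representableBy (simplexIso X n)
      (asIso (toOrbitSpace hW f q)).symm q ?_).2 hq.cover
    rw [Iso.symm_hom, asIso_inv, IsIso.comp_inv_eq, Category.assoc, simplexIso_toOrbitSpace]
  isRepresentable :=
    have := isIso_toOrbitSpace (hW := hW) hq
    Functor.IsRepresentable.mk' (asIso (toOrbitSpace hW f q)).symm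
  isSheafFor k _ := isSheafFor k
  ext k hk c t t' e ht := by
    have hb : base t = base t' := congrArg SSet.yonedaEquiv e
    refine ext_of_faces hk hb fun j => ?_
    by_cases hj : k = n → j ≠ 1
    · exact ht j hj
    · push Not at hj
      obtain ⟨rfl, rfl⟩ := hj
      exact face_eq hq hC hf t t' 1 hb fun j hj => ht j fun _ => hj
  exch c x x' i e hxx' := exchange hq hC hf x x' i e hxx'

end strictPsh

end

/-! ### Relative coskeletality -/

section

open SimplexCategory

variable {W : MorphismProperty C} {X Y : SimplicialObject C} {f : X ⟶ Y} {n : ℕ} {Q : C}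
  {q : X _⦋n⦌ ⟶ Q} {hW : IsCovers W}

lemma range_map_le_skeleton {k l d : ℕ} (h : l < d) (α : ⦋l⦌ ⟶ ⦋k⦌) :
    SSet.Subcomplex.range (SSet.stdSimplex.{v}.map α) ≤ SSet.skeleton Δ[k] d := by
  rintro m _ ⟨x, rfl⟩
  exact (SSet.skeleton Δ[k] d).map (SSet.stdSimplex.objEquiv x).op
    (SSet.mem_skeleton _ (SSet.stdSimplex.objEquiv.symm α) h)

/-- A simplex of dimension `l < d`, as a map to the skeleton. -/
def skeletonMap {k l d : ℕ} (h : l < d) (α : ⦋l⦌ ⟶ ⦋k⦌) :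
    (Δ[l] : SSet.{v}) ⟶ (SSet.skeleton Δ[k] d).toSSet :=
  SSet.Subcomplex.lift (SSet.stdSimplex.map α) (range_map_le_skeleton h α)

lemma skeletonMap_ι {k l d : ℕ} (h : l < d) (α : ⦋l⦌ ⟶ ⦋k⦌) :
    skeletonMap.{v} h α ≫ (SSet.skeleton Δ[k] d).ι = SSet.stdSimplex.map α :=
  SSet.Subcomplex.lift_ι _ _

lemma map_skeletonMap {k l m d : ℕ} (h : l < d) (h' : m < d) (α : ⦋l⦌ ⟶ ⦋k⦌) (β : ⦋m⦌ ⟶ ⦋l⦌) :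
    SSet.stdSimplex.map β ≫ skeletonMap.{v} h α = skeletonMap h' (β ≫ α) := by
  rw [← cancel_mono (SSet.skeleton Δ[k] d).ι, Category.assoc, skeletonMap_ι, skeletonMap_ι]
  exact (SSet.stdSimplex.map_comp β α).symm

lemma skeleton_hom_ext' {A : SSet.{v}} {k d : ℕ} {s s' : (SSet.skeleton Δ[k] d).toSSet ⟶ A}
    (h : ∀ l (hl : l < d) (α : ⦋l⦌ ⟶ ⦋k⦌), skeletonMap hl α ≫ s = skeletonMap hl α ≫ s') :
    s = s' := by
  refine skeleton_hom_ext fun l hl x => ?_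
  have e := fun s : (SSet.skeleton Δ[k] d).toSSet ⟶ A => congrArg (fun z => s.app (op ⦋l⦌) z)
    (Subtype.ext (SSet.yonedaEquiv_map (SSet.stdSimplex.objEquiv x)) :
      SSet.yonedaEquiv (skeletonMap hl (SSet.stdSimplex.objEquiv x)) =
        ⟨x, SSet.mem_skeleton _ x hl⟩)
  exact (e s).symm.trans ((congrArg SSet.yonedaEquiv (h l hl _)).trans (e s'))

/-- Such a map misses at least two vertices, so its image is contained in a face of the horn at 0.
-/
lemma exists_misses_ne_zero {k l : ℕ} (α : ⦋l⦌ ⟶ ⦋k + 1⦌) (h : l < k) :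
    ∃ j, j ≠ 0 ∧ Misses α j := by
  obtain ⟨j, hj⟩ := exists_misses α (by omega)
  rcases eq_or_ne j 0 with rfl | hj0
  · obtain ⟨β, rfl⟩ := hj.exists_eq_comp_δ
    obtain ⟨i, hi⟩ := exists_misses β h
    exact ⟨_, Fin.succAbove_ne _ _, hi.comp_δ 0⟩
  · exact ⟨j, hj0, hj⟩

namespace strictPsh

variable (hH : ∀ k, n < k → ∀ i : Fin (k + 1),
  IsIso (toRel (SSet.horn k i).ι (strictPshTo hW f q)))

include hH

/-- Induction on `k`: the faces are simplices of `strictPsh` by hypothesis, and those other than the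
face 0 form a horn. The filler is a local image by construction, and it is the given simplex because
its components are read off from the horn. -/
lemma isLocalImage_of_skeleton {c : C} {k : ℕ} (y : c ⟶ Y _⦋k⦌) (r : (⦋n⦌ ⟶ ⦋k⦌) → (c ⟶ Q))
    (h : ∀ l ≤ n + 1, ∀ α : ⦋l⦌ ⟶ ⦋k⦌,
      IsLocalImage W f q (y ≫ Y.map α.op) (fun θ => r (θ ≫ α))) : IsLocalImage W f q y r := by
  induction k with
  | zero =>
    have := h 0 (by omega) (𝟙 _)
    simpa only [op_id, Y.map_id, Category.comp_id] using this
  | succ k IH =>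
  rcases le_or_gt (k + 1) (n + 1) with hk | hk
  · have := h (k + 1) hk (𝟙 _)
    simpa only [op_id, Y.map_id, Category.comp_id] using this
  have h1 : ∀ j, ∃ t : Δ[k] ⟶ (strictPsh hW f q).obj (op c), base t = y ≫ Y.map (δ j).op ∧
      ∀ θ, comp t θ = r (θ ≫ δ j) := fun j => exists_mk (c := op c) (IH _ _ fun l hl α => by
    have := h l hl (α ≫ δ j)
    rw [op_comp, Y.map_comp, ← Category.assoc] at this
    simpa only [Category.assoc] using this)
  choose t ht ht' using h1
  have hcompat : IsCompatible (i := 0) ((strictPsh hW f q).obj (op c))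
      (fun j => SSet.yonedaEquiv (t j.1)) :=
    isCompatible_of_le _ fun j l m _ α β e => by
      refine (SSet.yonedaEquiv_naturality α (t j.1)).trans (Eq.trans ?_
        (SSet.yonedaEquiv_naturality β (t l.1)).symm)
      refine congrArg SSet.yonedaEquiv (ext ?_ fun θ => ?_)
      · rw [base_map, base_map, ht, ht, Category.assoc, Category.assoc, ← Y.map_comp,
          ← Y.map_comp, ← op_comp, ← op_comp, e]
      · rw [comp_map, comp_map, ht', ht', Category.assoc, Category.assoc, e]
  obtain ⟨s, hs⟩ := hcompat.exists_desc
  have hs : ∀ j : {j : Fin (k + 2) // j ≠ 0}, SSet.horn.ι 0 j.1 j.2 ≫ s = t j.1 :=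
    fun j => SSet.yonedaEquiv.injective (hs j)
  let y' : Δ[k + 1] ⟶ (pts.obj Y).obj (op c) :=
    SSet.yonedaEquiv.symm (y : ((pts.obj Y).obj (op c)).obj (op ⦋k + 1⦌))
  have hy' : SSet.yonedaEquiv y' = y := SSet.yonedaEquiv.apply_symm_apply _
  have hsy : s ≫ (strictPshTo hW f q).app (op c) = (SSet.horn (k + 1) 0).ι ≫ y' := by
    refine horn_hom_ext fun j => SSet.yonedaEquiv.injective ?_
    rw [← Category.assoc, hs, ← Category.assoc, SSet.horn.ι_ι]
    refine (ht j.1).trans (Eq.trans ?_ (yonedaEquiv_map_comp (δ j.1) y').symm)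
    exact congrArg (fun z : c ⟶ Y _⦋k + 1⦌ => z ≫ Y.map (δ j.1).op) hy'.symm
  have := hH (k + 1) (by omega) 0
  obtain ⟨u, hu⟩ := (bijective_of_isIso (toRel (SSet.horn (k + 1) 0).ι (strictPshTo hW f q))
    (op c)).2 ⟨(s, y'), hsy⟩
  change Δ[k + 1] ⟶ (strictPsh hW f q).obj (op c) at u
  have hu1 : (SSet.horn (k + 1) 0).ι ≫ u = s := congrArg (fun z => z.1.1) hu
  have hu2 : base u = y := (congrArg (fun z => SSet.yonedaEquiv z.1.2) hu).trans hy'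
  have hu3 : ∀ θ, comp u θ = r θ := fun θ => by
    -- Here the dimension is above `n + 1`, which leaves room for a missed vertex other than 0; so
    -- the face 0 need not be compared.
    obtain ⟨j, hj0, hj⟩ := exists_misses_ne_zero θ (by omega)
    obtain ⟨β, rfl⟩ := hj.exists_eq_comp_δ
    rw [← ht' j β, ← hs ⟨j, hj0⟩, ← hu1, ← Category.assoc, SSet.horn.ι_ι]
    exact (comp_map (δ j) u β).symm
  have := isLocalImage u
  rw [hu2] at this
  exact (funext hu3 : comp u = r) ▸ this

/-- The n-simplices of the skeleton supply the maps to `Q`, and its simplices of dimension up to `n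
+ 1` are local images, which suffices in all dimensions. -/
theorem isIso_toRel_skeleton (k : ℕ) :
    IsIso (toRel (SSet.skeleton Δ[k] (n + 2)).ι (strictPshTo hW f q)) := by
  refine isIso_presheaf _ fun c => ⟨?_, fun ⟨⟨s, y⟩, hsy⟩ => ?_⟩
  · intro (t : Δ[k] ⟶ (strictPsh hW f q).obj c) (t' : Δ[k] ⟶ (strictPsh hW f q).obj c) e
    have e1 : (SSet.skeleton Δ[k] (n + 2)).ι ≫ t = (SSet.skeleton Δ[k] (n + 2)).ι ≫ t' :=
      congrArg (fun z => z.1.1) e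
    refine ext (congrArg (fun z => SSet.yonedaEquiv z.1.2) e) fun θ => ?_
    have := comp_eq_of_range_le e1 _ (range_map_le_skeleton (by omega) θ)
    rw [← Category.id_comp θ, ← comp_map, ← comp_map, this]
  · have hsy : s ≫ (strictPshTo hW f q).app c = (SSet.skeleton Δ[k] (n + 2)).ι ≫ y := hsy
    have hb : ∀ {l : ℕ} (hl : l < n + 2) (α : ⦋l⦌ ⟶ ⦋k⦌), base (skeletonMap hl α ≫ s) =
        (SSet.yonedaEquiv y : c.unop ⟶ Y _⦋k⦌) ≫ Y.map α.op := fun hl α => by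
      refine Eq.trans ?_ (yonedaEquiv_map_comp α y)
      rw [← yonedaEquiv_comp_to, Category.assoc, hsy, ← Category.assoc, skeletonMap_ι]
    have hc : ∀ {l : ℕ} (hl : l < n + 2) (α : ⦋l⦌ ⟶ ⦋k⦌) (θ : ⦋n⦌ ⟶ ⦋l⦌),
        comp (skeletonMap hl α ≫ s) θ =
          comp (skeletonMap (show n < n + 2 by omega) (θ ≫ α) ≫ s) (𝟙 _) := fun hl α θ => by
      rw [← map_skeletonMap hl, Category.assoc, comp_map, Category.id_comp]
    obtain ⟨t, ht, ht'⟩ := exists_mk (c := c) (isLocalImage_of_skeleton hH (c := c.unop)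
      (SSet.yonedaEquiv y : c.unop ⟶ Y _⦋k⦌)
      (fun θ => comp (skeletonMap (show n < n + 2 by omega) θ ≫ s) (𝟙 _)) fun l hl α => by
        have := isLocalImage (skeletonMap (show l < n + 2 by omega) α ≫ s)
        rw [hb] at this
        exact (funext (hc _ α) : comp (skeletonMap (show l < n + 2 by omega) α ≫ s) = _) ▸ this)
    refine ⟨t, Subtype.ext (Prod.ext (skeleton_hom_ext' fun l hl α => ?_)
      (SSet.yonedaEquiv.injective ht))⟩
    refine (Category.assoc _ _ _).symm.trans ?_
    rw [skeletonMap_ι]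
    refine ext ?_ fun θ => ?_
    · rw [base_map, hb, ht]
    · rw [comp_map, hc, ht']

end strictPsh

end

/-! ### Existence of the strictification -/

section

open SimplexCategory

variable {X Y : SimplicialObject C}

lemma pts_map_injective {f g : X ⟶ Y} (h : pts.map f = pts.map g) : f = g := by
  ext k
  have := ConcreteCategory.congr_hom (congr_app (congr_app h (op (X.obj k))) k) (𝟙 (X.obj k))
  exact (Category.id_comp _).symm.trans (this.trans (Category.id_comp _))

lemma exists_pts_map_eq (φ : pts.obj X ⟶ pts.obj Y) : ∃ f : X ⟶ Y, pts.map f = φ := by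
  let m (k : SimplexCategoryᵒᵖ) : X.obj k ⟶ Y.obj k := (φ.app (op (X.obj k))).app k (𝟙 (X.obj k))
  have hm : ∀ (c : Cᵒᵖ) (k : SimplexCategoryᵒᵖ) (x : c.unop ⟶ X.obj k),
      (φ.app c).app k x = x ≫ m k := fun c k x => by
    have := ConcreteCategory.congr_hom (congr_app (φ.naturality x.op) k) (𝟙 (X.obj k))
    exact (congrArg (fun z => (φ.app c).app k z) (Category.comp_id x).symm).trans this
  refine ⟨{ app := m, naturality := fun k l α => ?_ }, ?_⟩
  · refine (hm (op (X.obj k)) l (X.map α)).symm.trans ?_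
    have := ConcreteCategory.congr_hom ((φ.app (op (X.obj k))).naturality α) (𝟙 (X.obj k))
    exact (congrArg (fun z => (φ.app (op (X.obj k))).app l z) (Category.id_comp (X.map α)).symm).trans
      this
  · refine NatTrans.ext (funext fun c => NatTrans.ext (funext fun k =>
      ConcreteCategory.hom_ext _ _ fun x => ?_))
    exact (hm c k x).symm

/-- The Yoneda embedding is fully faithful, so levelwise representing objects assemble into a
simplicial object. -/
lemma exists_pts_iso (T : Cᵒᵖ ⥤ SSet.{v}) (hT : ∀ k : ℕ, (homPsh Δ[k] T).IsRepresentable) :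
    ∃ T' : SimplicialObject C, Nonempty (pts.obj T' ≅ T) := by
  let G : SimplexCategoryᵒᵖ ⥤ Cᵒᵖ ⥤ Type v :=
    Functor.flip (show Cᵒᵖ ⥤ SimplexCategoryᵒᵖ ⥤ Type v from T)
  have hG : ∀ k, yoneda.essImage (G.obj k) := fun ⟨⟨k⟩⟩ => by
    have := hT k
    let e : homPsh Δ[k] T ≅ G.obj (op ⦋k⦌) := NatIso.ofComponents
      (fun c => Equiv.toIso (SSet.yonedaEquiv (X := T.obj c) (n := ⦋k⦌))) (fun u => rfl)
    exact ⟨_, ⟨(homPsh Δ[k] T).representableBy.toIso ≪≫ e⟩⟩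
  let e := Functor.essImage.liftFunctorCompIso G yoneda hG
  refine ⟨Functor.essImage.liftFunctor G yoneda hG, ⟨NatIso.ofComponents (fun c =>
    NatIso.ofComponents (fun k => (e.app k).app c) fun {k l} α => ?_) fun {c d} u => ?_⟩⟩
  · exact congr_app (e.hom.naturality α) c
  · exact NatTrans.ext (funext fun k => (e.hom.app k).naturality u)

variable {W : MorphismProperty C} {f : X ⟶ Y} {n : ℕ}

lemma IsOrbitSpace.comp_iso (hW : IsCovers W) {P : Cᵒᵖ ⥤ SSet.{v}} {A : C}
    {e : (P ⋙ (evaluation _ _).obj (op ⦋0⦌)).RepresentableBy A} {Q : C} {q : A ⟶ Q}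
    (hq : IsOrbitSpace W P e q) {Q' : C} (i : Q ≅ Q') : IsOrbitSpace W P e (q ≫ i.hom) where
  cover := by
    have := hW.respectsIso
    exact (W.cancel_right_of_respectsIso q i.hom).2 hq.cover
  condition p := by rw [← Category.assoc, hq.condition, Category.assoc]
  desc ε hε := by
    obtain ⟨u, hu, hu'⟩ := hq.desc ε hε
    refine ⟨i.inv ≫ u, by simpa using hu, fun v hv => ?_⟩
    rw [← hu' (i.hom ≫ v) (by simpa using hv), Iso.inv_hom_id_assoc]

lemma isIso_toRel_comp {S U : SSet.{v}} {E T B : Cᵒᵖ ⥤ SSet.{v}} (i : S ⟶ U) (e : E ⟶ T) [IsIso e]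
    (g : T ⟶ B) [IsIso (toRel i g)] : IsIso (toRel i (e ≫ g)) := by
  have w : (e ≫ g) ≫ 𝟙 B = e ≫ g := Category.comp_id _
  have := isIso_rel_post i e (𝟙 B) w
  have : IsIso (toRel i (e ≫ g) ≫ rel.post i e (𝟙 B) w) := by
    rw [toRel_comp_rel_post]
    infer_instance
  exact IsIso.of_isIso_comp_right _ (rel.post i e (𝟙 B) w)

/-- If `toRel` is invertible, `X_k` itself is the required limit. -/
lemma exists_isIso_relMap {S : SSet.{v}} {k : ℕ} (i : S ⟶ Δ[k])
    (h : IsIso (toRel i (pts.map f))) :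
    ∃ (L : C) (R : (relPresheaf i f).RepresentableBy L), IsIso (relMap i f R) := by
  obtain ⟨L, ⟨R⟩⟩ : (rel i (pts.map f)).IsRepresentable :=
    isRepresentable_of_isIso (inv (toRel i (pts.map f))) (Functor.IsRepresentable.mk' (simplexIso X k))
  exact ⟨L, R, (isIso_relMap_iff i f R).2 h⟩

theorem exists_isStrictification (hW : IsCovers W) (hC : EnoughPoints W) (hf : IsStack W ⊤ f)
    (hπ : OrbitSpaceExists W n f) :
    ∃ (T : SimplicialObject C) (g : T ⟶ Y) (q : X ⟶ T), IsStrictification W n f g q := by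
  obtain ⟨Q, q, hq⟩ := hπ
  have hw := strictPsh.isWeakStrictification (hW := hW) hq hC hf
  have hE := Functor.IsRepresentable.mk' (simplexIso X 0)
  have hB := fun k hk i => hf.target.presheaf_homPre hW k hk i
  have hH : ∀ k, 0 < k → ∀ i : Fin (k + 1), IsWeakStrictification.HornProp W n (toStrictPsh hW f q)
      (strictPshTo hW f q) k i := by
    intro k hk i
    obtain ⟨k, rfl⟩ : ∃ l, k = l + 1 := ⟨k - 1, by omega⟩
    exact hw.hornProp hW hE (fun k hk i => (hf.presheaf_toRel hW k hk i).2.1) hB k i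
  have hH' : ∀ k, n < k → ∀ i : Fin (k + 1), IsIso (toRel (SSet.horn k i).ι (strictPshTo hW f q)) :=
    fun k hk i => (hH k (by omega) i).2.1 hk
  have hT0 := hw.isRepresentable_zero hE
  -- In positive dimensions the simplices cover a relative horn object, which is representable; the
  -- vertices are represented by `X_0`, or by `Q` if `n = 0`.
  obtain ⟨T, ⟨e⟩⟩ := exists_pts_iso (strictPsh hW f q) fun k => by
    rcases k with _ | k
    · exact hT0
    · exact isRepresentable_of_presheaf (hH (k + 1) k.succ_pos 0).1
        (IsWeakStrictification.isRepresentable_rel_horn hW hT0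
          (fun m _ h0 i => (hH m h0 i).1) hB 0)
  obtain ⟨g, hg⟩ := exists_pts_map_eq (e.hom ≫ strictPshTo hW f q)
  obtain ⟨q', hq'⟩ := exists_pts_map_eq (toStrictPsh hW f q ≫ e.inv)
  refine ⟨T, g, q', pts_map_injective ?_, fun k hk => ?_, ?_, ?_, fun k => ?_⟩
  · rw [Functor.map_comp, hq', hg, Category.assoc, e.inv_hom_id_assoc, toStrictPsh_comp]
  · refine (isIso_iff_of_representableBy (simplexIso X k) (simplexIso T k) _
      (simplexIso_homPost q' k)).1 ?_
    have := hw.isIso k hk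
    rw [hq', homPost_comp]
    infer_instance
  · have := strictPsh.isIso_toOrbitSpace (hW := hW) hq
    -- Both sides represent the n-simplices of `strictPsh`, so `q'` in degree `n` is the orbit map
    -- up to an isomorphism of the target.
    let i : yoneda.obj Q ≅ yoneda.obj (T _⦋n⦌) := (asIso (strictPsh.toOrbitSpace hW f q)).symm ≪≫
      asIso (homPost Δ[n] e.inv) ≪≫ (simplexIso T n).symm
    have hi : q ≫ (Yoneda.fullyFaithful.preimageIso i).hom = q'.app (op ⦋n⦌) := by
      refine yoneda.map_injective ?_
      rw [Functor.map_comp, Functor.FullyFaithful.preimageIso_hom,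
        Functor.FullyFaithful.map_preimage, ← strictPsh.simplexIso_toOrbitSpace (hW := hW) (f := f),
        ← cancel_mono (simplexIso T n).hom, simplexIso_homPost, hq', homPost_comp]
      simp [i]
    rw [← hi]
    exact hq.comp_iso hW _
  · refine exists_isIso_relMap _ ?_
    rw [hg]
    have := hH' (n + 1) (by omega) 1
    exact isIso_toRel_comp _ e.hom _
  · refine exists_isIso_relMap _ ?_
    rw [hg]
    have := strictPsh.isIso_toRel_skeleton hH' k
    exact isIso_toRel_comp _ e.hom _

end

end HigherStack

theorem mainTheorem3 {C : Type u} [Category.{v} C] (W : MorphismProperty C)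
    (hW : HigherStack.IsCovers W) (hC : HigherStack.EnoughPoints W)
    (n : ℕ) {X Y : SimplicialObject C} (f : X ⟶ Y) (hf : HigherStack.IsStack W ⊤ f)
    (hπ : HigherStack.OrbitSpaceExists W n f) :
    (∃ (T : SimplicialObject C) (g : T ⟶ Y) (q : X ⟶ T),
      HigherStack.IsStrictification W n f g q) ∧
    ∀ (T : SimplicialObject C) (g : T ⟶ Y) (q : X ⟶ T),
      HigherStack.IsStrictification W n f g q →
        HigherStack.IsStack W n g ∧
        (Nonempty (Arrow.mk f ≅ Arrow.mk g) ↔ HigherStack.IsStack W n f) ∧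
        (Nonempty (Over.mk f ≅ Over.mk g) ↔ HigherStack.IsStack W n f) ∧
        (IsIso q ↔ HigherStack.IsStack W n f) := by
  refine ⟨HigherStack.exists_isStrictification hW hC hf hπ, fun T g q h => ?_⟩
  have hg := h.isStack hW hC hf
  exact ⟨hg, h.tfae hf hg⟩
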